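/- **Setting.** Let $d\ge 1$, $T>0$, and let $S_d=\{m\in\mathbb R^d: m_i\ge 0,\ \sum_i m_i=1\}$, $\mathrm{Int}(S_d)=\{m\in S_d: m_i>0\ \forall i\}$. Let $A$ be a (nonempty) action space, $Q_{i,j}:[0,T]\times A\times S_d\to[0,\infty)$ transition rates, $f^i:[0,T]\times A\times S_d\to\mathbb R$ running costs, $g^i:S_d\to\mathbb R$ terminal costs ($1\le i,j\le d$), and put $F(t,a,m)=\sum_i m_i f^i(t,a^i,m)$ for $a=(a^1,\dots,a^d)\in A^d$, and $G(m)=\sum_i m_i g^i(m)$. For $(t_0,m_0)\in[0,T]\times S_d$ and a measurable control $\alpha:[t_0,T]\to A^d$, let $\mu:[t_0,T]\to S_d$ solve $$\tfrac{d}{dt}\mu^i_t=\sum_j\big(\mu^j_tQ_{j,i}(t,\alpha^j(t),\mu_t)-\mu^i_tQ_{i,j}(t,\alpha^i(t),\mu_t)\big),\qquad \mu_{t_0}=m_0$$ (in integral form). Let $J(t_0,\alpha,\mu)=\int_{t_0}^TF(t,\alpha(t),\mu_t)\,dt+G(\mu_T)$, and let $V(t_0,m_0)$ be the infimum of the costs.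 An optimal control (for given $(t_0,m_0)$) is one of minimal cost. For a function $v$ of $m\in S_d$ let $D^iv=(\partial_{m_j-m_i}v)_{j}$ be the derivatives along the directions $\delta_j-\delta_i$. $C^1$ on $I\times S_d$ ($I$ a time interval) means $C^1$ in the interior with derivatives extending continuously to the boundary; $C^{1,1}$ means moreover that the derivatives are globally Lipschitz. For $z\in\mathbb R^d$ with $z_i=0$ let $\mathcal H^i(t,a,m,z)=-\sum_jQ_{i,j}(t,a,m)z_j-f^i(t,a,m)$ and $H^i(t,m,z)=\max_{a\in A}\mathcal H^i(t,a,m,z)$. Consider $$\text{(HJB)}\qquad -\partial_tv+\sum_i m_iH^i(t,m,D^iv)=0,\qquad v(T,m)=G(m).$$ For $S=S_d$ or $S=\mathrm{Int}(S_d)$, a function $v\in C([0,T]\times S_d)$ is a viscosity solution of (HJB) on $S$ if $v(T,\cdot)=G$ and, for every $\phi\in C^1([0,T)\times S)$, one has $-\partial_t\phi+\sum_i m_iH^i(t,m,D^i\phi)\le 0$ (resp. $\ge0$) at every $(t,m)\in[0,T)\times S$ that is a local maximum (resp. minimum) of $v-\phi$ on $[0,T)\times S$. A classical solution is a $v\in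 C^1([0,T]\times S_d)$ satisfying (HJB) on $[0,T]\times S_d$. **Assumption A.** $A$ is a compact metric space; each $Q_{i,j}$ is continuous, and Lipschitz in $(t,m)$ uniformly in $a$; $F$ is continuous on $[0,T]\times A^d\times S_d$, and Lipschitz in $(t,m)$ uniformly in $a$; $G$ is Lipschitz. **Assumption B.** A holds, $A=[0,M]^d$, and $Q_{i,j}(t,a,m)=a_j$ for $j\ne i$. (In state $i$ the component $a_i$ does not enter the dynamics. For each $i$ let $K_i\supseteq\{j:j\neq i\}$ be a set of components such that $f^i(t,a,m)$ depends on $a$ only through $(a_j)_{j\in K_i}$; thus $K_i$ is either $\{1,\dots,d\}$ or $\{j\ne i\}$.) Each $f^i$ is continuously differentiable in $a\in A$, $\nabla_af^i$ is Lipschitz in $m$ uniformly in $(t,a)$, and for some $\lambda>0$ $$f^i(t,b,m)\ge f^i(t,a,m)+\langle\nabla_af^i(t,a,m),b-a\rangle+\lambda\sum_{j\in K_i}|b_j-a_j|^2 .$$ **Assumption C.** B holds; $F(\cdot,a,\cdot)\in C^{1,1}([0,T]\times S_d)$ uniformly in $a$, $G\in C^{1,1}(S_d)$; $G$ is convex;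 and for every $t$ the function $(w,m)\mapsto\sum_i m_if^i\big(t,(w_{i,j}/m_i)_j,m\big)$ is convex on the set of $(w,m)$ with $m\in\mathrm{Int}(S_d)$ and $0\le w_{i,j}\le Mm_i$ for all $i,j$. **Theorem.** 1. If A holds, $V$ is Lipschitz on $[0,T]\times S_d$ and is the unique viscosity solution of (HJB) on $S_d$. 2. If A holds, $V$ is also the unique viscosity solution of (HJB) on $\mathrm{Int}(S_d)$. If B holds, an optimal control exists for every initial $(t_0,m_0)\in[0,T]\times S_d$. 3. If C holds, $V\in C^{1,1}([0,T]\times S_d)$ and $V$ is the unique classical solution of (HJB). 4. Let B hold and $V\in C^{1,1}([0,T]\times S_d)$. For every $(t,i,m,z)$ with $z_i=0$, $\mathcal H^i(t,\cdot,m,z)$ has a maximizer $a^*(t,i,m,z)$ over $A$, unique in the components $j\in K_i$ (normalized by $a^*_j=0$ for $j\notin K_i$). Put $\alpha_*^{i,j}(t,m)=a^*_j(t,i,m,D^iV(t,m))$. For every $(t_0,m_0)\in[0,T]\times S_d$ there is a trajectory $\mu$ started from $m_0$ at $t_0$ and controlled by $\alpha_*(t,\mu_t)$; this control is optimal, and it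 is the unique optimal control in the following sense: any optimal control $\alpha$, with trajectory $\nu$, satisfies $\nu=\mu$ on $[t_0,T]$ and, for a.e. $t\in[t_0,T]$, $\alpha^{i,j}(t)=\alpha_*^{i,j}(t,\nu_t)$ for all $j\in K_i$ and all $i$ such that $\nu^i_t>0$; if $m_0\in\mathrm{Int}(S_d)$ this holds for all $i$. -/

import Mathlib

open Set Filter Topology MeasureTheory

/-- The interior of the simplex `S_d` (relative to its affine hull): the image, under the chart
`x ↦ (x, 1 - ∑ x_j)`, of the interior of the chart domain. -/
def intSimplex (d : ℕ) : Set (Fin d → ℝ) := {m | (∀ i, 0 < m i) ∧ ∑ i, m i = 1}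

/-! ### Differential calculus on `time × simplex`

A gradient of `φ(t, ·)` on the simplex is represented by a vector `p ∈ ℝ^d`, which is only determined
up to adding a multiple of `(1, …, 1)`; the directional derivatives along `δ_j - δ_i`, namely
`∂_{m_j - m_i} φ = p_j - p_i`, are determined. (The derivatives in the chart are `p_j - p_d`.) -/

/-- The vector `D^i = (∂_{m_j - m_i})_j` associated with the gradient representative `p`. -/
def simplexD {d : ℕ} (p : Fin d → ℝ) (i : Fin d) : Fin d → ℝ := fun j => p j - p i

/-- The linear form `(h, k) ↦ c h + ∑ j, p_j k_j`. -/
noncomputable def timeSpaceForm {d : ℕ} (c : ℝ) (p : Fin d → ℝ) : ℝ × (Fin d → ℝ) →L[ℝ] ℝ :=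
  c • ContinuousLinearMap.fst ℝ ℝ (Fin d → ℝ) +
    ∑ j, p j • (ContinuousLinearMap.proj (R := ℝ) (φ := fun _ : Fin d => ℝ) j).comp
      (ContinuousLinearMap.snd ℝ ℝ (Fin d → ℝ))

/-- `φ` is of class `C^1` on `I × S` (`I` an interval, `S` the simplex or its interior), with time
derivative `φt` and space gradient represented by `p`. At boundary points the derivative is taken
within `I × S`; since `I × S` is convex this is the same as being `C^1` in the interior, with
derivatives that extend continuously up to the boundary. -/
structure IsC1On {d : ℕ} (I : Set ℝ) (S : Set (Fin d → ℝ)) (φ φt : ℝ → (Fin d → ℝ) → ℝ)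
    (p : ℝ → (Fin d → ℝ) → (Fin d → ℝ)) : Prop where
  hasDeriv : ∀ t ∈ I, ∀ m ∈ S,
    HasFDerivWithinAt (fun q : ℝ × (Fin d → ℝ) => φ q.1 q.2) (timeSpaceForm (φt t m) (p t m))
      (I ×ˢ S) (t, m)
  cont_time : ContinuousOn (fun q : ℝ × (Fin d → ℝ) => φt q.1 q.2) (I ×ˢ S)
  cont_space : ContinuousOn (fun q : ℝ × (Fin d → ℝ) => p q.1 q.2) (I ×ˢ S)

/-- `φ` is of class `C^{1,1}` on `I × S`: it is `C^1`, and its derivatives are globally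
`L`-Lipschitz. -/
structure IsC11OnWith {d : ℕ} (L : ℝ) (I : Set ℝ) (S : Set (Fin d → ℝ))
    (φ φt : ℝ → (Fin d → ℝ) → ℝ) (p : ℝ → (Fin d → ℝ) → (Fin d → ℝ)) : Prop where
  c1 : IsC1On I S φ φt p
  lip_time : ∀ t ∈ I, ∀ s ∈ I, ∀ m ∈ S, ∀ q ∈ S, |φt t m - φt s q| ≤ L * (|t - s| + ‖m - q‖)
  lip_space : ∀ t ∈ I, ∀ s ∈ I, ∀ m ∈ S, ∀ q ∈ S, ‖p t m - p s q‖ ≤ L * (|t - s| + ‖m - q‖)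

/-- The data of a mean field control problem with states `Fin d`: horizon `T`, action space `A` (a
subset of an ambient space `X`), transition rates `Q i j t a m`, running cost `f i t a m` and
terminal cost `g i m`. Only the values for `t ∈ [0,T]`, `a ∈ A`, `m ∈ S_d` matter. -/
structure MFCP (d : ℕ) (X : Type*) where
  T : ℝ
  A : Set X
  Q : Fin d → Fin d → ℝ → X → (Fin d → ℝ) → ℝ
  f : Fin d → ℝ → X → (Fin d → ℝ) → ℝ
  g : Fin d → (Fin d → ℝ) → ℝ

namespace MFCP

variable {d : ℕ} {X : Type*}

/-- `F(t, a, m) = ∑ i, m_i f^i(t, a^i, m)`. -/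
def F (P : MFCP d X) (t : ℝ) (a : Fin d → X) (m : Fin d → ℝ) : ℝ := ∑ i, m i * P.f i t (a i) m

/-- `G(m) = ∑ i, m_i g^i(m)`. -/
def G (P : MFCP d X) (m : Fin d → ℝ) : ℝ := ∑ i, m i * P.g i m

/-- The pre-Hamiltonian `- ⟨Q_{i,•}(t,a,m), z⟩ - f^i(t,a,m)`. -/
def preH (P : MFCP d X) (i : Fin d) (t : ℝ) (a : X) (m z : Fin d → ℝ) : ℝ :=
  -(∑ j, P.Q i j t a m * z j) - P.f i t a m

/-- The Hamiltonian `H^i(t,m,z) = max_{a ∈ A} preH`. (Under Assumption A the maximum is attained when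
`m_i > 0`; when `m_i = 0` the Hamiltonian `H^i` only occurs multiplied by `m_i`.) -/
noncomputable def H (P : MFCP d X) (i : Fin d) (t : ℝ) (m z : Fin d → ℝ) : ℝ :=
  sSup ((fun a => P.preH i t a m z) '' P.A)

/-- `∑ i, m_i H^i(t, m, D^i)`, where `D^i` is read off from the gradient representative `p`. -/
noncomputable def totalH (P : MFCP d X) (t : ℝ) (m p : Fin d → ℝ) : ℝ :=
  ∑ i, m i * P.H i t m (simplexD p i)

/-- The right-hand side of the state equation:
`∑ j, (m_j Q_{j,i}(t, a^j, m) - m_i Q_{i,j}(t, a^i, m))`. -/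
def drift (P : MFCP d X) (t : ℝ) (a : Fin d → X) (m : Fin d → ℝ) (i : Fin d) : ℝ :=
  ∑ j, (m j * P.Q j i t (a j) m - m i * P.Q i j t (a i) m)

/-- `α : [t₀,T] → A^d` is a measurable control and `μ` is a trajectory of the state equation in the
simplex, started from `m₀` at time `t₀`, controlled by `α` (in integral form). -/
structure IsAdmissible [MeasurableSpace X] (P : MFCP d X) (t₀ : ℝ) (m₀ : Fin d → ℝ)
    (α : ℝ → Fin d → X) (μ : ℝ → Fin d → ℝ) : Prop where
  measurable : ∀ i, Measurable fun s : Icc t₀ P.T => α s i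
  mem_A : ∀ s ∈ Icc t₀ P.T, ∀ i, α s i ∈ P.A
  mem_simplex : ∀ s ∈ Icc t₀ P.T, μ s ∈ stdSimplex ℝ (Fin d)
  continuousOn : ContinuousOn μ (Icc t₀ P.T)
  state_eq : ∀ s ∈ Icc t₀ P.T, ∀ i, μ s i = m₀ i + ∫ r in t₀..s, P.drift r (α r) (μ r) i

/-- The cost of a control, started at time `t₀`, with associated trajectory `μ`. -/
noncomputable def J (P : MFCP d X) (t₀ : ℝ) (α : ℝ → Fin d → X) (μ : ℝ → Fin d → ℝ) : ℝ :=
  (∫ s in t₀..P.T, P.F s (α s) (μ s)) + P.G (μ P.T)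

/-- The value function. -/
noncomputable def V [MeasurableSpace X] (P : MFCP d X) (t₀ : ℝ) (m₀ : Fin d → ℝ) : ℝ :=
  sInf {c | ∃ α μ, P.IsAdmissible t₀ m₀ α μ ∧ c = P.J t₀ α μ}

/-- `α`, with trajectory `μ`, is an optimal control for the problem started from `m₀` at `t₀`. -/
def IsOptimal [MeasurableSpace X] (P : MFCP d X) (t₀ : ℝ) (m₀ : Fin d → ℝ)
    (α : ℝ → Fin d → X) (μ : ℝ → Fin d → ℝ) : Prop :=
  P.IsAdmissible t₀ m₀ α μ ∧ ∀ β ν, P.IsAdmissible t₀ m₀ β ν → P.J t₀ α μ ≤ P.J t₀ β ν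

/-- Assumption A. -/
structure AssumptionA [MetricSpace X] (P : MFCP d X) : Prop where
  T_pos : 0 < P.T
  A_nonempty : P.A.Nonempty
  A_compact : IsCompact P.A
  Q_nonneg : ∀ i j, ∀ t ∈ Icc 0 P.T, ∀ a ∈ P.A, ∀ m ∈ stdSimplex ℝ (Fin d), 0 ≤ P.Q i j t a m
  Q_cont : ∀ i j, ContinuousOn (fun q : ℝ × X × (Fin d → ℝ) => P.Q i j q.1 q.2.1 q.2.2)
    (Icc 0 P.T ×ˢ P.A ×ˢ stdSimplex ℝ (Fin d))
  Q_lip : ∃ C : ℝ, ∀ i j, ∀ t ∈ Icc 0 P.T, ∀ s ∈ Icc 0 P.T, ∀ a ∈ P.A,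
    ∀ m ∈ stdSimplex ℝ (Fin d), ∀ q ∈ stdSimplex ℝ (Fin d),
      |P.Q i j t a m - P.Q i j s a q| ≤ C * (|t - s| + ‖m - q‖)
  F_cont : ContinuousOn (fun q : ℝ × (Fin d → X) × (Fin d → ℝ) => P.F q.1 q.2.1 q.2.2)
    (Icc 0 P.T ×ˢ (univ.pi fun _ => P.A) ×ˢ stdSimplex ℝ (Fin d))
  F_lip : ∃ C : ℝ, ∀ t ∈ Icc 0 P.T, ∀ s ∈ Icc 0 P.T, ∀ a : Fin d → X, (∀ i, a i ∈ P.A) →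
    ∀ m ∈ stdSimplex ℝ (Fin d), ∀ q ∈ stdSimplex ℝ (Fin d),
      |P.F t a m - P.F s a q| ≤ C * (|t - s| + ‖m - q‖)
  G_lip : ∃ C : ℝ, ∀ m ∈ stdSimplex ℝ (Fin d), ∀ q ∈ stdSimplex ℝ (Fin d),
    |P.G m - P.G q| ≤ C * ‖m - q‖

/-- Assumption B. The action set is `[0,M]^d` and `a_j` is the rate of jumping to `j`. In state `i` the
component `a_i` plays no role in the dynamics, and the running cost `f^i` is allowed either to depend
on it or not: `K i ⊇ {j ≠ i}` is the set of the components of the action on which `f^i` depends and in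
which it is uniformly convex. (`K i = univ` and `K i = {j ≠ i}` are the two possibilities.) -/
structure AssumptionB (P : MFCP d (Fin d → ℝ)) (M : ℝ) (K : Fin d → Finset (Fin d)) : Prop where
  toA : P.AssumptionA
  A_eq : P.A = Icc 0 (fun _ => M)
  Q_eq : ∀ i j, j ≠ i → ∀ t ∈ Icc 0 P.T, ∀ a ∈ P.A, ∀ m ∈ stdSimplex ℝ (Fin d),
    P.Q i j t a m = a j
  mem_K : ∀ i j, j ≠ i → j ∈ K i
  f_dep : ∀ i, ∀ t ∈ Icc 0 P.T, ∀ m ∈ stdSimplex ℝ (Fin d), ∀ a ∈ P.A, ∀ b ∈ P.A,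
    (∀ j ∈ K i, a j = b j) → P.f i t a m = P.f i t b m
  /-- `f` has a gradient `D = ∇_a f`, continuous in `a` and Lipschitz in `m`, and is uniformly
  convex in `a`. -/
  f_convex : ∃ D : Fin d → ℝ → (Fin d → ℝ) → (Fin d → ℝ) → (Fin d → ℝ),
    (∀ i, ∀ t ∈ Icc 0 P.T, ∀ m ∈ stdSimplex ℝ (Fin d), ∀ a ∈ P.A,
      HasFDerivWithinAt (fun b => P.f i t b m)
        (∑ j, D i t a m j • ContinuousLinearMap.proj (R := ℝ) (φ := fun _ : Fin d => ℝ) j) P.A a) ∧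
    (∀ i, ∀ t ∈ Icc 0 P.T, ∀ m ∈ stdSimplex ℝ (Fin d), ContinuousOn (fun a => D i t a m) P.A) ∧
    (∃ L : ℝ, ∀ i, ∀ t ∈ Icc 0 P.T, ∀ a ∈ P.A, ∀ m ∈ stdSimplex ℝ (Fin d),
      ∀ q ∈ stdSimplex ℝ (Fin d), ‖D i t a m - D i t a q‖ ≤ L * ‖m - q‖) ∧
    (∃ l : ℝ, 0 < l ∧ ∀ i, ∀ t ∈ Icc 0 P.T, ∀ m ∈ stdSimplex ℝ (Fin d), ∀ a ∈ P.A, ∀ b ∈ P.A,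
      P.f i t a m + ∑ j, D i t a m j * (b j - a j) + l * ∑ j ∈ K i, (b j - a j) ^ 2 ≤ P.f i t b m)

/-- Assumption C. The joint convexity is required on the set where the arguments `w_{i,j} / m_i` of the
cost belong to `[0,M]`. -/
structure AssumptionC (P : MFCP d (Fin d → ℝ)) (M : ℝ) (K : Fin d → Finset (Fin d)) : Prop where
  toB : P.AssumptionB M K
  /-- `F(·, a, ·)` is of class `C^{1,1}`, uniformly in `a`. -/
  F_C11 : ∃ L : ℝ, ∀ a : Fin d → Fin d → ℝ, (∀ i, a i ∈ P.A) → ∃ Ft p,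
    IsC11OnWith L (Icc 0 P.T) (stdSimplex ℝ (Fin d)) (fun t m => P.F t a m) Ft p
  /-- `G` is of class `C^{1,1}` (seen as a function constant in time). -/
  G_C11 : ∃ L : ℝ, ∃ Gt p,
    IsC11OnWith L (Icc 0 P.T) (stdSimplex ℝ (Fin d)) (fun _ m => P.G m) Gt p
  F_convex : ∀ t ∈ Icc 0 P.T, ConvexOn ℝ
    {q : (Fin d → Fin d → ℝ) × (Fin d → ℝ) |
      q.2 ∈ intSimplex d ∧ ∀ i j, 0 ≤ q.1 i j ∧ q.1 i j ≤ M * q.2 i}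
    (fun q => ∑ i, q.2 i * P.f i t (fun j => q.1 i j / q.2 i) q.2)
  G_convex : ConvexOn ℝ (stdSimplex ℝ (Fin d)) P.G

/-- Viscosity subsolutions of the HJB equation
`-∂_t v + ∑ i, m_i H^i(t, m, D^i v) = 0` on `S` (`S` is the simplex or its interior). -/
def IsViscositySubsolution (P : MFCP d X) (S : Set (Fin d → ℝ)) (v : ℝ → (Fin d → ℝ) → ℝ) : Prop :=
  ContinuousOn (fun q : ℝ × (Fin d → ℝ) => v q.1 q.2) (Ico 0 P.T ×ˢ stdSimplex ℝ (Fin d)) ∧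
  ∀ φ φt p, IsC1On (Ico 0 P.T) S φ φt p → ∀ t ∈ Ico 0 P.T, ∀ m ∈ S,
    IsLocalMaxOn (fun q : ℝ × (Fin d → ℝ) => v q.1 q.2 - φ q.1 q.2) (Ico 0 P.T ×ˢ S) (t, m) →
      -φt t m + P.totalH t m (p t m) ≤ 0

/-- Viscosity supersolutions of the HJB equation on `S`. -/
def IsViscositySupersolution (P : MFCP d X) (S : Set (Fin d → ℝ)) (v : ℝ → (Fin d → ℝ) → ℝ) :
    Prop :=
  ContinuousOn (fun q : ℝ × (Fin d → ℝ) => v q.1 q.2) (Ico 0 P.T ×ˢ stdSimplex ℝ (Fin d)) ∧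
  ∀ φ φt p, IsC1On (Ico 0 P.T) S φ φt p → ∀ t ∈ Ico 0 P.T, ∀ m ∈ S,
    IsLocalMinOn (fun q : ℝ × (Fin d → ℝ) => v q.1 q.2 - φ q.1 q.2) (Ico 0 P.T ×ˢ S) (t, m) →
      0 ≤ -φt t m + P.totalH t m (p t m)

/-- `v ∈ C([0,T] × S_d)` is a viscosity solution of the HJB equation on `S` and satisfies the terminal
condition `v(T, ·) = G`. -/
structure IsViscositySolution (P : MFCP d X) (S : Set (Fin d → ℝ)) (v : ℝ → (Fin d → ℝ) → ℝ) :
    Prop where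
  continuousOn :
    ContinuousOn (fun q : ℝ × (Fin d → ℝ) => v q.1 q.2) (Icc 0 P.T ×ˢ stdSimplex ℝ (Fin d))
  sub : P.IsViscositySubsolution S v
  super : P.IsViscositySupersolution S v
  terminal : ∀ m ∈ stdSimplex ℝ (Fin d), v P.T m = P.G m

/-- `v ∈ C^1([0,T] × S_d)` is a classical solution of the HJB equation with its terminal condition. -/
def IsClassicalSolution (P : MFCP d X) (v : ℝ → (Fin d → ℝ) → ℝ) : Prop :=
  (∃ vt p, IsC1On (Icc 0 P.T) (stdSimplex ℝ (Fin d)) v vt p ∧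
    ∀ t ∈ Icc 0 P.T, ∀ m ∈ stdSimplex ℝ (Fin d), -vt t m + P.totalH t m (p t m) = 0) ∧
  ∀ m ∈ stdSimplex ℝ (Fin d), v P.T m = P.G m

/-- `a` maximizes the pre-Hamiltonian over the action space. -/
def IsMaximizer (P : MFCP d X) (t : ℝ) (i : Fin d) (m z : Fin d → ℝ) (a : X) : Prop :=
  a ∈ P.A ∧ ∀ b ∈ P.A, P.preH i t b m z ≤ P.preH i t a m z

/-- The maximizer `a^*(t,i,m,z)` of the pre-Hamiltonian under Assumption B (the component outside
`K i`, if any, does not matter and is set to `0`). -/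
noncomputable def aStar (P : MFCP d (Fin d → ℝ)) (K : Fin d → Finset (Fin d)) (t : ℝ) (i : Fin d)
    (m z : Fin d → ℝ) : Fin d → ℝ :=
  Classical.epsilon fun a => P.IsMaximizer t i m z a ∧ ∀ j, j ∉ K i → a j = 0

/-- The feedback `α_*^{i,j}(t,m) = a^*_j(t,i,m,D^i(t,m))`, where `D^i` is read off from the gradient
field `p`. -/
noncomputable def feedback (P : MFCP d (Fin d → ℝ)) (K : Fin d → Finset (Fin d))
    (p : ℝ → (Fin d → ℝ) → (Fin d → ℝ)) (t : ℝ) (m : Fin d → ℝ) : Fin d → Fin d → ℝ :=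
  fun i => P.aStar K t i m (simplexD (p t m) i)

end MFCP

/-!
The proof combines dynamic programming with elementary estimates on the simplex.

**Trajectories.** The drift is bounded, Lipschitz, tangent to the simplex, and bounded below by
`-C m_i` in the component `i`. After multiplication by `e^{C t}` the state equation has a nonnegative
right-hand side, so that a Picard iteration stays in the simplex (`SimplexField.exists_solution`), and
the components which are positive at the initial time remain positive (`IsAdmissible.pos`). Grönwall's
inequality makes the cost, hence the value function, Lipschitz; concatenation and restriction of
controls give the dynamic programming principle (`IsAdmissible.V_le_integral_add`,
`IsAdmissible.integral_add_V_le`).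

**Viscosity solutions.** Since `m_i ≥ 0`, the sum `∑ i, m_i H^i` is the maximum over `a ∈ A^d` of
`-⟨p, drift⟩ - F` (`le_totalH`, `exists_eq_totalH`). By dynamic programming along trajectories that stay
in `S`, the value function is a viscosity solution on `S`, up to the boundary of the simplex.
Uniqueness is a doubling of variables (`doubling_le`, `comparison`); on the interior, one adds the
barrier `-δ ∑ i, log m_i`, whose contribution to the Hamiltonian is bounded because of the lower bound
on the drift.

**Existence of optimal controls.** Under Assumption B the drift is affine and the cost is convex in the
control. Along an ultrafilter, a minimizing sequence of controls converges weakly in `L²`, its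
trajectories converge uniformly, and the sublevel sets of the cost are convex and closed in `L²`.

**Regularity.** Under Assumption C the value function is convex in space, because the problem is
linear-convex in the variables `w_{i,j} = m_i a_{i,j}` (`exists_mix`), and semiconcave, because for a
fixed control the state equation is linear (`exists_concaveOn_V`). A convex and semiconcave function on
the simplex is differentiable with a Lipschitz gradient, up to the boundary
(`exists_isSimplexGradient`, `IsSimplexGradient.norm_sub_le`). Dynamic programming then shows that the
gradient is Lipschitz in time, and that the time derivative is the Hamiltonian at the gradient, with a
quadratic error (`IsGradientField.isC11OnWith`). A classical solution is a viscosity solution, since the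
directions `(1, drift)` point into `[0,T) × S_d`; this gives uniqueness.

**The feedback.** Uniform convexity in the action makes the maximizer of the pre-Hamiltonian unique,
Lipschitz in `(m, z)` and continuous in time, so that the closed-loop equation is well posed. The cost
of an admissible control exceeds the value by the integral of
`∑ i, m_i (H^i - preH^i(α^i)) ≥ 0` (`IsAdmissible.J_sub_V_eq`), which vanishes exactly for the controls
that agree almost everywhere with the feedback, in the components `K_i` and the states `i` of positive
mass.
-/

/-! ### The pairing of gradients and velocities -/

theorem timeSpaceForm_apply {d : ℕ} (c : ℝ) (p : Fin d → ℝ) (h : ℝ) (k : Fin d → ℝ) :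
    timeSpaceForm c p (h, k) = c * h + ∑ j, p j * k j := by
  simp [timeSpaceForm]

theorem abs_sum_mul_le {d : ℕ} (p k : Fin d → ℝ) : |∑ j, p j * k j| ≤ d * ‖p‖ * ‖k‖ := by
  calc |∑ j, p j * k j| ≤ ∑ j, |p j * k j| := Finset.abs_sum_le_sum_abs _ _
    _ ≤ ∑ _j : Fin d, ‖p‖ * ‖k‖ := by
        refine Finset.sum_le_sum fun j _ => ?_
        rw [abs_mul]
        exact mul_le_mul (norm_le_pi_norm p j) (norm_le_pi_norm k j) (abs_nonneg _) (norm_nonneg _)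
    _ = d * ‖p‖ * ‖k‖ := by simp [mul_assoc]

theorem stdSimplex_le_one {d : ℕ} {m : Fin d → ℝ} (hm : m ∈ stdSimplex ℝ (Fin d)) (i : Fin d) :
    m i ≤ 1 := by
  rw [← hm.2]
  exact Finset.single_le_sum (fun j _ => hm.1 j) (Finset.mem_univ i)

theorem stdSimplex_norm_sub_le {d : ℕ} {m q : Fin d → ℝ} (hm : m ∈ stdSimplex ℝ (Fin d))
    (hq : q ∈ stdSimplex ℝ (Fin d)) : ‖m - q‖ ≤ 1 := by
  rw [pi_norm_le_iff_of_nonneg zero_le_one]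
  intro i
  rw [Real.norm_eq_abs, abs_le, Pi.sub_apply]
  have := hm.1 i; have := hq.1 i; have := stdSimplex_le_one hm i; have := stdSimplex_le_one hq i
  constructor <;> linarith

theorem intSimplex_subset {d : ℕ} : intSimplex d ⊆ stdSimplex ℝ (Fin d) :=
  fun _ hm => ⟨fun i => (hm.1 i).le, hm.2⟩

namespace MFCP

variable {d : ℕ} {X : Type*}

theorem sum_drift (P : MFCP d X) (t : ℝ) (a : Fin d → X) (m : Fin d → ℝ) :
    ∑ i, P.drift t a m i = 0 := by
  simp only [drift, Finset.sum_sub_distrib]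
  rw [Finset.sum_comm, sub_self]

theorem sum_mul_drift (P : MFCP d X) (t : ℝ) (a : Fin d → X) (m p : Fin d → ℝ) :
    ∑ i, p i * P.drift t a m i = ∑ i, m i * ∑ j, P.Q i j t (a i) m * simplexD p i j := by
  simp only [drift, simplexD, Finset.mul_sum, mul_sub, Finset.sum_sub_distrib]
  rw [Finset.sum_comm]
  congr 1 <;> (refine Finset.sum_congr rfl fun i _ => Finset.sum_congr rfl fun j _ => ?_) <;> ring

/-- The linear Hamiltonian `-⟨b, p⟩ - F` at a fixed action is the average of the pre-Hamiltonians. -/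
theorem sum_mul_preH (P : MFCP d X) (t : ℝ) (a : Fin d → X) (m p : Fin d → ℝ) :
    ∑ i, m i * P.preH i t (a i) m (simplexD p i) = -(∑ i, p i * P.drift t a m i) - P.F t a m := by
  rw [sum_mul_drift, F, ← Finset.sum_neg_distrib, ← Finset.sum_sub_distrib]
  refine Finset.sum_congr rfl fun i _ => ?_
  rw [preH]; ring

/-- A common constant for the bounds and the Lipschitz estimates on the drift and the costs that
Assumption A provides. The field `inward` says that `m + b / C` has nonnegative components, where `b` is
the drift at `m`; it makes the simplex invariant. -/
structure Bounds (P : MFCP d X) (C : ℝ) : Prop where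
  one_le : 1 ≤ C
  drift_le : ∀ t ∈ Icc 0 P.T, ∀ a, (∀ i, a i ∈ P.A) → ∀ m ∈ stdSimplex ℝ (Fin d),
    ‖P.drift t a m‖ ≤ C
  drift_lip : ∀ t ∈ Icc 0 P.T, ∀ s ∈ Icc 0 P.T, ∀ a, (∀ i, a i ∈ P.A) →
    ∀ m ∈ stdSimplex ℝ (Fin d), ∀ q ∈ stdSimplex ℝ (Fin d),
      ‖P.drift t a m - P.drift s a q‖ ≤ C * (|t - s| + ‖m - q‖)
  inward : ∀ t ∈ Icc 0 P.T, ∀ a, (∀ i, a i ∈ P.A) → ∀ m ∈ stdSimplex ℝ (Fin d), ∀ i,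
    0 ≤ C * m i + P.drift t a m i
  F_le : ∀ t ∈ Icc 0 P.T, ∀ a, (∀ i, a i ∈ P.A) → ∀ m ∈ stdSimplex ℝ (Fin d), |P.F t a m| ≤ C
  F_lip : ∀ t ∈ Icc 0 P.T, ∀ s ∈ Icc 0 P.T, ∀ a, (∀ i, a i ∈ P.A) →
    ∀ m ∈ stdSimplex ℝ (Fin d), ∀ q ∈ stdSimplex ℝ (Fin d),
      |P.F t a m - P.F s a q| ≤ C * (|t - s| + ‖m - q‖)
  G_le : ∀ m ∈ stdSimplex ℝ (Fin d), |P.G m| ≤ C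
  G_lip : ∀ m ∈ stdSimplex ℝ (Fin d), ∀ q ∈ stdSimplex ℝ (Fin d),
    |P.G m - P.G q| ≤ C * ‖m - q‖

theorem Bounds.pos {P : MFCP d X} {C : ℝ} (h : P.Bounds C) : 0 < C := by linarith [h.one_le]

theorem isCompact_actions [TopologicalSpace X] {P : MFCP d X} (h : IsCompact P.A) :
    IsCompact (univ.pi fun _ : Fin d => P.A) := isCompact_univ_pi fun _ => h

theorem AssumptionA.exists_Q_le [MetricSpace X] {P : MFCP d X} (hA : P.AssumptionA) :
    ∃ C, 0 ≤ C ∧ ∀ i j, ∀ t ∈ Icc 0 P.T, ∀ a ∈ P.A, ∀ m ∈ stdSimplex ℝ (Fin d),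
      P.Q i j t a m ≤ C := by
  have hc : IsCompact (Icc 0 P.T ×ˢ P.A ×ˢ stdSimplex ℝ (Fin d)) :=
    isCompact_Icc.prod (hA.A_compact.prod (isCompact_stdSimplex ℝ (Fin d)))
  choose C hC using fun i j => hc.exists_bound_of_continuousOn (hA.Q_cont i j)
  refine ⟨∑ i, ∑ j, |C i j|, by positivity, fun i j t ht a ha m hm => ?_⟩
  have h1 := hC i j (t, a, m) ⟨ht, ha, hm⟩
  calc P.Q i j t a m ≤ |P.Q i j t a m| := le_abs_self _
    _ ≤ |C i j| := h1.trans (le_abs_self _)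
    _ ≤ ∑ j, |C i j| :=
        Finset.single_le_sum (f := fun j => |C i j|) (fun _ _ => abs_nonneg _) (Finset.mem_univ j)
    _ ≤ _ := Finset.single_le_sum (f := fun i => ∑ j, |C i j|)
        (fun _ _ => Finset.sum_nonneg fun _ _ => abs_nonneg _) (Finset.mem_univ i)

theorem AssumptionA.exists_bounds [MetricSpace X] {P : MFCP d X} (hA : P.AssumptionA) :
    ∃ C, P.Bounds C := by
  obtain ⟨q, hq0, hq⟩ := hA.exists_Q_le
  obtain ⟨LQ', hLQ'⟩ := hA.Q_lip
  obtain ⟨LF, hLF⟩ := hA.F_lip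
  obtain ⟨LG, hLG⟩ := hA.G_lip
  have hcF : IsCompact (Icc 0 P.T ×ˢ (univ.pi fun _ : Fin d => P.A) ×ˢ stdSimplex ℝ (Fin d)) :=
    isCompact_Icc.prod ((isCompact_actions hA.A_compact).prod (isCompact_stdSimplex ℝ (Fin d)))
  obtain ⟨BF, hBF⟩ := hcF.exists_bound_of_continuousOn hA.F_cont
  have hGc : ContinuousOn P.G (stdSimplex ℝ (Fin d)) := by
    have : LipschitzOnWith (Real.toNNReal |LG|) P.G (stdSimplex ℝ (Fin d)) :=
      LipschitzOnWith.of_dist_le_mul fun m hm x hx => by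
        rw [Real.dist_eq, dist_eq_norm, Real.coe_toNNReal _ (abs_nonneg _)]
        exact (hLG m hm x hx).trans (by gcongr; exact le_abs_self _)
    exact this.continuousOn
  obtain ⟨BG, hBG⟩ := (isCompact_stdSimplex ℝ (Fin d)).exists_bound_of_continuousOn hGc
  obtain ⟨LQ, hLQ0, hLQ⟩ : ∃ L, 0 ≤ L ∧ ∀ i j, ∀ t ∈ Icc 0 P.T, ∀ s ∈ Icc 0 P.T, ∀ a ∈ P.A,
      ∀ m ∈ stdSimplex ℝ (Fin d), ∀ q ∈ stdSimplex ℝ (Fin d),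
      |P.Q i j t a m - P.Q i j s a q| ≤ L * (|t - s| + ‖m - q‖) :=
    ⟨|LQ'|, abs_nonneg _, fun i j t ht s hs a ha m hm q hq =>
      (hLQ' i j t ht s hs a ha m hm q hq).trans (by gcongr; exact le_abs_self _)⟩
  have hQabs : ∀ i j, ∀ t ∈ Icc 0 P.T, ∀ a ∈ P.A, ∀ m ∈ stdSimplex ℝ (Fin d),
      |P.Q i j t a m| ≤ q := fun i j t ht a ha m hm => by
    rw [abs_of_nonneg (hA.Q_nonneg i j t ht a ha m hm)]; exact hq i j t ht a ha m hm
  have habs : ∀ m ∈ stdSimplex ℝ (Fin d), ∀ i, |m i| ≤ 1 := fun m hm i => by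
    rw [abs_of_nonneg (hm.1 i)]; exact stdSimplex_le_one hm i
  set C := 1 + d * (2 * q) + d * (2 * (q + LQ)) + d * q + |BF| + |LF| + |BG| + |LG| with hC
  have hd : (0 : ℝ) ≤ d := Nat.cast_nonneg d
  have e1 : 0 ≤ d * (2 * q) := by positivity
  have e2 : 0 ≤ d * (2 * (q + LQ)) := by positivity
  have e3 : 0 ≤ d * q := by positivity
  have e4 := abs_nonneg BF
  have e5 := abs_nonneg LF
  have e6 := abs_nonneg BG
  have e7 := abs_nonneg LG
  have hC0 : 0 ≤ C := by linarith
  -- one term of the drift is Lipschitz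
  have hterm : ∀ k i j, ∀ t ∈ Icc 0 P.T, ∀ s ∈ Icc 0 P.T, ∀ a ∈ P.A,
      ∀ m ∈ stdSimplex ℝ (Fin d), ∀ x ∈ stdSimplex ℝ (Fin d),
      |m k * P.Q i j t a m - x k * P.Q i j s a x| ≤ (q + LQ) * (|t - s| + ‖m - x‖) := by
    intro k i j t ht s hs a ha m hm x hx
    have h1 : m k * P.Q i j t a m - x k * P.Q i j s a x
        = (m k - x k) * P.Q i j t a m + x k * (P.Q i j t a m - P.Q i j s a x) := by ring
    have h2 : |m k - x k| ≤ |t - s| + ‖m - x‖ :=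
      (norm_le_pi_norm (m - x) k).trans (by linarith [abs_nonneg (t - s)])
    have h3 := hLQ i j t ht s hs a ha m hm x hx
    rw [h1]
    refine (abs_add_le _ _).trans ?_
    rw [abs_mul, abs_mul, add_mul]
    have h4 := hQabs i j t ht a ha m hm
    have h5 := habs x hx k
    refine add_le_add ?_ ?_
    · rw [mul_comm]; exact mul_le_mul h4 h2 (abs_nonneg _) hq0
    · exact (mul_le_mul h5 h3 (abs_nonneg _) zero_le_one).trans (by rw [one_mul])
  refine ⟨C, ⟨by linarith, ?_, ?_, ?_, ?_, ?_, ?_, ?_⟩⟩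
  · intro t ht a ha m hm
    rw [pi_norm_le_iff_of_nonneg hC0]
    intro i
    rw [Real.norm_eq_abs, drift]
    refine (Finset.abs_sum_le_sum_abs _ _).trans ?_
    have : ∀ j ∈ Finset.univ, |m j * P.Q j i t (a j) m - m i * P.Q i j t (a i) m| ≤ 2 * q := by
      intro j _
      refine (abs_sub _ _).trans ?_
      rw [abs_mul, abs_mul]
      have h1 := mul_le_mul (habs m hm j) (hQabs j i t ht (a j) (ha j) m hm) (abs_nonneg _) zero_le_one
      have h2 := mul_le_mul (habs m hm i) (hQabs i j t ht (a i) (ha i) m hm) (abs_nonneg _) zero_le_one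
      linarith
    refine (Finset.sum_le_sum this).trans ?_
    simp only [Finset.sum_const, Finset.card_univ, Fintype.card_fin, nsmul_eq_mul]
    linarith
  · intro t ht s hs a ha m hm x hx
    have hn : 0 ≤ |t - s| + ‖m - x‖ := by positivity
    rw [pi_norm_le_iff_of_nonneg (by positivity)]
    intro i
    rw [Real.norm_eq_abs, Pi.sub_apply, drift, drift, ← Finset.sum_sub_distrib]
    refine (Finset.abs_sum_le_sum_abs _ _).trans ?_
    have : ∀ j ∈ Finset.univ, |m j * P.Q j i t (a j) m - m i * P.Q i j t (a i) m -
        (x j * P.Q j i s (a j) x - x i * P.Q i j s (a i) x)|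
          ≤ 2 * (q + LQ) * (|t - s| + ‖m - x‖) := by
      intro j _
      have h1 := hterm j j i t ht s hs (a j) (ha j) m hm x hx
      have h2 := hterm i i j t ht s hs (a i) (ha i) m hm x hx
      rw [show m j * P.Q j i t (a j) m - m i * P.Q i j t (a i) m -
        (x j * P.Q j i s (a j) x - x i * P.Q i j s (a i) x) =
        (m j * P.Q j i t (a j) m - x j * P.Q j i s (a j) x) -
        (m i * P.Q i j t (a i) m - x i * P.Q i j s (a i) x) by ring]
      refine (abs_sub _ _).trans ?_
      linarith
    refine (Finset.sum_le_sum this).trans ?_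
    simp only [Finset.sum_const, Finset.card_univ, Fintype.card_fin, nsmul_eq_mul]
    rw [← mul_assoc]
    gcongr
    linarith
  · intro t ht a ha m hm i
    rw [drift, Finset.sum_sub_distrib, ← Finset.mul_sum]
    have h1 : 0 ≤ ∑ j, m j * P.Q j i t (a j) m :=
      Finset.sum_nonneg fun j _ => mul_nonneg (hm.1 j) (hA.Q_nonneg j i t ht _ (ha j) m hm)
    have h2 : ∑ j, P.Q i j t (a i) m ≤ C := by
      refine (Finset.sum_le_sum fun j _ => hq i j t ht (a i) (ha i) m hm).trans ?_
      simp only [Finset.sum_const, Finset.card_univ, Fintype.card_fin, nsmul_eq_mul]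
      linarith
    have h3 := mul_le_mul_of_nonneg_left h2 (hm.1 i)
    linarith
  · intro t ht a ha m hm
    have := hBF (t, a, m) ⟨ht, fun i _ => ha i, hm⟩
    rw [Real.norm_eq_abs] at this
    linarith [le_abs_self BF]
  · intro t ht s hs a ha m hm x hx
    refine (hLF t ht s hs a ha m hm x hx).trans ?_
    gcongr
    linarith [le_abs_self LF]
  · intro m hm
    have := hBG m hm
    rw [Real.norm_eq_abs] at this
    linarith [le_abs_self BG]
  · intro m hm x hx
    refine (hLG m hm x hx).trans ?_
    gcongr
    linarith [le_abs_self LG]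

/-! ### The Hamiltonian as a maximum over the product action space -/

theorem AssumptionA.continuousOn_drift [MetricSpace X] {P : MFCP d X} (hA : P.AssumptionA)
    (i : Fin d) :
    ContinuousOn (fun q : ℝ × (Fin d → X) × (Fin d → ℝ) => P.drift q.1 q.2.1 q.2.2 i)
      (Icc 0 P.T ×ˢ (univ.pi fun _ => P.A) ×ˢ stdSimplex ℝ (Fin d)) := by
  have hQ : ∀ i j k, ContinuousOn
      (fun q : ℝ × (Fin d → X) × (Fin d → ℝ) => P.Q i j q.1 (q.2.1 k) q.2.2)
      (Icc 0 P.T ×ˢ (univ.pi fun _ => P.A) ×ˢ stdSimplex ℝ (Fin d)) := by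
    intro i j k
    refine (hA.Q_cont i j).comp (f := fun q : ℝ × (Fin d → X) × (Fin d → ℝ) =>
      (q.1, q.2.1 k, q.2.2)) (by fun_prop) ?_
    rintro ⟨t, a, m⟩ ⟨ht, ha, hm⟩
    exact ⟨ht, ha k (mem_univ k), hm⟩
  unfold drift
  refine continuousOn_finsetSum _ fun j _ => ?_
  refine ContinuousOn.sub (ContinuousOn.mul (by fun_prop) (hQ _ _ _))
    (ContinuousOn.mul (by fun_prop) (hQ _ _ _))

/-- In states of positive mass the pre-Hamiltonian is continuous in the action. -/
theorem AssumptionA.continuousOn_preH [MetricSpace X] {P : MFCP d X} (hA : P.AssumptionA)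
    {t : ℝ} (ht : t ∈ Icc 0 P.T) {m : Fin d → ℝ} (hm : m ∈ stdSimplex ℝ (Fin d)) {i : Fin d}
    (hi : 0 < m i) (z : Fin d → ℝ) : ContinuousOn (fun a => P.preH i t a m z) P.A := by
  obtain ⟨a₀, ha₀⟩ := hA.A_nonempty
  have hQ : ∀ j, ContinuousOn (fun a => P.Q i j t a m) P.A := fun j =>
    (hA.Q_cont i j).comp (f := fun a => (t, a, m)) (by fun_prop) fun a ha => ⟨ht, ha, hm⟩
  have hF : ContinuousOn (fun a => P.F t (Function.update (fun _ => a₀) i a) m) P.A := by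
    refine hA.F_cont.comp (f := fun a => (t, Function.update (fun _ => a₀) i a, m)) ?_ ?_
    · exact Continuous.continuousOn (by fun_prop)
    · intro a ha
      refine ⟨ht, fun j _ => ?_, hm⟩
      rcases eq_or_ne j i with rfl | hj
      · simpa using ha
      · simpa [hj] using ha₀
  have hf : ∀ a, P.f i t a m = (m i)⁻¹ * (P.F t (Function.update (fun _ => a₀) i a) m
      - ∑ j ∈ Finset.univ.erase i, m j * P.f j t a₀ m) := by
    intro a
    have : P.F t (Function.update (fun _ => a₀) i a) m
        = m i * P.f i t a m + ∑ j ∈ Finset.univ.erase i, m j * P.f j t a₀ m := by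
      rw [F, ← Finset.add_sum_erase _ _ (Finset.mem_univ i)]
      congr 1
      · simp
      · refine Finset.sum_congr rfl fun j hj => ?_
        simp [Finset.ne_of_mem_erase hj]
    rw [this]; field_simp; ring
  unfold preH
  simp only [hf]
  refine ContinuousOn.sub (ContinuousOn.neg (continuousOn_finsetSum _ fun j _ =>
    (hQ j).mul continuousOn_const)) (continuousOn_const.mul (hF.sub continuousOn_const))

theorem AssumptionA.exists_isMaximizer [MetricSpace X] {P : MFCP d X} (hA : P.AssumptionA)
    {t : ℝ} (ht : t ∈ Icc 0 P.T) {m : Fin d → ℝ} (hm : m ∈ stdSimplex ℝ (Fin d)) {i : Fin d}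
    (hi : 0 < m i) (z : Fin d → ℝ) : ∃ a, P.IsMaximizer t i m z a := by
  obtain ⟨a, ha, hmax⟩ := hA.A_compact.exists_isMaxOn hA.A_nonempty (hA.continuousOn_preH ht hm hi z)
  exact ⟨a, ha, fun b hb => hmax hb⟩

theorem IsMaximizer.H_eq {P : MFCP d X} {t : ℝ} {i : Fin d} {m z : Fin d → ℝ} {a : X}
    (h : P.IsMaximizer t i m z a) : P.H i t m z = P.preH i t a m z :=
  IsGreatest.csSup_eq ⟨⟨a, h.1, rfl⟩, by rintro _ ⟨b, hb, rfl⟩; exact h.2 b hb⟩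

theorem AssumptionA.mul_preH_le [MetricSpace X] {P : MFCP d X} (hA : P.AssumptionA)
    {t : ℝ} (ht : t ∈ Icc 0 P.T) {m : Fin d → ℝ} (hm : m ∈ stdSimplex ℝ (Fin d)) (i : Fin d)
    (z : Fin d → ℝ) {a : X} (ha : a ∈ P.A) : m i * P.preH i t a m z ≤ m i * P.H i t m z := by
  rcases (hm.1 i).eq_or_lt with h | h
  · simp [← h]
  · obtain ⟨b, hb⟩ := hA.exists_isMaximizer ht hm h z
    rw [hb.H_eq]
    exact mul_le_mul_of_nonneg_left (hb.2 a ha) h.le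

theorem AssumptionA.le_totalH [MetricSpace X] {P : MFCP d X} (hA : P.AssumptionA)
    {t : ℝ} (ht : t ∈ Icc 0 P.T) {m : Fin d → ℝ} (hm : m ∈ stdSimplex ℝ (Fin d)) (p : Fin d → ℝ)
    {a : Fin d → X} (ha : ∀ i, a i ∈ P.A) :
    -(∑ i, p i * P.drift t a m i) - P.F t a m ≤ P.totalH t m p := by
  rw [← sum_mul_preH]
  exact Finset.sum_le_sum fun i _ => hA.mul_preH_le ht hm i _ (ha i)

theorem AssumptionA.exists_eq_totalH [MetricSpace X] {P : MFCP d X} (hA : P.AssumptionA)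
    {t : ℝ} (ht : t ∈ Icc 0 P.T) {m : Fin d → ℝ} (hm : m ∈ stdSimplex ℝ (Fin d)) (p : Fin d → ℝ) :
    ∃ a : Fin d → X, (∀ i, a i ∈ P.A) ∧
      P.totalH t m p = -(∑ i, p i * P.drift t a m i) - P.F t a m := by
  have : ∀ i, ∃ a, a ∈ P.A ∧ m i * P.H i t m (simplexD p i) = m i * P.preH i t a m (simplexD p i) := by
    intro i
    rcases (hm.1 i).eq_or_lt with h | h
    · obtain ⟨a, ha⟩ := hA.A_nonempty
      exact ⟨a, ha, by simp [← h]⟩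
    · obtain ⟨b, hb⟩ := hA.exists_isMaximizer ht hm h (simplexD p i)
      exact ⟨b, hb.1, by rw [hb.H_eq]⟩
  choose a ha h using this
  exact ⟨a, ha, by rw [← sum_mul_preH]; exact Finset.sum_congr rfl fun i _ => h i⟩

theorem AssumptionA.totalH_sub_le [MetricSpace X] {P : MFCP d X} (hA : P.AssumptionA)
    {C : ℝ} (hC : P.Bounds C) {t s : ℝ} (ht : t ∈ Icc 0 P.T) (hs : s ∈ Icc 0 P.T)
    {m q : Fin d → ℝ} (hm : m ∈ stdSimplex ℝ (Fin d)) (hq : q ∈ stdSimplex ℝ (Fin d))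
    (p p' : Fin d → ℝ) :
    P.totalH t m p - P.totalH s q p' ≤
      C * (1 + d * ‖p‖) * (|t - s| + ‖m - q‖) + d * C * ‖p - p'‖ := by
  obtain ⟨a, ha, h⟩ := hA.exists_eq_totalH ht hm p
  have h1 := hA.le_totalH hs hq p' ha
  have h2 := (abs_le.1 (hC.F_lip t ht s hs a ha m hm q hq)).1
  have h3 := (abs_le.1 ((abs_sum_mul_le p (P.drift t a m - P.drift s a q)).trans
    (mul_le_mul_of_nonneg_left (hC.drift_lip t ht s hs a ha m hm q hq) (by positivity)))).1
  have h4 := (abs_le.1 ((abs_sum_mul_le (p - p') (P.drift s a q)).trans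
    (mul_le_mul_of_nonneg_left (hC.drift_le s hs a ha q hq) (by positivity)))).1
  have h5 : ∑ j, p j * (P.drift t a m - P.drift s a q) j
      = ∑ j, p j * P.drift t a m j - ∑ j, p j * P.drift s a q j := by
    simp [mul_sub, Finset.sum_sub_distrib]
  have h6 : ∑ j, (p - p') j * P.drift s a q j
      = ∑ j, p j * P.drift s a q j - ∑ j, p' j * P.drift s a q j := by
    simp [sub_mul, Finset.sum_sub_distrib]
  rw [h5] at h3
  rw [h6] at h4
  rw [h]
  nlinarith

theorem AssumptionA.abs_totalH_sub_le [MetricSpace X] {P : MFCP d X} (hA : P.AssumptionA)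
    {C : ℝ} (hC : P.Bounds C) {t s : ℝ} (ht : t ∈ Icc 0 P.T) (hs : s ∈ Icc 0 P.T)
    {m q : Fin d → ℝ} (hm : m ∈ stdSimplex ℝ (Fin d)) (hq : q ∈ stdSimplex ℝ (Fin d))
    {p p' : Fin d → ℝ} {R : ℝ} (hp : ‖p‖ ≤ R) (hp' : ‖p'‖ ≤ R) :
    |P.totalH t m p - P.totalH s q p'| ≤
      C * (1 + d * R) * (|t - s| + ‖m - q‖) + d * C * ‖p - p'‖ := by
  have h0 := hC.pos
  have h1 := hA.totalH_sub_le hC ht hs hm hq p p'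
  have h2 := hA.totalH_sub_le hC hs ht hq hm p' p
  rw [abs_sub_comm s t, norm_sub_rev q m, norm_sub_rev p' p] at h2
  have h3 : C * (1 + d * ‖p‖) * (|t - s| + ‖m - q‖) ≤ C * (1 + d * R) * (|t - s| + ‖m - q‖) := by
    gcongr
  have h4 : C * (1 + d * ‖p'‖) * (|t - s| + ‖m - q‖) ≤ C * (1 + d * R) * (|t - s| + ‖m - q‖) := by
    gcongr
  rw [abs_le]
  constructor <;> linarith

end MFCP

/-! ### Integral inequalities and the chain rule along trajectories -/

theorem intervalIntegrable_of_abs_le {f : ℝ → ℝ} {t₀ T C a b : ℝ}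
    (hf : AEStronglyMeasurable f (volume.restrict (Icc t₀ T))) (hC : ∀ r ∈ Icc t₀ T, |f r| ≤ C)
    (ha : a ∈ Icc t₀ T) (hb : b ∈ Icc t₀ T) : IntervalIntegrable f volume a b := by
  have h : IntegrableOn f (Icc t₀ T) := by
    refine Integrable.of_bound hf C ?_
    filter_upwards [ae_restrict_mem measurableSet_Icc] with r hr using hC r hr
  exact (h.mono_set (uIcc_subset_Icc ha hb)).intervalIntegrable

theorem abs_integral_le_of_le {f : ℝ → ℝ} {t₀ T C a b : ℝ} (hC : ∀ r ∈ Icc t₀ T, |f r| ≤ C)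
    (ha : a ∈ Icc t₀ T) (hb : b ∈ Icc t₀ T) : |∫ r in a..b, f r| ≤ C * |b - a| := by
  rw [← Real.norm_eq_abs]
  exact intervalIntegral.norm_integral_le_of_norm_le_const fun r hr =>
    hC r (uIcc_subset_Icc ha hb (uIoc_subset_uIcc hr))

/-- Grönwall's inequality in integral form. -/
theorem le_mul_exp_of_le_integral {u : ℝ → ℝ} {a b c K : ℝ} (hu : ContinuousOn u (Icc a b))
    (hK : 0 ≤ K) (h : ∀ s ∈ Icc a b, u s ≤ c + K * ∫ r in a..s, u r) :
    ∀ s ∈ Icc a b, u s ≤ c * Real.exp (K * (s - a)) := by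
  intro s hs
  have hab : a ≤ b := hs.1.trans hs.2
  set v : ℝ → ℝ := IccExtend hab ((Icc a b).domRestrict u) with hv
  have hvc : Continuous v := hu.domRestrict.Icc_extend'
  have hvu : ∀ r ∈ Icc a b, v r = u r := fun r hr => by
    rw [hv, IccExtend_of_mem hab _ hr]; rfl
  have hint : ∀ s ∈ Icc a b, ∫ r in a..s, v r = ∫ r in a..s, u r := fun s hs =>
    intervalIntegral.integral_congr fun r hr => by
      rw [uIcc_of_le hs.1] at hr
      exact hvu r ⟨hr.1, hr.2.trans hs.2⟩
  set U : ℝ → ℝ := fun s => (c + K * ∫ r in a..s, v r) * Real.exp (-(K * (s - a))) with hU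
  have hder : ∀ x, HasDerivAt U (K * v x * Real.exp (-(K * (x - a))) +
      (c + K * ∫ r in a..x, v r) * (Real.exp (-(K * (x - a))) * -(K * 1))) x := by
    intro x
    have h1 : HasDerivAt (fun s => c + K * ∫ r in a..s, v r) (K * v x) x :=
      ((hvc.integral_hasStrictDerivAt a x).hasDerivAt.const_mul K).const_add c
    have h2 : HasDerivAt (fun s => Real.exp (-(K * (s - a))))
        (Real.exp (-(K * (x - a))) * -(K * 1)) x :=
      ((((hasDerivAt_id x).sub_const a).const_mul K).neg).exp
    exact h1.mul h2
  have hanti : AntitoneOn U (Icc a b) := by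
    refine antitoneOn_of_deriv_nonpos (convex_Icc a b)
      (fun x _ => (hder x).continuousAt.continuousWithinAt)
      (fun x _ => (hder x).differentiableAt.differentiableWithinAt) fun x hx => ?_
    rw [interior_Icc] at hx
    have hx' : x ∈ Icc a b := Ioo_subset_Icc_self hx
    rw [(hder x).deriv]
    have h1 := h x hx'
    rw [← hvu x hx', ← hint x hx'] at h1
    have h2 := Real.exp_pos (-(K * (x - a)))
    have h3 := mul_nonneg (mul_nonneg hK h2.le) (sub_nonneg.2 h1)
    nlinarith
  have h0 := hanti (left_mem_Icc.2 hab) hs hs.1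
  simp only [hU, intervalIntegral.integral_same, mul_zero, add_zero, sub_self, neg_zero,
    Real.exp_zero, mul_one] at h0
  have h1 := h s hs
  rw [← hint s hs] at h1
  have h2 := Real.exp_pos (K * (s - a))
  have h3 := mul_le_mul_of_nonneg_right h0 h2.le
  rw [mul_assoc, ← Real.exp_add, neg_add_cancel, Real.exp_zero, mul_one] at h3
  exact h1.trans h3

/-- The primitive, from the base point `s`, of a function that tends to zero at `s` is `o(x - s)`. -/
theorem isLittleO_integral_of_tendsto {h : ℝ → ℝ} {s b : ℝ} (hsb : s < b)
    (hh : Tendsto h (𝓝[Icc s b] s) (𝓝 0)) :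
    (fun x => ∫ r in s..x, h r) =o[𝓝[Ici s] s] fun x => x - s := by
  rw [Asymptotics.isLittleO_iff]
  intro ε hε
  have h1 : ∀ᶠ r in 𝓝[Ici s] s, |h r| < ε := by
    rw [← nhdsWithin_Icc_eq_nhdsGE hsb]
    have := (tendsto_order.1 hh.abs).2 ε (by simpa using hε)
    simpa using this
  rw [eventually_nhdsWithin_iff, Metric.eventually_nhds_iff] at h1
  obtain ⟨δ, hδ, h1⟩ := h1
  have h2 : ∀ᶠ x in 𝓝[Ici s] s, dist x s < δ :=
    nhdsWithin_le_nhds (Metric.ball_mem_nhds s hδ)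
  filter_upwards [h2, self_mem_nhdsWithin] with x hx hsx
  refine intervalIntegral.norm_integral_le_of_norm_le_const fun r hr => ?_
  rw [uIoc_of_le hsx] at hr
  refine (h1 ?_ hr.1.le).le
  rw [Real.dist_eq, abs_of_nonneg (sub_nonneg.2 hr.1.le)]
  rw [Real.dist_eq, abs_of_nonneg (sub_nonneg.2 hsx)] at hx
  linarith [hr.2]

theorem norm_sub_le_of_integral_eq {d : ℕ} {ν β : ℝ → Fin d → ℝ} {ν₀ : Fin d → ℝ} {a b C : ℝ}
    (hC : 0 ≤ C) (hβ : ∀ i, IntervalIntegrable (fun r => β r i) volume a b)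
    (hβC : ∀ r ∈ Icc a b, ‖β r‖ ≤ C)
    (hν : ∀ s ∈ Icc a b, ∀ i, ν s i = ν₀ i + ∫ r in a..s, β r i)
    {s s' : ℝ} (hs : s ∈ Icc a b) (hs' : s' ∈ Icc a b) : ‖ν s' - ν s‖ ≤ C * |s' - s| := by
  have hab : a ≤ b := hs.1.trans hs.2
  rw [pi_norm_le_iff_of_nonneg (by positivity)]
  intro i
  rw [Pi.sub_apply, hν s hs, hν s' hs', Real.norm_eq_abs]
  have hsub : ∀ x ∈ Icc a b, IntervalIntegrable (fun r => β r i) volume a x := fun x hx =>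
    (hβ i).mono_set (by rw [uIcc_of_le hab, uIcc_of_le hx.1]; exact Icc_subset_Icc_right hx.2)
  rw [add_sub_add_left_eq_sub, intervalIntegral.integral_interval_sub_left (hsub s' hs') (hsub s hs)]
  exact abs_integral_le_of_le (fun r hr => (norm_le_pi_norm (β r) i).trans (hβC r hr)) hs hs'

/-- The chain rule for a `C^1` function along a curve which is the primitive of a bounded function.
No almost everywhere differentiability is needed: the difference of the two sides has zero
derivative at every point. -/
theorem IsC1On.sub_eq_integral {d : ℕ} {I : Set ℝ} {S : Set (Fin d → ℝ)}
    {φ φt : ℝ → (Fin d → ℝ) → ℝ} {p : ℝ → (Fin d → ℝ) → (Fin d → ℝ)} (hφ : IsC1On I S φ φt p)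
    {a b C : ℝ} (hab : a ≤ b) (hI : Icc a b ⊆ I) {ν β : ℝ → Fin d → ℝ} {ν₀ : Fin d → ℝ}
    (hνS : ∀ s ∈ Icc a b, ν s ∈ S)
    (hβ : ∀ i, IntervalIntegrable (fun r => β r i) volume a b)
    (hβC : ∀ r ∈ Icc a b, ‖β r‖ ≤ C)
    (hν : ∀ s ∈ Icc a b, ∀ i, ν s i = ν₀ i + ∫ r in a..s, β r i) :
    φ b (ν b) - φ a (ν a) = ∫ r in a..b, (φt r (ν r) + ∑ i, p r (ν r) i * β r i) := by
  have hC : 0 ≤ C := (norm_nonneg _).trans (hβC a (left_mem_Icc.2 hab))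
  have hlip := fun {s s' : ℝ} (hs : s ∈ Icc a b) (hs' : s' ∈ Icc a b) =>
    norm_sub_le_of_integral_eq hC hβ hβC hν hs hs'
  have hνc : ContinuousOn ν (Icc a b) := by
    have : LipschitzOnWith (Real.toNNReal C) ν (Icc a b) :=
      LipschitzOnWith.of_dist_le_mul fun x hx y hy => by
        rw [dist_eq_norm, Real.dist_eq, Real.coe_toNNReal _ hC]
        exact hlip hy hx
    exact this.continuousOn
  have hmaps : MapsTo (fun r => (r, ν r)) (Icc a b) (I ×ˢ S) := fun r hr => ⟨hI hr, hνS r hr⟩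
  have hpair : ContinuousOn (fun r => (r, ν r)) (Icc a b) := continuousOn_id.prodMk hνc
  have hφtc : ContinuousOn (fun r => φt r (ν r)) (Icc a b) := hφ.cont_time.comp hpair hmaps
  have hpc : ContinuousOn (fun r => p r (ν r)) (Icc a b) := hφ.cont_space.comp hpair hmaps
  have hpci : ∀ i, ContinuousOn (fun r => p r (ν r) i) (Icc a b) := fun i =>
    (continuous_apply i).comp_continuousOn hpc
  have hsub : ∀ x ∈ Icc a b, ∀ y ∈ Icc a b, uIcc x y ⊆ uIcc a b := fun x hx y hy => by
    rw [uIcc_of_le hab]; exact uIcc_subset_Icc hx hy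
  have hint0 : ∀ i, IntervalIntegrable (fun r => p r (ν r) i * β r i) volume a b := fun i =>
    (hβ i).continuousOn_mul (by rw [uIcc_of_le hab]; exact hpci i)
  have hint : IntervalIntegrable (fun r => φt r (ν r) + ∑ i, p r (ν r) i * β r i) volume a b := by
    refine IntervalIntegrable.add ?_ ?_
    · exact ContinuousOn.intervalIntegrable (by rw [uIcc_of_le hab]; exact hφtc)
    · have := IntervalIntegrable.sum (μ := volume) (a := a) (b := b) Finset.univ
        (f := fun i => fun r => p r (ν r) i * β r i) fun i _ => hint0 i
      simpa [Finset.sum_fn] using this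
  set w : ℝ → ℝ := fun s => φ s (ν s) - ∫ r in a..s, (φt r (ν r) + ∑ i, p r (ν r) i * β r i)
    with hw
  have hwc : ContinuousOn w (Icc a b) := by
    refine ContinuousOn.sub ?_ ?_
    · have h1 : ContinuousOn (fun q : ℝ × (Fin d → ℝ) => φ q.1 q.2) (I ×ˢ S) := fun q hq =>
        (hφ.hasDeriv q.1 hq.1 q.2 hq.2).continuousWithinAt
      exact h1.comp hpair hmaps
    · have := intervalIntegral.continuousOn_primitive_interval' hint (left_mem_uIcc)
      rwa [uIcc_of_le hab] at this
  have hwd : ∀ s ∈ Ico a b, HasDerivWithinAt w 0 (Ici s) s := by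
    intro s hs
    have hs' : s ∈ Icc a b := Ico_subset_Icc_self hs
    have hIcc : Icc s b ⊆ Icc a b := Icc_subset_Icc_left hs.1
    have hmem : ∀ᶠ x in 𝓝[Ici s] s, x ∈ Icc s b := by
      rw [← nhdsWithin_Icc_eq_nhdsGE hs.2]; exact self_mem_nhdsWithin
    -- Taylor remainder of `φ` along the curve
    have e1 : (fun x => φ x (ν x) - φ s (ν s) -
        (φt s (ν s) * (x - s) + ∑ i, p s (ν s) i * (ν x i - ν s i))) =o[𝓝[Ici s] s]
        fun x => x - s := by
      have h1 := (hφ.hasDeriv s (hI hs') (ν s) (hνS s hs')).isLittleO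
      have ht : Tendsto (fun r => (r, ν r)) (𝓝[Ici s] s) (𝓝[I ×ˢ S] (s, ν s)) := by
        rw [← nhdsWithin_Icc_eq_nhdsGE hs.2]
        refine tendsto_nhdsWithin_iff.2 ⟨((hpair.mono hIcc) s (left_mem_Icc.2 hs.2.le)), ?_⟩
        filter_upwards [self_mem_nhdsWithin] with r hr using hmaps (hIcc hr)
      have h2 := h1.comp_tendsto ht
      have h3 : ((fun q : ℝ × (Fin d → ℝ) => q - (s, ν s)) ∘ fun r => (r, ν r)) =O[𝓝[Ici s] s]
          fun x => x - s := by
        refine Asymptotics.IsBigO.of_bound (1 + C) ?_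
        filter_upwards [hmem] with x hx
        simp only [Function.comp, Prod.mk_sub_mk, Prod.norm_mk, Real.norm_eq_abs]
        have := hlip hs' (hIcc hx)
        have h0 := abs_nonneg (x - s)
        refine max_le (by nlinarith) (by nlinarith)
      refine (h2.trans_isBigO h3).congr_left fun x => ?_
      simp only [Function.comp, Prod.mk_sub_mk, timeSpaceForm_apply, Pi.sub_apply]
    -- the integral remainder
    have e2 : (fun x => ∫ r in s..x, (φt r (ν r) - φt s (ν s) +
        ∑ i, (p r (ν r) i - p s (ν s) i) * β r i)) =o[𝓝[Ici s] s] fun x => x - s := by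
      refine isLittleO_integral_of_tendsto hs.2 ?_
      have h1 : Tendsto (fun r => φt r (ν r) - φt s (ν s)) (𝓝[Icc s b] s) (𝓝 0) := by
        have := ((hφtc.mono hIcc) s (left_mem_Icc.2 hs.2.le)).tendsto
        simpa using this.sub_const (φt s (ν s))
      have h2 : ∀ i, Tendsto (fun r => (p r (ν r) i - p s (ν s) i) * β r i) (𝓝[Icc s b] s) (𝓝 0) := by
        intro i
        have h3 := ((hpci i).mono hIcc s (left_mem_Icc.2 hs.2.le)).tendsto.sub_const (p s (ν s) i)
        rw [sub_self] at h3
        refine h3.zero_mul_isBoundedUnder_le ?_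
        refine ⟨C, ?_⟩
        rw [eventually_map]
        filter_upwards [self_mem_nhdsWithin] with r hr
        exact (norm_le_pi_norm (β r) i).trans (hβC r (hIcc hr))
      have := h1.add (tendsto_finsetSum Finset.univ fun i _ => h2 i)
      simpa using this
    rw [hasDerivWithinAt_iff_isLittleO]
    refine (e1.sub e2).congr' ?_ EventuallyEq.rfl
    filter_upwards [hmem] with x hx
    have hx' := hIcc hx
    have i1 := hint.mono_set (hsub a (left_mem_Icc.2 hab) x hx')
    have i2 := hint.mono_set (hsub a (left_mem_Icc.2 hab) s hs')
    have i3 := hint.mono_set (hsub s hs' x hx')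
    have h1 : w x - w s = φ x (ν x) - φ s (ν s) -
        ∫ r in s..x, (φt r (ν r) + ∑ i, p r (ν r) i * β r i) := by
      rw [hw, ← intervalIntegral.integral_interval_sub_left i1 i2]; ring
    have i4 : ∀ i, IntervalIntegrable (fun r => β r i) volume s x := fun i =>
      (hβ i).mono_set (hsub s hs' x hx')
    have i5 : IntervalIntegrable (fun r => ∑ i, p s (ν s) i * β r i) volume s x := by
      have := IntervalIntegrable.sum (μ := volume) (a := s) (b := x) Finset.univ
        (f := fun i => fun r => p s (ν s) i * β r i) fun i _ => (i4 i).const_mul _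
      simpa [Finset.sum_fn] using this
    have h2 : ∫ r in s..x, (φt r (ν r) - φt s (ν s) +
        ∑ i, (p r (ν r) i - p s (ν s) i) * β r i) =
        (∫ r in s..x, (φt r (ν r) + ∑ i, p r (ν r) i * β r i)) -
        (φt s (ν s) * (x - s) + ∑ i, p s (ν s) i * (ν x i - ν s i)) := by
      have h3 : ∫ r in s..x, (φt s (ν s) + ∑ i, p s (ν s) i * β r i) =
          φt s (ν s) * (x - s) + ∑ i, p s (ν s) i * (ν x i - ν s i) := by
        rw [intervalIntegral.integral_add (by simp) i5, intervalIntegral.integral_const,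
          intervalIntegral.integral_finsetSum fun i _ => (i4 i).const_mul _]
        congr 1
        · simp [mul_comm]
        · refine Finset.sum_congr rfl fun i _ => ?_
          rw [intervalIntegral.integral_const_mul, hν x hx' i, hν s hs' i,
            add_sub_add_left_eq_sub, intervalIntegral.integral_interval_sub_left]
          · exact (hβ i).mono_set (hsub a (left_mem_Icc.2 hab) x hx')
          · exact (hβ i).mono_set (hsub a (left_mem_Icc.2 hab) s hs')
      rw [← h3, ← intervalIntegral.integral_sub i3 (IntervalIntegrable.add (by simp) i5)]
      refine intervalIntegral.integral_congr fun r _ => ?_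
      simp only [sub_mul, Finset.sum_sub_distrib]
      ring
    rw [h1, h2]
    simp only [smul_zero]
    ring
  have := constant_of_has_deriv_right_zero hwc hwd b (right_mem_Icc.2 hab)
  simp only [hw, intervalIntegral.integral_same] at this
  linarith

namespace MFCP

variable {d : ℕ} {X : Type*}

/-! ### Measurability along controlled trajectories -/

/-- A function that is continuous on the compact set of times, actions and states is measurable along
a measurable control and a continuous curve. The action space `X` need not be second countable; its
compact subset `P.A` is. -/
theorem aestronglyMeasurable_comp [MetricSpace X] [MeasurableSpace X] [BorelSpace X] {P : MFCP d X}
    (hA : IsCompact P.A) {Φ : ℝ × (Fin d → X) × (Fin d → ℝ) → ℝ}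
    (hΦ : ContinuousOn Φ (Icc 0 P.T ×ˢ (univ.pi fun _ => P.A) ×ˢ stdSimplex ℝ (Fin d)))
    {t₀ : ℝ} (ht₀ : 0 ≤ t₀) {α : ℝ → Fin d → X} {ν : ℝ → Fin d → ℝ}
    (hα : ∀ i, Measurable fun s : Icc t₀ P.T => α s i)
    (hαA : ∀ s ∈ Icc t₀ P.T, ∀ i, α s i ∈ P.A) (hν : ContinuousOn ν (Icc t₀ P.T))
    (hνS : ∀ s ∈ Icc t₀ P.T, ν s ∈ stdSimplex ℝ (Fin d)) :
    AEStronglyMeasurable (fun r => Φ (r, α r, ν r)) (volume.restrict (Icc t₀ P.T)) := by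
  have : CompactSpace P.A := isCompact_iff_compactSpace.1 hA
  have : SecondCountableTopology P.A := inferInstance
  refine AEMeasurable.aestronglyMeasurable
    (aemeasurable_restrict_of_measurable_subtype measurableSet_Icc ?_)
  let Ψ : Icc 0 P.T × (Fin d → P.A) × stdSimplex ℝ (Fin d) → ℝ := fun q =>
    Φ (q.1, fun i => q.2.1 i, q.2.2)
  have hΨ : Continuous Ψ := by
    refine hΦ.comp_continuous (f := fun q : Icc 0 P.T × (Fin d → P.A) × stdSimplex ℝ (Fin d) =>
      ((q.1 : ℝ), (fun i => (q.2.1 i : X)), (q.2.2 : Fin d → ℝ))) (by fun_prop) ?_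
    intro q
    exact ⟨q.1.2, fun i _ => (q.2.1 i).2, q.2.2.2⟩
  let g : Icc t₀ P.T → Icc 0 P.T × (Fin d → P.A) × stdSimplex ℝ (Fin d) := fun r =>
    (⟨r, ht₀.trans r.2.1, r.2.2⟩, fun i => ⟨α r i, hαA r r.2 i⟩, ⟨ν r, hνS r r.2⟩)
  have hg : Measurable g := by
    refine Measurable.prodMk ?_ (Measurable.prodMk ?_ ?_)
    · exact (measurable_subtype_coe).subtype_mk
    · exact measurable_pi_lambda _ fun i => (hα i).subtype_mk
    · exact (hν.domRestrict.measurable).subtype_mk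
  exact hΨ.measurable.comp hg

end MFCP

/-! ### Carathéodory differential equations on the simplex -/

/-- Banach's fixed point theorem for Volterra operators: an iterate is a contraction. -/
theorem exists_eq_of_dist_le_integral {Y : Type*} [MetricSpace Y] [CompleteSpace Y] [Nonempty Y]
    {t₀ T L : ℝ} (h : t₀ ≤ T) (hL : 0 ≤ L) (Φ : C(Icc t₀ T, Y) → C(Icc t₀ T, Y))
    (hΦ : ∀ x y : C(Icc t₀ T, Y), ∀ s : Icc t₀ T, dist (Φ x s) (Φ y s) ≤
      L * ∫ r in t₀..s, dist (x (projIcc t₀ T h r)) (y (projIcc t₀ T h r))) : ∃ x, Φ x = x := by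
  have hn : ∀ n : ℕ, ∀ x y : C(Icc t₀ T, Y), ∀ s : Icc t₀ T,
      dist (Φ^[n] x s) (Φ^[n] y s) ≤ (L * (s - t₀)) ^ n / n.factorial * dist x y := by
    intro n
    induction n with
    | zero => intro x y s; simpa using ContinuousMap.dist_apply_le_dist s
    | succ n ih =>
      intro x y s
      rw [Function.iterate_succ_apply', Function.iterate_succ_apply']
      refine (hΦ _ _ s).trans ?_
      have hcont : Continuous fun r => dist (Φ^[n] x (projIcc t₀ T h r)) (Φ^[n] y (projIcc t₀ T h r)) := by
        have h1 : Continuous (projIcc t₀ T h) := continuous_projIcc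
        fun_prop
      have h1 : ∫ r in t₀..s, dist (Φ^[n] x (projIcc t₀ T h r)) (Φ^[n] y (projIcc t₀ T h r)) ≤
          ∫ r in t₀..s, L ^ n / n.factorial * dist x y * (r - t₀) ^ n := by
        refine intervalIntegral.integral_mono_on s.2.1 (hcont.intervalIntegrable _ _)
          (Continuous.intervalIntegrable (by fun_prop) _ _) fun r hr => ?_
        have hr' : r ∈ Icc t₀ T := ⟨hr.1, hr.2.trans s.2.2⟩
        rw [projIcc_of_mem h hr']
        refine (ih x y ⟨r, hr'⟩).trans (le_of_eq ?_)
        simp only [mul_pow]; ring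
      have h2 : ∫ r in t₀..(s : ℝ), L ^ n / n.factorial * dist x y * (r - t₀) ^ n =
          L ^ n / n.factorial * dist x y * ((s - t₀) ^ (n + 1) / (n + 1)) := by
        rw [intervalIntegral.integral_const_mul,
          intervalIntegral.integral_comp_sub_right (fun r => r ^ n) t₀, integral_pow]
        simp
      refine (mul_le_mul_of_nonneg_left (h1.trans h2.le) hL).trans (le_of_eq ?_)
      rw [Nat.factorial_succ]
      push_cast
      rw [mul_pow, pow_succ L n]
      field_simp
  obtain ⟨n, hn1⟩ : ∃ n : ℕ, (L * (T - t₀)) ^ n / n.factorial < 1 :=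
    ((FloorSemiring.tendsto_pow_div_factorial_atTop (L * (T - t₀))).eventually
      (gt_mem_nhds zero_lt_one)).exists
  have hk : 0 ≤ (L * (T - t₀)) ^ n / n.factorial := by
    have := mul_nonneg hL (sub_nonneg.2 h); positivity
  have : Nonempty C(Icc t₀ T, Y) := ⟨ContinuousMap.const _ (Classical.arbitrary Y)⟩
  have hc : ContractingWith (Real.toNNReal ((L * (T - t₀)) ^ n / n.factorial)) Φ^[n] := by
    refine ⟨by rwa [Real.toNNReal_lt_one], LipschitzWith.of_dist_le_mul fun x y => ?_⟩
    rw [Real.coe_toNNReal _ hk, ContinuousMap.dist_le (by positivity)]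
    intro s
    refine (hn n x y s).trans ?_
    have h3 : 0 ≤ (s : ℝ) - t₀ := sub_nonneg.2 s.2.1
    have h4 : (s : ℝ) ≤ T := s.2.2
    gcongr
  exact ⟨_, hc.isFixedPt_fixedPoint_iterate⟩

theorem isC1On_exp_mul {d : ℕ} (c t₀ : ℝ) (i : Fin d) :
    IsC1On univ univ (fun t w => Real.exp (c * (t - t₀)) * w i)
      (fun t w => c * Real.exp (c * (t - t₀)) * w i)
      (fun t _ => Pi.single i (Real.exp (c * (t - t₀)))) where
  hasDeriv t _ m _ := by
    have h1 : HasFDerivAt (fun q : ℝ × (Fin d → ℝ) => Real.exp (c * (q.1 - t₀)))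
        (Real.exp (c * (t - t₀)) • (c • ContinuousLinearMap.fst ℝ ℝ (Fin d → ℝ))) (t, m) :=
      (((hasFDerivAt_fst (𝕜 := ℝ) (p := (t, m))).sub_const t₀).const_mul c).exp
    have h2 : HasFDerivAt (fun q : ℝ × (Fin d → ℝ) => q.2 i)
        ((ContinuousLinearMap.proj (R := ℝ) (φ := fun _ : Fin d => ℝ) i).comp
          (ContinuousLinearMap.snd ℝ ℝ (Fin d → ℝ))) (t, m) :=
      ((ContinuousLinearMap.proj (R := ℝ) (φ := fun _ : Fin d => ℝ) i).comp
          (ContinuousLinearMap.snd ℝ ℝ (Fin d → ℝ))).hasFDerivAt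
    have h3 := (h1.mul h2).hasFDerivWithinAt (s := univ ×ˢ univ)
    refine h3.congr_fderiv ?_
    refine ContinuousLinearMap.ext fun q => ?_
    obtain ⟨h, k⟩ := q
    simp [timeSpaceForm_apply, Pi.single_apply]
    ring
  cont_time := Continuous.continuousOn (by fun_prop)
  cont_space := by
    refine Continuous.continuousOn (continuous_pi fun j => ?_)
    rcases eq_or_ne j i with rfl | hj
    · simp only [Pi.single_eq_same]; fun_prop
    · simp only [Pi.single_eq_of_ne hj]; fun_prop

/-- The Lipschitz and inwardness conditions on a time-measurable vector field `B`, under which the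
simplex is invariant. -/
structure SimplexField {d : ℕ} (B : ℝ → (Fin d → ℝ) → (Fin d → ℝ)) (t₀ T C : ℝ) : Prop where
  pos : 0 < C
  sum_eq : ∀ t ∈ Icc t₀ T, ∀ m ∈ stdSimplex ℝ (Fin d), ∑ i, B t m i = 0
  inward : ∀ t ∈ Icc t₀ T, ∀ m ∈ stdSimplex ℝ (Fin d), ∀ i, 0 ≤ C * m i + B t m i
  lip : ∀ t ∈ Icc t₀ T, ∀ m ∈ stdSimplex ℝ (Fin d), ∀ q ∈ stdSimplex ℝ (Fin d),
    ‖B t m - B t q‖ ≤ C * ‖m - q‖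
  meas : ∀ ν : ℝ → Fin d → ℝ, ContinuousOn ν (Icc t₀ T) →
    (∀ s ∈ Icc t₀ T, ν s ∈ stdSimplex ℝ (Fin d)) → ∀ i,
      AEStronglyMeasurable (fun r => B r (ν r) i) (volume.restrict (Icc t₀ T))

/-- Existence for `μ' = B(t, μ)` in the simplex. With `w = e^{C (t - t₀)} μ` the equation becomes
`w' = e^{C (t - t₀)} (C μ + B(t, μ))`, whose right-hand side is nonnegative; hence the corresponding
Volterra operator maps the curves in the simplex into themselves. -/
theorem SimplexField.exists_solution {d : ℕ} {B : ℝ → (Fin d → ℝ) → (Fin d → ℝ)} {t₀ T C : ℝ}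
    (hB : SimplexField B t₀ T C) (h : t₀ ≤ T) {m₀ : Fin d → ℝ} (hm₀ : m₀ ∈ stdSimplex ℝ (Fin d)) :
    ∃ μ : ℝ → Fin d → ℝ, ContinuousOn μ (Icc t₀ T) ∧
      (∀ s ∈ Icc t₀ T, μ s ∈ stdSimplex ℝ (Fin d)) ∧
      ∀ s ∈ Icc t₀ T, ∀ i, μ s i = m₀ i + ∫ r in t₀..s, B r (μ r) i := by
  have hC := hB.pos
  -- the integrand `e^{C (r - t₀)} (C ν + B(r, ν))`
  let k : (ℝ → Fin d → ℝ) → ℝ → Fin d → ℝ := fun ν r i =>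
    Real.exp (C * (r - t₀)) * (C * ν r i + B r (ν r) i)
  have hle : ∀ r ∈ Icc t₀ T, ∀ m ∈ stdSimplex ℝ (Fin d), ∀ i, C * m i + B r m i ≤ C := by
    intro r hr m hm i
    have h1 : ∑ i, (C * m i + B r m i) = C := by
      rw [Finset.sum_add_distrib, ← Finset.mul_sum, hm.2, hB.sum_eq r hr m hm]; ring
    refine le_of_le_of_eq ?_ h1
    exact Finset.single_le_sum (f := fun i => C * m i + B r m i)
      (fun j _ => hB.inward r hr m hm j) (Finset.mem_univ i)
  set E := Real.exp (C * (T - t₀)) * C with hE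
  have hk0 : ∀ ν : ℝ → Fin d → ℝ, (∀ s ∈ Icc t₀ T, ν s ∈ stdSimplex ℝ (Fin d)) →
      ∀ r ∈ Icc t₀ T, ∀ i, 0 ≤ k ν r i := fun ν hν r hr i =>
    mul_nonneg (Real.exp_pos _).le (hB.inward r hr _ (hν r hr) i)
  have hkE : ∀ ν : ℝ → Fin d → ℝ, (∀ s ∈ Icc t₀ T, ν s ∈ stdSimplex ℝ (Fin d)) →
      ∀ r ∈ Icc t₀ T, ∀ i, |k ν r i| ≤ E := by
    intro ν hν r hr i
    rw [abs_of_nonneg (hk0 ν hν r hr i)]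
    refine mul_le_mul (Real.exp_le_exp.2 ?_) (hle r hr _ (hν r hr) i)
      (hB.inward r hr _ (hν r hr) i) (Real.exp_pos _).le
    have := hr.2
    gcongr
  have hkm : ∀ ν : ℝ → Fin d → ℝ, ContinuousOn ν (Icc t₀ T) →
      (∀ s ∈ Icc t₀ T, ν s ∈ stdSimplex ℝ (Fin d)) → ∀ i,
      AEStronglyMeasurable (fun r => k ν r i) (volume.restrict (Icc t₀ T)) := by
    intro ν hν hνS i
    have h1 : AEStronglyMeasurable (fun r => C * ν r i) (volume.restrict (Icc t₀ T)) :=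
      (continuousOn_const.mul ((continuous_apply i).comp_continuousOn hν)).aestronglyMeasurable
        measurableSet_Icc
    have h2 : Continuous fun r : ℝ => Real.exp (C * (r - t₀)) := by fun_prop
    exact h2.aestronglyMeasurable.mul (h1.add (hB.meas ν hν hνS i))
  have hkI : ∀ ν : ℝ → Fin d → ℝ, ContinuousOn ν (Icc t₀ T) →
      (∀ s ∈ Icc t₀ T, ν s ∈ stdSimplex ℝ (Fin d)) → ∀ i, ∀ a ∈ Icc t₀ T, ∀ b ∈ Icc t₀ T,
      IntervalIntegrable (fun r => k ν r i) volume a b := fun ν hν hνS i a ha b hb =>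
    intervalIntegrable_of_abs_le (hkm ν hν hνS i) (fun r hr => hkE ν hνS r hr i) ha hb
  have ht₀ : t₀ ∈ Icc t₀ T := left_mem_Icc.2 h
  have hsumk : ∀ ν : ℝ → Fin d → ℝ, ContinuousOn ν (Icc t₀ T) →
      (∀ s ∈ Icc t₀ T, ν s ∈ stdSimplex ℝ (Fin d)) → ∀ s ∈ Icc t₀ T,
      ∑ i, (m₀ i + ∫ r in t₀..s, k ν r i) = Real.exp (C * (s - t₀)) := by
    intro ν hν hνS s hs
    rw [Finset.sum_add_distrib, hm₀.2, ← intervalIntegral.integral_finsetSum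
      fun i _ => hkI ν hν hνS i t₀ ht₀ s hs]
    have h1 : ∫ r in t₀..s, ∑ i, k ν r i = ∫ r in t₀..s, Real.exp (C * (r - t₀)) * (C * 1) := by
      refine intervalIntegral.integral_congr fun r hr => ?_
      rw [uIcc_of_le hs.1] at hr
      have hr' : r ∈ Icc t₀ T := ⟨hr.1, hr.2.trans hs.2⟩
      simp only [k]
      rw [← Finset.mul_sum, Finset.sum_add_distrib, ← Finset.mul_sum, (hνS r hr').2,
        hB.sum_eq r hr' _ (hνS r hr')]
      ring
    rw [h1, intervalIntegral.integral_eq_sub_of_hasDerivAt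
      (f := fun r => Real.exp (C * (r - t₀)))]
    · simp
    · intro x _
      exact (((hasDerivAt_id x).sub_const t₀).const_mul C).exp
    · exact Continuous.intervalIntegrable (by fun_prop) _ _
  let ext : C(Icc t₀ T, stdSimplex ℝ (Fin d)) → ℝ → Fin d → ℝ := fun x r => (x (projIcc t₀ T h r)).1
  have hextc : ∀ x, ContinuousOn (ext x) (Icc t₀ T) := fun x => by
    have h1 : Continuous (projIcc t₀ T h) := continuous_projIcc
    exact Continuous.continuousOn (by fun_prop)
  have hextS : ∀ x, ∀ s ∈ Icc t₀ T, ext x s ∈ stdSimplex ℝ (Fin d) := fun x s _ =>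
    (x (projIcc t₀ T h s)).2
  let Φ : C(Icc t₀ T, stdSimplex ℝ (Fin d)) → C(Icc t₀ T, stdSimplex ℝ (Fin d)) := fun x =>
    ⟨fun s => ⟨fun i => Real.exp (-C * (s - t₀)) * (m₀ i + ∫ r in t₀..s, k (ext x) r i), by
      constructor
      · intro i
        refine mul_nonneg (Real.exp_pos _).le (add_nonneg (hm₀.1 i) ?_)
        exact intervalIntegral.integral_nonneg s.2.1 fun r hr =>
          hk0 _ (hextS x) r ⟨hr.1, hr.2.trans s.2.2⟩ i
      · rw [← Finset.mul_sum, hsumk _ (hextc x) (hextS x) s s.2, ← Real.exp_add]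
        simp⟩, by
      refine Continuous.subtype_mk (continuous_pi fun i => ?_) _
      have h1 := intervalIntegral.continuousOn_primitive_interval'
        (hkI _ (hextc x) (hextS x) i t₀ ht₀ T (right_mem_Icc.2 h)) left_mem_uIcc
      rw [uIcc_of_le h] at h1
      have h2 := h1.domRestrict
      refine Continuous.mul (by fun_prop) (continuous_const.add h2)⟩
  have hne : Nonempty (stdSimplex ℝ (Fin d)) := ⟨⟨m₀, hm₀⟩⟩
  have hcs : CompleteSpace (stdSimplex ℝ (Fin d)) :=
    (isClosed_stdSimplex ℝ (Fin d)).completeSpace_coe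
  obtain ⟨x, hx⟩ := exists_eq_of_dist_le_integral h (L := C + C) (by positivity) Φ (by
    intro x y s
    have hint : Continuous fun r => dist (x (projIcc t₀ T h r)) (y (projIcc t₀ T h r)) := by
      have h1 : Continuous (projIcc t₀ T h) := continuous_projIcc
      fun_prop
    rw [Subtype.dist_eq, dist_pi_le_iff (mul_nonneg (by positivity)
      (intervalIntegral.integral_nonneg s.2.1 fun _ _ => dist_nonneg))]
    intro i
    have h1 : (Φ x s).1 i - (Φ y s).1 i = Real.exp (-C * (s - t₀)) *
        ∫ r in t₀..s, (k (ext x) r i - k (ext y) r i) := by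
      rw [intervalIntegral.integral_sub (hkI _ (hextc x) (hextS x) i t₀ ht₀ s s.2)
        (hkI _ (hextc y) (hextS y) i t₀ ht₀ s s.2)]
      change Real.exp (-C * (s - t₀)) * _ - Real.exp (-C * (s - t₀)) * _ = _
      ring
    rw [Real.dist_eq, h1, ← intervalIntegral.integral_const_mul,
      ← intervalIntegral.integral_const_mul, ← Real.norm_eq_abs]
    refine intervalIntegral.norm_integral_le_of_norm_le s.2.1 ?_
      (Continuous.intervalIntegrable (by fun_prop) _ _)
    refine Eventually.of_forall fun r hr => ?_
    have hr' : r ∈ Icc t₀ T := ⟨hr.1.le, hr.2.trans s.2.2⟩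
    have h2 := hB.lip r hr' _ (hextS x r hr') _ (hextS y r hr')
    have h3 : ‖ext x r - ext y r‖ = dist (x (projIcc t₀ T h r)) (y (projIcc t₀ T h r)) := by
      rw [Subtype.dist_eq, dist_eq_norm]
    have h4 := norm_le_pi_norm (B r (ext x r) - B r (ext y r)) i
    have h5 := norm_le_pi_norm (ext x r - ext y r) i
    rw [h3] at h2 h5
    rw [Pi.sub_apply, Real.norm_eq_abs] at h4 h5
    rw [Real.norm_eq_abs, show Real.exp (-C * (s - t₀)) * (k (ext x) r i - k (ext y) r i) =
      Real.exp (-C * (s - t₀) + C * (r - t₀)) *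
        (C * (ext x r i - ext y r i) + (B r (ext x r) i - B r (ext y r) i)) by
          simp only [k]; rw [Real.exp_add]; ring, abs_mul, Real.abs_exp]
    have h6 : Real.exp (-C * (s - t₀) + C * (r - t₀)) ≤ 1 := by
      rw [Real.exp_le_one_iff]
      have := mul_le_mul_of_nonneg_left hr.2 hC.le
      linarith
    have h7 : |C * (ext x r i - ext y r i) + (B r (ext x r) i - B r (ext y r) i)| ≤
        (C + C) * dist (x (projIcc t₀ T h r)) (y (projIcc t₀ T h r)) := by
      refine (abs_add_le _ _).trans ?_
      rw [abs_mul, abs_of_pos hC]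
      have := mul_le_mul_of_nonneg_left h5 hC.le
      linarith
    calc _ ≤ 1 * _ := mul_le_mul_of_nonneg_right h6 (abs_nonneg _)
      _ ≤ _ := by rw [one_mul]; exact h7)
  refine ⟨ext x, hextc x, hextS x, fun s hs i => ?_⟩
  -- undo the exponential change of unknown
  have hw : ∀ s ∈ Icc t₀ T, ∀ i, ext x s i =
      Real.exp (-C * (s - t₀)) * (m₀ i + ∫ r in t₀..s, k (ext x) r i) := by
    intro s hs i
    have h1 : ext x s = (Φ x (projIcc t₀ T h s)).1 := by rw [hx]
    rw [h1]
    change Real.exp (-C * ((projIcc t₀ T h s : ℝ) - t₀)) * _ = _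
    rw [projIcc_of_mem h hs]
  have hsub : ∀ r ∈ Icc t₀ s, r ∈ Icc t₀ T := fun r hr => ⟨hr.1, hr.2.trans hs.2⟩
  have hchain := (isC1On_exp_mul (-C) t₀ i).sub_eq_integral hs.1 (subset_univ _)
    (ν := fun s i => m₀ i + ∫ r in t₀..s, k (ext x) r i) (β := k (ext x)) (ν₀ := m₀) (C := E)
    (fun _ _ => mem_univ _) (fun j => hkI _ (hextc x) (hextS x) j t₀ ht₀ s hs)
    (fun r hr => (pi_norm_le_iff_of_nonneg (by positivity)).2 fun j =>
      hkE _ (hextS x) r (hsub r hr) j) (fun _ _ _ => rfl)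
  simp only [sub_self, mul_zero, Real.exp_zero, intervalIntegral.integral_same, add_zero,
    one_mul] at hchain
  rw [hw s hs i, ← sub_eq_iff_eq_add', hchain]
  refine intervalIntegral.integral_congr fun r hr => ?_
  rw [uIcc_of_le hs.1] at hr
  have h1 := hw r (hsub r hr) i
  have h2 : Real.exp (-C * (r - t₀)) * Real.exp (C * (r - t₀)) = 1 := by
    rw [← Real.exp_add]; simp
  simp only [Pi.single_apply, ite_mul, zero_mul, Finset.sum_ite_eq', Finset.mem_univ, if_true]
  rw [mul_assoc, ← h1]
  simp only [k]
  rw [← mul_assoc, h2]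
  ring

/-- Two trajectories whose velocities differ by at most `K` times their distance. -/
theorem norm_sub_le_exp_of_integral_eq {d : ℕ} {μ ν β γ : ℝ → Fin d → ℝ} {m q : Fin d → ℝ}
    {a b K : ℝ} (hK : 0 ≤ K) (hμc : ContinuousOn μ (Icc a b)) (hνc : ContinuousOn ν (Icc a b))
    (hβ : ∀ i, IntervalIntegrable (fun r => β r i) volume a b)
    (hγ : ∀ i, IntervalIntegrable (fun r => γ r i) volume a b)
    (hμ : ∀ s ∈ Icc a b, ∀ i, μ s i = m i + ∫ r in a..s, β r i)
    (hν : ∀ s ∈ Icc a b, ∀ i, ν s i = q i + ∫ r in a..s, γ r i)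
    (h : ∀ᵐ r, r ∈ Icc a b → ‖β r - γ r‖ ≤ K * ‖μ r - ν r‖) :
    ∀ s ∈ Icc a b, ‖μ s - ν s‖ ≤ ‖m - q‖ * Real.exp (K * (s - a)) := by
  have hc : ContinuousOn (fun r => ‖μ r - ν r‖) (Icc a b) := (hμc.sub hνc).norm
  refine le_mul_exp_of_le_integral hc hK fun s hs => ?_
  have hsub : Icc a s ⊆ Icc a b := Icc_subset_Icc_right hs.2
  have hn : 0 ≤ ∫ r in a..s, ‖μ r - ν r‖ :=
    intervalIntegral.integral_nonneg hs.1 fun _ _ => norm_nonneg _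
  have hu : uIcc a s ⊆ uIcc a b := by
    rw [uIcc_of_le hs.1, uIcc_of_le (hs.1.trans hs.2)]; exact hsub
  rw [pi_norm_le_iff_of_nonneg (by positivity)]
  intro i
  rw [Pi.sub_apply, hμ s hs i, hν s hs i, add_sub_add_comm, ← intervalIntegral.integral_sub
    ((hβ i).mono_set hu) ((hγ i).mono_set hu)]
  refine (norm_add_le _ _).trans (add_le_add (norm_le_pi_norm (m - q) i) ?_)
  rw [← intervalIntegral.integral_const_mul]
  refine intervalIntegral.norm_integral_le_of_norm_le hs.1 ?_ ?_
  · filter_upwards [h] with r hr hrm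
    exact (norm_le_pi_norm (β r - γ r) i).trans (hr (hsub ⟨hrm.1.le, hrm.2⟩))
  · exact ((hc.mono hsub).const_mul K |>.intervalIntegrable_of_Icc hs.1)

/-- Mass that leaves at a bounded rate is never exhausted. -/
theorem pos_of_integral_eq {y β : ℝ → ℝ} {y₀ a b K : ℝ} (hK : 0 ≤ K)
    (hyc : ContinuousOn y (Icc a b)) (hβ : IntervalIntegrable β volume a b)
    (hy : ∀ s ∈ Icc a b, y s = y₀ + ∫ r in a..s, β r) (h : ∀ r ∈ Icc a b, -(K * y r) ≤ β r)
    (h₀ : 0 < y₀) : ∀ s ∈ Icc a b, 0 < y s := by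
  intro s hs
  -- Grönwall's inequality backward in time from `s`
  have hmaps : ∀ τ ∈ Icc 0 (s - a), s - τ ∈ Icc a b := fun τ hτ =>
    ⟨by linarith [hτ.2], by linarith [hτ.1, hs.2]⟩
  have hu : ∀ x ∈ Icc a b, ∀ x' ∈ Icc a b, uIcc x x' ⊆ uIcc a b := fun x hx x' hx' => by
    rw [uIcc_of_le (hs.1.trans hs.2)]; exact uIcc_subset_Icc hx hx'
  have ha : a ∈ Icc a b := left_mem_Icc.2 (hs.1.trans hs.2)
  have h1 := le_mul_exp_of_le_integral (u := fun τ => y (s - τ)) (a := 0) (b := s - a) (c := y s)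
    (K := K) (hyc.comp (by fun_prop) hmaps) hK (by
      intro τ hτ
      rw [intervalIntegral.integral_comp_sub_left (fun r => y r) s, sub_zero, hy _ (hmaps τ hτ),
        hy s hs, ← intervalIntegral.integral_const_mul]
      have h2 := intervalIntegral.integral_add_adjacent_intervals
        (hβ.mono_set (hu a ha _ (hmaps τ hτ))) (hβ.mono_set (hu _ (hmaps τ hτ) s hs))
      have hle : s - τ ≤ s := by linarith [hτ.1]
      have hsub : Icc (s - τ) s ⊆ Icc a b := Icc_subset_Icc (hmaps τ hτ).1 hs.2
      have h3 : ∫ r in (s - τ)..s, -(K * y r) ≤ ∫ r in (s - τ)..s, β r := by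
        refine intervalIntegral.integral_mono_on hle ?_ (hβ.mono_set (hu _ (hmaps τ hτ) s hs))
          fun r hr => h r (hsub hr)
        exact (((hyc.mono hsub).const_mul K).neg).intervalIntegrable_of_Icc hle
      rw [intervalIntegral.integral_neg] at h3
      linarith) (s - a) ⟨by linarith [hs.1], le_rfl⟩
  simp only [sub_sub_cancel, hy a ha, intervalIntegral.integral_same, add_zero] at h1
  exact pos_of_mul_pos_left (h₀.trans_le h1) (Real.exp_pos _).le

theorem integral_congr_uIoc {f g : ℝ → ℝ} {a b : ℝ} (h : EqOn f g (uIoc a b)) :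
    ∫ x in a..b, f x = ∫ x in a..b, g x :=
  intervalIntegral.integral_congr_ae (Eventually.of_forall fun _ hx => h hx)

namespace MFCP

variable {d : ℕ} {X : Type*}

/-! ### Controlled trajectories -/

theorem IsAdmissible.start [MeasurableSpace X] {P : MFCP d X} {t₀ : ℝ}
    {m₀ : Fin d → ℝ} {α : ℝ → Fin d → X} {μ : ℝ → Fin d → ℝ} (h : P.IsAdmissible t₀ m₀ α μ)
    (ht : t₀ ≤ P.T) : μ t₀ = m₀ := by
  ext i
  rw [h.state_eq t₀ (left_mem_Icc.2 ht) i]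
  simp

theorem IsAdmissible.norm_drift_le [MeasurableSpace X] {P : MFCP d X} {t₀ : ℝ}
    {m₀ : Fin d → ℝ} {α : ℝ → Fin d → X} {μ : ℝ → Fin d → ℝ} (h : P.IsAdmissible t₀ m₀ α μ) {C : ℝ} (hC : P.Bounds C)
    (ht₀ : 0 ≤ t₀) {r : ℝ} (hr : r ∈ Icc t₀ P.T) : ‖P.drift r (α r) (μ r)‖ ≤ C :=
  hC.drift_le r ⟨ht₀.trans hr.1, hr.2⟩ _ (h.mem_A r hr) _ (h.mem_simplex r hr)

theorem IsAdmissible.abs_integral_F_le [MeasurableSpace X] {P : MFCP d X} {t₀ : ℝ} {m₀ : Fin d → ℝ} {α : ℝ → Fin d → X}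
    {μ : ℝ → Fin d → ℝ} (h : P.IsAdmissible t₀ m₀ α μ) {C : ℝ} (hC : P.Bounds C) (ht₀ : 0 ≤ t₀)
    {a b : ℝ} (ha : a ∈ Icc t₀ P.T) (hb : b ∈ Icc t₀ P.T) :
    |∫ r in a..b, P.F r (α r) (μ r)| ≤ C * |b - a| :=
  abs_integral_le_of_le (fun r hr =>
    hC.F_le r ⟨ht₀.trans hr.1, hr.2⟩ _ (h.mem_A r hr) _ (h.mem_simplex r hr)) ha hb

theorem IsAdmissible.V_le [MetricSpace X] [MeasurableSpace X] {P : MFCP d X} {t₀ : ℝ}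
    {m₀ : Fin d → ℝ} {α : ℝ → Fin d → X}
    {μ : ℝ → Fin d → ℝ} (h : P.IsAdmissible t₀ m₀ α μ) (hA : P.AssumptionA)
    (ht₀ : t₀ ∈ Icc 0 P.T) : P.V t₀ m₀ ≤ P.J t₀ α μ := by
  obtain ⟨C, hC⟩ := hA.exists_bounds
  refine csInf_le ⟨-(C * |P.T - t₀|) - C, ?_⟩ ⟨α, μ, h, rfl⟩
  rintro _ ⟨β, ν, hν, rfl⟩
  have h1 := hν.abs_integral_F_le hC ht₀.1 (left_mem_Icc.2 ht₀.2) (right_mem_Icc.2 ht₀.2)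
  have h2 := hC.G_le _ (hν.mem_simplex P.T (right_mem_Icc.2 ht₀.2))
  rw [J]
  linarith [(abs_le.1 h1).1, (abs_le.1 h2).1]

variable [MetricSpace X] [MeasurableSpace X] [BorelSpace X] {P : MFCP d X}

theorem AssumptionA.aestronglyMeasurable_drift (hA : P.AssumptionA) {t₀ : ℝ} (ht₀ : 0 ≤ t₀)
    {α : ℝ → Fin d → X} {ν : ℝ → Fin d → ℝ}
    (hα : ∀ i, Measurable fun s : Icc t₀ P.T => α s i)
    (hαA : ∀ s ∈ Icc t₀ P.T, ∀ i, α s i ∈ P.A) (hν : ContinuousOn ν (Icc t₀ P.T))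
    (hνS : ∀ s ∈ Icc t₀ P.T, ν s ∈ stdSimplex ℝ (Fin d)) (i : Fin d) :
    AEStronglyMeasurable (fun r => P.drift r (α r) (ν r) i) (volume.restrict (Icc t₀ P.T)) :=
  aestronglyMeasurable_comp hA.A_compact (hA.continuousOn_drift i) ht₀ hα hαA hν hνS

/-- The drift along a control is integrable along any continuous curve in the simplex. -/
theorem AssumptionA.intervalIntegrable_drift (hA : P.AssumptionA) {C : ℝ} (hC : P.Bounds C) {t₀ : ℝ}
    (ht₀ : 0 ≤ t₀) {α : ℝ → Fin d → X} {ν : ℝ → Fin d → ℝ}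
    (hα : ∀ i, Measurable fun s : Icc t₀ P.T => α s i)
    (hαA : ∀ s ∈ Icc t₀ P.T, ∀ i, α s i ∈ P.A) (hν : ContinuousOn ν (Icc t₀ P.T))
    (hνS : ∀ s ∈ Icc t₀ P.T, ν s ∈ stdSimplex ℝ (Fin d)) {a b : ℝ} (ha : a ∈ Icc t₀ P.T)
    (hb : b ∈ Icc t₀ P.T) (i : Fin d) :
    IntervalIntegrable (fun r => P.drift r (α r) (ν r) i) volume a b :=
  intervalIntegrable_of_abs_le (hA.aestronglyMeasurable_drift ht₀ hα hαA hν hνS i)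
    (fun r hr => (norm_le_pi_norm _ i).trans
      (hC.drift_le r ⟨ht₀.trans hr.1, hr.2⟩ _ (hαA r hr) _ (hνS r hr))) ha hb

theorem AssumptionA.intervalIntegrable_F (hA : P.AssumptionA) {C : ℝ} (hC : P.Bounds C) {t₀ : ℝ}
    (ht₀ : 0 ≤ t₀) {α : ℝ → Fin d → X} {ν : ℝ → Fin d → ℝ}
    (hα : ∀ i, Measurable fun s : Icc t₀ P.T => α s i)
    (hαA : ∀ s ∈ Icc t₀ P.T, ∀ i, α s i ∈ P.A) (hν : ContinuousOn ν (Icc t₀ P.T))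
    (hνS : ∀ s ∈ Icc t₀ P.T, ν s ∈ stdSimplex ℝ (Fin d)) {a b : ℝ} (ha : a ∈ Icc t₀ P.T)
    (hb : b ∈ Icc t₀ P.T) :
    IntervalIntegrable (fun r => P.F r (α r) (ν r)) volume a b :=
  intervalIntegrable_of_abs_le (aestronglyMeasurable_comp hA.A_compact hA.F_cont ht₀ hα hαA hν hνS)
    (fun r hr => hC.F_le r ⟨ht₀.trans hr.1, hr.2⟩ _ (hαA r hr) _ (hνS r hr)) ha hb

section

variable {t₀ : ℝ} {m₀ : Fin d → ℝ} {α : ℝ → Fin d → X} {μ : ℝ → Fin d → ℝ}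

theorem IsAdmissible.intervalIntegrable_drift (h : P.IsAdmissible t₀ m₀ α μ) (hA : P.AssumptionA)
    (ht₀ : 0 ≤ t₀) {a b : ℝ} (ha : a ∈ Icc t₀ P.T) (hb : b ∈ Icc t₀ P.T) (i : Fin d) :
    IntervalIntegrable (fun r => P.drift r (α r) (μ r) i) volume a b :=
  hA.intervalIntegrable_drift hA.exists_bounds.choose_spec ht₀ h.measurable h.mem_A h.continuousOn
    h.mem_simplex ha hb i

theorem IsAdmissible.intervalIntegrable_F (h : P.IsAdmissible t₀ m₀ α μ) (hA : P.AssumptionA)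
    (ht₀ : 0 ≤ t₀) {a b : ℝ} (ha : a ∈ Icc t₀ P.T) (hb : b ∈ Icc t₀ P.T) :
    IntervalIntegrable (fun r => P.F r (α r) (μ r)) volume a b :=
  hA.intervalIntegrable_F hA.exists_bounds.choose_spec ht₀ h.measurable h.mem_A h.continuousOn
    h.mem_simplex ha hb

theorem IsAdmissible.norm_sub_le (h : P.IsAdmissible t₀ m₀ α μ) (hA : P.AssumptionA) {C : ℝ}
    (hC : P.Bounds C) (ht₀ : 0 ≤ t₀) {s s' : ℝ} (hs : s ∈ Icc t₀ P.T) (hs' : s' ∈ Icc t₀ P.T) :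
    ‖μ s' - μ s‖ ≤ C * |s' - s| := by
  have hT : t₀ ≤ P.T := hs.1.trans hs.2
  exact norm_sub_le_of_integral_eq hC.pos.le
    (fun i => h.intervalIntegrable_drift hA ht₀ (left_mem_Icc.2 hT) (right_mem_Icc.2 hT) i)
    (fun r hr => h.norm_drift_le hC ht₀ hr) h.state_eq hs hs'

theorem IsAdmissible.sub_eq_integral (h : P.IsAdmissible t₀ m₀ α μ) (hA : P.AssumptionA)
    (ht₀ : 0 ≤ t₀) {s s' : ℝ} (hs : s ∈ Icc t₀ P.T) (hs' : s' ∈ Icc t₀ P.T) (i : Fin d) :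
    μ s' i - μ s i = ∫ r in s..s', P.drift r (α r) (μ r) i := by
  have hl : t₀ ∈ Icc t₀ P.T := left_mem_Icc.2 (hs.1.trans hs.2)
  rw [h.state_eq s hs, h.state_eq s' hs', add_sub_add_left_eq_sub,
    intervalIntegral.integral_interval_sub_left (h.intervalIntegrable_drift hA ht₀ hl hs' i)
      (h.intervalIntegrable_drift hA ht₀ hl hs i)]

theorem IsAdmissible.pos (h : P.IsAdmissible t₀ m₀ α μ) (hA : P.AssumptionA)
    (ht₀ : 0 ≤ t₀) {s : ℝ} (hs : s ∈ Icc t₀ P.T) {i : Fin d} (hi : 0 < m₀ i) : 0 < μ s i := by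
  obtain ⟨C, hC⟩ := hA.exists_bounds
  have hT : t₀ ≤ P.T := hs.1.trans hs.2
  refine pos_of_integral_eq hC.pos.le ((continuous_apply i).comp_continuousOn h.continuousOn)
    (h.intervalIntegrable_drift hA ht₀ (left_mem_Icc.2 hT) (right_mem_Icc.2 hT) i)
    (fun s hs => h.state_eq s hs i) (fun r hr => ?_) hi s hs
  have := hC.inward r ⟨ht₀.trans hr.1, hr.2⟩ _ (h.mem_A r hr) _ (h.mem_simplex r hr) i
  simp only [Function.comp_apply]
  linarith

end

theorem AssumptionA.exists_isAdmissible (hA : P.AssumptionA) {t₀ : ℝ} (ht₀ : t₀ ∈ Icc 0 P.T)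
    {m₀ : Fin d → ℝ} (hm₀ : m₀ ∈ stdSimplex ℝ (Fin d)) {α : ℝ → Fin d → X}
    (hα : ∀ i, Measurable fun s : Icc t₀ P.T => α s i)
    (hαA : ∀ s ∈ Icc t₀ P.T, ∀ i, α s i ∈ P.A) : ∃ μ, P.IsAdmissible t₀ m₀ α μ := by
  obtain ⟨C, hC⟩ := hA.exists_bounds
  have hI : ∀ r ∈ Icc t₀ P.T, r ∈ Icc 0 P.T := fun r hr => ⟨ht₀.1.trans hr.1, hr.2⟩
  have hB : SimplexField (fun r m => P.drift r (α r) m) t₀ P.T C :=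
    { pos := hC.pos
      sum_eq := fun t _ m _ => P.sum_drift t _ m
      inward := fun t ht m hm i => hC.inward t (hI t ht) _ (hαA t ht) m hm i
      lip := fun t ht m hm q hq => by
        simpa using hC.drift_lip t (hI t ht) t (hI t ht) _ (hαA t ht) m hm q hq
      meas := fun ν hν hνS i => hA.aestronglyMeasurable_drift ht₀.1 hα hαA hν hνS i }
  obtain ⟨μ, h1, h2, h3⟩ := hB.exists_solution ht₀.2 hm₀
  exact ⟨μ, ⟨hα, hαA, h2, h1, h3⟩⟩

theorem AssumptionA.exists_isAdmissible_const (hA : P.AssumptionA) {t₀ : ℝ} (ht₀ : t₀ ∈ Icc 0 P.T)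
    {m₀ : Fin d → ℝ} (hm₀ : m₀ ∈ stdSimplex ℝ (Fin d)) {a : Fin d → X} (ha : ∀ i, a i ∈ P.A) :
    ∃ μ, P.IsAdmissible t₀ m₀ (fun _ => a) μ :=
  hA.exists_isAdmissible ht₀ hm₀ (fun _ => measurable_const) (fun _ _ => ha)

/-- Continuous dependence on the initial state, for a fixed control. -/
theorem IsAdmissible.norm_sub_le_exp {t₀ : ℝ} {m q : Fin d → ℝ} {α : ℝ → Fin d → X}
    {μ ν : ℝ → Fin d → ℝ} (hμ : P.IsAdmissible t₀ m α μ) (hν : P.IsAdmissible t₀ q α ν)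
    (hA : P.AssumptionA) {C : ℝ} (hC : P.Bounds C) (ht₀ : 0 ≤ t₀) {s : ℝ} (hs : s ∈ Icc t₀ P.T) :
    ‖μ s - ν s‖ ≤ ‖m - q‖ * Real.exp (C * (s - t₀)) := by
  have hT : t₀ ≤ P.T := hs.1.trans hs.2
  refine norm_sub_le_exp_of_integral_eq hC.pos.le hμ.continuousOn hν.continuousOn
    (fun i => hμ.intervalIntegrable_drift hA ht₀ (left_mem_Icc.2 hT) (right_mem_Icc.2 hT) i)
    (fun i => hν.intervalIntegrable_drift hA ht₀ (left_mem_Icc.2 hT) (right_mem_Icc.2 hT) i)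
    hμ.state_eq hν.state_eq (Eventually.of_forall fun r hr => ?_) s hs
  have hr' : r ∈ Icc 0 P.T := ⟨ht₀.trans hr.1, hr.2⟩
  simpa using hC.drift_lip r hr' r hr' _ (hμ.mem_A r hr) _ (hμ.mem_simplex r hr) _
    (hν.mem_simplex r hr)

theorem IsAdmissible.norm_sub_le_mul {t₀ : ℝ} {m q : Fin d → ℝ} {α : ℝ → Fin d → X}
    {μ ν : ℝ → Fin d → ℝ} (hμ : P.IsAdmissible t₀ m α μ) (hν : P.IsAdmissible t₀ q α ν)
    (hA : P.AssumptionA) {C : ℝ} (hC : P.Bounds C) (ht₀ : 0 ≤ t₀) {s : ℝ} (hs : s ∈ Icc t₀ P.T) :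
    ‖μ s - ν s‖ ≤ Real.exp (C * P.T) * ‖m - q‖ := by
  refine (hμ.norm_sub_le_exp hν hA hC ht₀ hs).trans ?_
  rw [mul_comm]
  have := hC.pos
  have h1 : s - t₀ ≤ P.T := by linarith [hs.2]
  gcongr

/-! ### The dynamic programming principle -/

theorem AssumptionA.exists_J_lt (hA : P.AssumptionA) {t₀ : ℝ} (ht₀ : t₀ ∈ Icc 0 P.T)
    {m₀ : Fin d → ℝ} (hm₀ : m₀ ∈ stdSimplex ℝ (Fin d)) {ε : ℝ} (hε : 0 < ε) :
    ∃ α μ, P.IsAdmissible t₀ m₀ α μ ∧ P.J t₀ α μ < P.V t₀ m₀ + ε := by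
  obtain ⟨a, ha⟩ := hA.A_nonempty
  obtain ⟨μ, hμ⟩ := hA.exists_isAdmissible_const ht₀ hm₀ (a := fun _ => a) (fun _ => ha)
  have hne : {c | ∃ α μ, P.IsAdmissible t₀ m₀ α μ ∧ c = P.J t₀ α μ}.Nonempty := ⟨_, _, _, hμ, rfl⟩
  obtain ⟨_, ⟨α, ν, hν, rfl⟩, hlt⟩ := Real.lt_sInf_add_pos hne hε
  exact ⟨α, ν, hν, hlt⟩

theorem AssumptionA.V_terminal (hA : P.AssumptionA) {m : Fin d → ℝ}
    (hm : m ∈ stdSimplex ℝ (Fin d)) : P.V P.T m = P.G m := by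
  have hT : P.T ∈ Icc 0 P.T := right_mem_Icc.2 hA.T_pos.le
  have hJ : ∀ α μ, P.IsAdmissible P.T m α μ → P.J P.T α μ = P.G m := fun α μ h => by
    rw [J, intervalIntegral.integral_same, zero_add, h.start le_rfl]
  refine le_antisymm ?_ (le_of_forall_pos_lt_add fun ε hε => ?_)
  · obtain ⟨a, ha⟩ := hA.A_nonempty
    obtain ⟨μ, hμ⟩ := hA.exists_isAdmissible_const hT hm (a := fun _ => a) (fun _ => ha)
    exact (hμ.V_le hA hT).trans_eq (hJ _ _ hμ)
  · obtain ⟨α, μ, hμ, h⟩ := hA.exists_J_lt hT hm hε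
    rwa [hJ _ _ hμ] at h

/-- Following one control up to time `s` and another one afterwards. -/
theorem IsAdmissible.concat {t₀ s : ℝ} {m₀ : Fin d → ℝ} {α β : ℝ → Fin d → X}
    {μ ν : ℝ → Fin d → ℝ} (h : P.IsAdmissible t₀ m₀ α μ) (hs : s ∈ Icc t₀ P.T)
    (h' : P.IsAdmissible s (μ s) β ν) (hA : P.AssumptionA) (ht₀ : 0 ≤ t₀) :
    P.IsAdmissible t₀ m₀ (fun r => if r ≤ s then α r else β r)
      (fun r => if r ≤ s then μ r else ν r) ∧
    P.J t₀ (fun r => if r ≤ s then α r else β r) (fun r => if r ≤ s then μ r else ν r) =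
      (∫ r in t₀..s, P.F r (α r) (μ r)) + P.J s β ν := by
  have hνs := h'.start hs.2
  have hl : t₀ ∈ Icc t₀ P.T := left_mem_Icc.2 (hs.1.trans hs.2)
  -- integrals along the concatenated trajectory
  have key : ∀ Ψ : ℝ → (Fin d → X) → (Fin d → ℝ) → ℝ,
      (∀ r ∈ Icc t₀ P.T, IntervalIntegrable (fun r => Ψ r (α r) (μ r)) volume t₀ r) →
      (∀ r ∈ Icc s P.T, IntervalIntegrable (fun r => Ψ r (β r) (ν r)) volume s r) →
      (∀ r ∈ Icc t₀ s, ∫ x in t₀..r, Ψ x (if x ≤ s then α x else β x) (if x ≤ s then μ x else ν x) =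
        ∫ x in t₀..r, Ψ x (α x) (μ x)) ∧
      ∀ r ∈ Icc s P.T, ∫ x in t₀..r, Ψ x (if x ≤ s then α x else β x) (if x ≤ s then μ x else ν x) =
        (∫ x in t₀..s, Ψ x (α x) (μ x)) + ∫ x in s..r, Ψ x (β x) (ν x) := by
    intro Ψ h1 h2
    have e1 : ∀ r ∈ Icc t₀ s, EqOn (fun x => Ψ x (α x) (μ x))
        (fun x => Ψ x (if x ≤ s then α x else β x) (if x ≤ s then μ x else ν x)) (uIoc t₀ r) := by
      intro r hr x hx
      rw [uIoc_of_le hr.1] at hx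
      have : x ≤ s := hx.2.trans hr.2
      simp [this]
    have e2 : ∀ r ∈ Icc s P.T, EqOn (fun x => Ψ x (β x) (ν x))
        (fun x => Ψ x (if x ≤ s then α x else β x) (if x ≤ s then μ x else ν x)) (uIoc s r) := by
      intro r hr x hx
      rw [uIoc_of_le hr.1] at hx
      simp [not_le.2 hx.1]
    have i1 : ∀ r ∈ Icc t₀ s, ∫ x in t₀..r,
        Ψ x (if x ≤ s then α x else β x) (if x ≤ s then μ x else ν x) =
        ∫ x in t₀..r, Ψ x (α x) (μ x) := fun r hr =>
      (integral_congr_uIoc (e1 r hr)).symm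
    refine ⟨i1, fun r hr => ?_⟩
    rw [← i1 s (right_mem_Icc.2 hs.1), integral_congr_uIoc (e2 r hr),
      intervalIntegral.integral_add_adjacent_intervals]
    · exact (h1 s hs).congr (e1 s (right_mem_Icc.2 hs.1))
    · exact (h2 r hr).congr (e2 r hr)
  have hcase : ∀ r ∈ Icc t₀ P.T, ¬ r ≤ s → r ∈ Icc s P.T := fun r hr h => ⟨(not_le.1 h).le, hr.2⟩
  have hsT : s ∈ Icc s P.T := left_mem_Icc.2 hs.2
  have hs0 : 0 ≤ s := ht₀.trans hs.1
  refine ⟨⟨?_, ?_, ?_, ?_, ?_⟩, ?_⟩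
  · intro i
    have hg : Measurable fun r : Icc t₀ P.T =>
        (⟨max s r, le_max_left _ _, max_le hs.2 r.2.2⟩ : Icc s P.T) :=
      (measurable_const.max measurable_subtype_coe).subtype_mk
    have h1 := (h'.measurable i).comp hg
    have h2 : (fun r : Icc t₀ P.T => (if (r : ℝ) ≤ s then α r else β r) i) =
        fun r : Icc t₀ P.T => if (r : ℝ) ≤ s then α r i else β (max s r) i := by
      ext r
      by_cases hr : (r : ℝ) ≤ s
      · simp [hr]
      · simp [hr, max_eq_right (not_le.1 hr).le]
    rw [h2]
    exact Measurable.ite (measurableSet_le measurable_subtype_coe measurable_const)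
      (h.measurable i) h1
  · intro r hr i
    by_cases hrs : r ≤ s
    · simpa [hrs] using h.mem_A r hr i
    · simpa [hrs] using h'.mem_A r (hcase r hr hrs) i
  · intro r hr
    by_cases hrs : r ≤ s
    · simpa [hrs] using h.mem_simplex r hr
    · simpa [hrs] using h'.mem_simplex r (hcase r hr hrs)
  · have hc1 : ContinuousOn (fun r => if r ≤ s then μ r else ν r) (Icc t₀ s) :=
      (h.continuousOn.mono (Icc_subset_Icc_right hs.2)).congr fun r hr => by simp [hr.2]
    have hc2 : ContinuousOn (fun r => if r ≤ s then μ r else ν r) (Icc s P.T) :=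
      h'.continuousOn.congr fun r hr => by
        rcases hr.1.eq_or_lt with rfl | h3
        · simp [hνs]
        · simp [not_le.2 h3]
    have := hc1.union_of_isClosed hc2 isClosed_Icc isClosed_Icc
    rwa [Icc_union_Icc_eq_Icc hs.1 hs.2] at this
  · intro r hr i
    obtain ⟨k1, k2⟩ := key (fun x a m => P.drift x a m i)
      (fun r hr => h.intervalIntegrable_drift hA ht₀ hl hr i)
      (fun r hr => h'.intervalIntegrable_drift hA hs0 hsT hr i)
    by_cases hrs : r ≤ s
    · rw [k1 r ⟨hr.1, hrs⟩, ← h.state_eq r hr i]; simp [hrs]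
    · rw [k2 r (hcase r hr hrs), ← add_assoc, ← h.state_eq s hs i,
        ← h'.state_eq r (hcase r hr hrs) i]; simp [hrs]
  · obtain ⟨-, k2⟩ := key (fun x a m => P.F x a m)
      (fun r hr => h.intervalIntegrable_F hA ht₀ hl hr)
      (fun r hr => h'.intervalIntegrable_F hA hs0 hsT hr)
    rw [J, J, k2 P.T (right_mem_Icc.2 hs.2), add_assoc]
    congr 3
    by_cases hTs : P.T ≤ s
    · have : s = P.T := le_antisymm hs.2 hTs
      subst this
      simp [hνs]
    · simp [hTs]

theorem IsAdmissible.restrict {t₀ s : ℝ} {m₀ : Fin d → ℝ} {α : ℝ → Fin d → X}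
    {μ : ℝ → Fin d → ℝ} (h : P.IsAdmissible t₀ m₀ α μ) (hs : s ∈ Icc t₀ P.T)
    (hA : P.AssumptionA) (ht₀ : 0 ≤ t₀) :
    P.IsAdmissible s (μ s) α μ ∧
      P.J t₀ α μ = (∫ r in t₀..s, P.F r (α r) (μ r)) + P.J s α μ := by
  have hsub : Icc s P.T ⊆ Icc t₀ P.T := Icc_subset_Icc_left hs.1
  refine ⟨⟨fun i => (h.measurable i).comp (measurable_inclusion hsub), fun r hr => h.mem_A r (hsub hr),
    fun r hr => h.mem_simplex r (hsub hr), h.continuousOn.mono hsub, fun r hr i => ?_⟩, ?_⟩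
  · rw [← h.sub_eq_integral hA ht₀ hs (hsub hr) i]; ring
  · have hl : t₀ ∈ Icc t₀ P.T := left_mem_Icc.2 (hs.1.trans hs.2)
    have hr : P.T ∈ Icc t₀ P.T := right_mem_Icc.2 (hs.1.trans hs.2)
    rw [J, J, ← add_assoc, intervalIntegral.integral_add_adjacent_intervals
      (h.intervalIntegrable_F hA ht₀ hl hs) (h.intervalIntegrable_F hA ht₀ hs hr)]

theorem IsAdmissible.V_le_integral_add {t₀ s : ℝ} {m₀ : Fin d → ℝ} {α : ℝ → Fin d → X}
    {μ : ℝ → Fin d → ℝ} (h : P.IsAdmissible t₀ m₀ α μ) (hs : s ∈ Icc t₀ P.T)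
    (hA : P.AssumptionA) (ht₀ : 0 ≤ t₀) :
    P.V t₀ m₀ ≤ (∫ r in t₀..s, P.F r (α r) (μ r)) + P.V s (μ s) := by
  refine le_of_forall_pos_le_add fun ε hε => ?_
  obtain ⟨β, ν, hν, hlt⟩ := hA.exists_J_lt ⟨ht₀.trans hs.1, hs.2⟩ (h.mem_simplex s hs) hε
  obtain ⟨h1, h2⟩ := h.concat hs hν hA ht₀
  have := h1.V_le hA ⟨ht₀, hs.1.trans hs.2⟩
  linarith

theorem IsAdmissible.integral_add_V_le {t₀ s : ℝ} {m₀ : Fin d → ℝ} {α : ℝ → Fin d → X}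
    {μ : ℝ → Fin d → ℝ} (h : P.IsAdmissible t₀ m₀ α μ) (hs : s ∈ Icc t₀ P.T)
    (hA : P.AssumptionA) (ht₀ : 0 ≤ t₀) :
    (∫ r in t₀..s, P.F r (α r) (μ r)) + P.V s (μ s) ≤ P.J t₀ α μ := by
  obtain ⟨h1, h2⟩ := h.restrict hs hA ht₀
  have := h1.V_le hA ⟨ht₀.trans hs.1, hs.2⟩
  linarith

/-! ### Lipschitz continuity of the value function -/

theorem IsAdmissible.J_sub_le {t₀ : ℝ} {m q : Fin d → ℝ} {α : ℝ → Fin d → X}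
    {μ ν : ℝ → Fin d → ℝ} (hμ : P.IsAdmissible t₀ m α μ) (hν : P.IsAdmissible t₀ q α ν)
    (hA : P.AssumptionA) {C : ℝ} (hC : P.Bounds C) (ht₀ : t₀ ∈ Icc 0 P.T) :
    P.J t₀ α μ - P.J t₀ α ν ≤ C * (P.T + 1) * Real.exp (C * P.T) * ‖m - q‖ := by
  have h0 := hC.pos
  have hl : t₀ ∈ Icc t₀ P.T := left_mem_Icc.2 ht₀.2
  have hr : P.T ∈ Icc t₀ P.T := right_mem_Icc.2 ht₀.2
  have hd := fun r hr => hμ.norm_sub_le_mul hν hA hC ht₀.1 (s := r) hr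
  have h1 := hC.G_lip _ (hμ.mem_simplex _ hr) _ (hν.mem_simplex _ hr)
  have h2 : |∫ r in t₀..P.T, (P.F r (α r) (μ r) - P.F r (α r) (ν r))| ≤
      C * (Real.exp (C * P.T) * ‖m - q‖) * |P.T - t₀| := by
    refine abs_integral_le_of_le (fun r hr => ?_) hl hr
    have hr' : r ∈ Icc 0 P.T := ⟨ht₀.1.trans hr.1, hr.2⟩
    have h3 := hC.F_lip r hr' r hr' _ (hμ.mem_A r hr) _ (hμ.mem_simplex r hr) _
      (hν.mem_simplex r hr)
    rw [sub_self, abs_zero, zero_add] at h3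
    exact h3.trans (mul_le_mul_of_nonneg_left (hd r hr) h0.le)
  rw [intervalIntegral.integral_sub (hμ.intervalIntegrable_F hA ht₀.1 hl hr)
    (hν.intervalIntegrable_F hA ht₀.1 hl hr)] at h2
  have h4 : |P.T - t₀| ≤ P.T := by
    rw [abs_of_nonneg (sub_nonneg.2 ht₀.2)]; linarith [ht₀.1]
  have h5 : C * (Real.exp (C * P.T) * ‖m - q‖) * |P.T - t₀| ≤
      C * (Real.exp (C * P.T) * ‖m - q‖) * P.T := by gcongr
  have h6 := mul_le_mul_of_nonneg_left (hd _ hr) h0.le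
  have h7 := (abs_le.1 h2).2
  have h8 := (abs_le.1 h1).2
  rw [J, J]
  linarith

theorem AssumptionA.V_lipschitz (hA : P.AssumptionA) :
    ∃ L, 0 ≤ L ∧ ∀ t ∈ Icc 0 P.T, ∀ s ∈ Icc 0 P.T, ∀ m ∈ stdSimplex ℝ (Fin d),
      ∀ q ∈ stdSimplex ℝ (Fin d), |P.V t m - P.V s q| ≤ L * (|t - s| + ‖m - q‖) := by
  obtain ⟨C, hC⟩ := hA.exists_bounds
  have h0 := hC.pos
  have hT := hA.T_pos
  set L := C * (P.T + 1) * Real.exp (C * P.T) with hL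
  have hL0 : 0 ≤ L := by positivity
  have hspace : ∀ t ∈ Icc 0 P.T, ∀ m ∈ stdSimplex ℝ (Fin d), ∀ q ∈ stdSimplex ℝ (Fin d),
      P.V t m - P.V t q ≤ L * ‖m - q‖ := by
    intro t ht m hm q hq
    refine le_of_forall_pos_le_add fun ε hε => ?_
    obtain ⟨α, ν, hν, hlt⟩ := hA.exists_J_lt ht hq hε
    obtain ⟨μ, hμ⟩ := hA.exists_isAdmissible ht hm hν.measurable hν.mem_A
    have h1 := hμ.J_sub_le hν hA hC ht
    have h2 := hμ.V_le hA ht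
    linarith
  have htime : ∀ t ∈ Icc 0 P.T, ∀ s ∈ Icc 0 P.T, t ≤ s → ∀ m ∈ stdSimplex ℝ (Fin d),
      |P.V t m - P.V s m| ≤ (C + L * C) * (s - t) := by
    intro t ht s hs hts m hm
    have hs' : s ∈ Icc t P.T := ⟨hts, hs.2⟩
    have ht' : t ∈ Icc t P.T := left_mem_Icc.2 ht.2
    have hst : |s - t| = s - t := abs_of_nonneg (sub_nonneg.2 hts)
    have key : ∀ α μ, P.IsAdmissible t m α μ →
        |(∫ r in t..s, P.F r (α r) (μ r)) + (P.V s (μ s) - P.V s m)| ≤ (C + L * C) * (s - t) := by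
      intro α μ hμ
      have e1 := hμ.abs_integral_F_le hC ht.1 ht' hs'
      have e2 := hμ.norm_sub_le hA hC ht.1 ht' hs'
      rw [hμ.start ht.2] at e2
      have e3 := hspace s hs _ (hμ.mem_simplex s hs') m hm
      have e4 := hspace s hs m hm _ (hμ.mem_simplex s hs')
      rw [norm_sub_rev] at e4
      have e5 := mul_le_mul_of_nonneg_left e2 hL0
      rw [hst] at e1 e5
      rw [abs_le] at e1 ⊢
      constructor <;> linarith [e1.1, e1.2]
    rw [abs_le]
    constructor
    · refine le_of_forall_pos_le_add fun ε hε => ?_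
      obtain ⟨α, μ, hμ, hlt⟩ := hA.exists_J_lt ht hm hε
      have h1 := hμ.integral_add_V_le hs' hA ht.1
      have h2 := (abs_le.1 (key α μ hμ)).1
      linarith
    · obtain ⟨a, ha⟩ := hA.A_nonempty
      obtain ⟨μ, hμ⟩ := hA.exists_isAdmissible_const ht hm (a := fun _ => a) (fun _ => ha)
      have h1 := hμ.V_le_integral_add hs' hA ht.1
      have h2 := (abs_le.1 (key _ μ hμ)).2
      linarith
  refine ⟨C + L * C + L, by positivity, fun t ht s hs m hm q hq => ?_⟩
  have h1 : |P.V t m - P.V t q| ≤ L * ‖m - q‖ := by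
    rw [abs_le]
    have e1 := hspace t ht m hm q hq
    have e2 := hspace t ht q hq m hm
    rw [norm_sub_rev] at e2
    constructor <;> linarith
  have h2 : |P.V t q - P.V s q| ≤ (C + L * C) * |t - s| := by
    rcases le_total t s with h | h
    · rw [abs_sub_comm t s, abs_of_nonneg (sub_nonneg.2 h)]
      exact htime t ht s hs h q hq
    · rw [abs_of_nonneg (sub_nonneg.2 h), abs_sub_comm]
      exact htime s hs t ht h q hq
  have h3 : P.V t m - P.V s q = (P.V t m - P.V t q) + (P.V t q - P.V s q) := by ring
  rw [h3]
  refine (abs_add_le _ _).trans ?_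
  have h4 := abs_nonneg (t - s)
  have h5 := norm_nonneg (m - q)
  have h6 : 0 ≤ L * C := by positivity
  nlinarith [mul_nonneg hL0 h4, mul_nonneg h0.le h5, mul_nonneg h6 h5]

theorem AssumptionA.continuousOn_V (hA : P.AssumptionA) :
    ContinuousOn (fun q : ℝ × (Fin d → ℝ) => P.V q.1 q.2) (Icc 0 P.T ×ˢ stdSimplex ℝ (Fin d)) := by
  obtain ⟨L, hL0, hL⟩ := hA.V_lipschitz
  have : LipschitzOnWith (Real.toNNReal (L * 2)) (fun q : ℝ × (Fin d → ℝ) => P.V q.1 q.2)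
      (Icc 0 P.T ×ˢ stdSimplex ℝ (Fin d)) := by
    refine LipschitzOnWith.of_dist_le_mul fun x hx y hy => ?_
    rw [Real.coe_toNNReal _ (by positivity), Real.dist_eq, dist_eq_norm]
    refine (hL _ hx.1 _ hy.1 _ hx.2 _ hy.2).trans ?_
    have h1 : |x.1 - y.1| ≤ ‖x - y‖ := norm_fst_le (x - y)
    have h2 : ‖x.2 - y.2‖ ≤ ‖x - y‖ := norm_snd_le (x - y)
    rw [mul_assoc]
    gcongr
    linarith
  exact this.continuousOn

end MFCP

namespace MFCP

variable {d : ℕ} {X : Type*}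

/-! ### The value function is a viscosity solution -/

theorem AssumptionA.continuousOn_totalH [MetricSpace X] {P : MFCP d X} (hA : P.AssumptionA) :
    ContinuousOn (fun q : ℝ × (Fin d → ℝ) × (Fin d → ℝ) => P.totalH q.1 q.2.1 q.2.2)
      (Icc 0 P.T ×ˢ stdSimplex ℝ (Fin d) ×ˢ univ) := by
  obtain ⟨C, hC⟩ := hA.exists_bounds
  rintro ⟨t, m, p⟩ ⟨ht, hm, -⟩
  rw [ContinuousWithinAt, tendsto_iff_norm_sub_tendsto_zero]
  let g : ℝ × (Fin d → ℝ) × (Fin d → ℝ) → ℝ := fun q =>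
    C * (1 + d * max ‖q.2.2‖ ‖p‖) * (|q.1 - t| + ‖q.2.1 - m‖) + d * C * ‖q.2.2 - p‖
  have hg : Continuous g := by fun_prop
  have hg0 : Tendsto g (𝓝[Icc 0 P.T ×ˢ stdSimplex ℝ (Fin d) ×ˢ univ] (t, m, p)) (𝓝 0) := by
    have := hg.tendsto (t, m, p)
    simp only [g, sub_self, abs_zero, norm_zero, add_zero, mul_zero] at this
    exact this.mono_left nhdsWithin_le_nhds
  refine squeeze_zero' (Eventually.of_forall fun _ => norm_nonneg _) ?_ hg0
  filter_upwards [self_mem_nhdsWithin] with q hq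
  exact hA.abs_totalH_sub_le hC hq.1 ht hq.2.1 hm (le_max_left _ _) (le_max_right _ _)

/-- Curves with a bounded speed remain for a short time in any neighborhood of the initial point
relative to `[0,T) × S`, if `S` is relatively open in the simplex. -/
theorem exists_short_time {T C t : ℝ} (hC : 0 ≤ C) {S : Set (Fin d → ℝ)} {m : Fin d → ℝ}
    (ht : t ∈ Ico 0 T) (hS : ∀ᶠ q in 𝓝[stdSimplex ℝ (Fin d)] m, q ∈ S)
    {N : ℝ × (Fin d → ℝ) → Prop} (hN : ∀ᶠ x in 𝓝[Ico 0 T ×ˢ S] (t, m), N x) :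
    ∃ r, t < r ∧ r < T ∧ ∀ x ∈ Icc t r, ∀ q ∈ stdSimplex ℝ (Fin d), ‖q - m‖ ≤ C * (x - t) →
      q ∈ S ∧ N (x, q) := by
  rw [eventually_nhdsWithin_iff, Metric.eventually_nhds_iff] at hS hN
  obtain ⟨δ₁, h1, hS⟩ := hS
  obtain ⟨δ₂, h2, hN⟩ := hN
  have h3 : 0 < T - t := sub_pos.2 ht.2
  set δ := min (min δ₁ δ₂) (T - t) with hδ
  have hδ0 : 0 < δ := lt_min (lt_min h1 h2) h3
  have e1 : δ ≤ δ₁ := (min_le_left _ _).trans (min_le_left _ _)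
  have e2 : δ ≤ δ₂ := (min_le_left _ _).trans (min_le_right _ _)
  have e3 : δ ≤ T - t := min_le_right _ _
  have hη : 0 < δ / (2 * (1 + C)) := by positivity
  have hη' : (1 + C) * (δ / (2 * (1 + C))) = δ / 2 := by field_simp
  have hη1 : δ / (2 * (1 + C)) ≤ δ / 2 := by nlinarith
  refine ⟨t + δ / (2 * (1 + C)), by linarith, by linarith, fun x hx q hq hqm => ?_⟩
  have hx0 : 0 ≤ x - t := sub_nonneg.2 hx.1
  have hx1 : x - t ≤ δ / (2 * (1 + C)) := by linarith [hx.2]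
  have hx2 : C * (x - t) ≤ δ / 2 := by nlinarith [mul_le_mul_of_nonneg_left hx1 hC]
  have hd1 : dist q m < δ := by rw [dist_eq_norm]; linarith
  have hqS : q ∈ S := hS (by linarith) hq
  refine ⟨hqS, hN ?_ ⟨⟨by linarith [ht.1], by linarith⟩, hqS⟩⟩
  rw [Prod.dist_eq]
  refine max_lt ?_ (by simpa using hd1.trans_le e2)
  rw [Real.dist_eq, abs_of_nonneg hx0]
  linarith

variable [MetricSpace X] [MeasurableSpace X] [BorelSpace X] {P : MFCP d X}

/-- The growth of a test function plus the running cost along a trajectory. -/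
theorem IsAdmissible.test_add_cost {t r : ℝ} {m : Fin d → ℝ} {α : ℝ → Fin d → X}
    {μ : ℝ → Fin d → ℝ} (h : P.IsAdmissible t m α μ) (hA : P.AssumptionA) {I : Set ℝ}
    {S : Set (Fin d → ℝ)} {φ φt : ℝ → (Fin d → ℝ) → ℝ} {p : ℝ → (Fin d → ℝ) → (Fin d → ℝ)}
    (hφ : IsC1On I S φ φt p) (ht : 0 ≤ t) (htr : t ≤ r) (hrT : r ≤ P.T)
    (hI : Icc t r ⊆ I) (hS : ∀ x ∈ Icc t r, μ x ∈ S) :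
    IntervalIntegrable (fun x => φt x (μ x) + ∑ i, p x (μ x) i * P.drift x (α x) (μ x) i +
      P.F x (α x) (μ x)) volume t r ∧
    φ r (μ r) - φ t m + ∫ x in t..r, P.F x (α x) (μ x) =
      ∫ x in t..r, (φt x (μ x) + ∑ i, p x (μ x) i * P.drift x (α x) (μ x) i +
        P.F x (α x) (μ x)) := by
  obtain ⟨C, hC⟩ := hA.exists_bounds
  have hsub : Icc t r ⊆ Icc t P.T := Icc_subset_Icc_right hrT
  have hl : t ∈ Icc t P.T := left_mem_Icc.2 (htr.trans hrT)
  have hr : r ∈ Icc t P.T := ⟨htr, hrT⟩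
  have h1 := hφ.sub_eq_integral htr hI hS (β := fun x => P.drift x (α x) (μ x)) (ν₀ := m) (C := C)
    (fun i => h.intervalIntegrable_drift hA ht hl hr i)
    (fun x hx => h.norm_drift_le hC ht (hsub hx)) (fun s hs i => h.state_eq s (hsub hs) i)
  have hmaps : MapsTo (fun r => (r, μ r)) (Icc t r) (I ×ˢ S) := fun r hr => ⟨hI hr, hS r hr⟩
  have hpair : ContinuousOn (fun r => (r, μ r)) (Icc t r) :=
    continuousOn_id.prodMk (h.continuousOn.mono hsub)
  have i1 : IntervalIntegrable (fun x => φt x (μ x)) volume t r :=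
    (hφ.cont_time.comp hpair hmaps).intervalIntegrable_of_Icc htr
  have i2 : IntervalIntegrable (fun x => ∑ i, p x (μ x) i * P.drift x (α x) (μ x) i) volume t r := by
    have hpc : ContinuousOn (fun r => p r (μ r)) (Icc t r) := hφ.cont_space.comp hpair hmaps
    have := IntervalIntegrable.sum (μ := volume) (a := t) (b := r) Finset.univ
      (f := fun i => fun x => p x (μ x) i * P.drift x (α x) (μ x) i) fun i _ =>
      (h.intervalIntegrable_drift hA ht hl hr i).continuousOn_mul (by
        rw [uIcc_of_le htr]; exact (continuous_apply i).comp_continuousOn hpc)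
    simpa [Finset.sum_fn] using this
  have i3 := h.intervalIntegrable_F hA ht hl hr
  refine ⟨(i1.add i2).add i3, ?_⟩
  rw [intervalIntegral.integral_add (i1.add i2) i3, ← h1, h.start (htr.trans hrT)]

theorem AssumptionA.V_isViscositySubsolution (hA : P.AssumptionA) {S : Set (Fin d → ℝ)}
    (hS : S ⊆ stdSimplex ℝ (Fin d))
    (hS' : ∀ m ∈ S, ∀ᶠ q in 𝓝[stdSimplex ℝ (Fin d)] m, q ∈ S) :
    P.IsViscositySubsolution S P.V := by
  obtain ⟨C, hC⟩ := hA.exists_bounds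
  refine ⟨hA.continuousOn_V.mono (prod_mono Ico_subset_Icc_self le_rfl), ?_⟩
  intro φ φt p hφ t ht m hm hmax
  have ht' : t ∈ Icc 0 P.T := Ico_subset_Icc_self ht
  by_contra! hneg
  obtain ⟨a, ha, haH⟩ := hA.exists_eq_totalH ht' (hS hm) (p t m)
  let g : ℝ × (Fin d → ℝ) → ℝ := fun x => φt x.1 x.2 + ∑ i, p x.1 x.2 i * P.drift x.1 a x.2 i +
    P.F x.1 a x.2
  have hmaps : MapsTo (fun x : ℝ × (Fin d → ℝ) => (x.1, a, x.2)) (Ico 0 P.T ×ˢ S)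
      (Icc 0 P.T ×ˢ (univ.pi fun _ => P.A) ×ˢ stdSimplex ℝ (Fin d)) := fun x hx =>
    ⟨Ico_subset_Icc_self hx.1, fun i _ => ha i, hS hx.2⟩
  have hg : ContinuousOn g (Ico 0 P.T ×ˢ S) := by
    refine (hφ.cont_time.add (continuousOn_finsetSum _ fun i _ => ?_)).add ?_
    · exact ((continuous_apply i).comp_continuousOn hφ.cont_space).mul
        ((hA.continuousOn_drift i).comp (f := fun x : ℝ × (Fin d → ℝ) => (x.1, a, x.2))
          (by fun_prop) hmaps)
    · exact hA.F_cont.comp (f := fun x : ℝ × (Fin d → ℝ) => (x.1, a, x.2)) (by fun_prop) hmaps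
  have hg0 : g (t, m) < 0 := by simp only [g]; linarith
  obtain ⟨r, htr, hrT, hr⟩ := exists_short_time hC.pos.le ht (hS' m hm)
    (((hg (t, m) ⟨ht, hm⟩).eventually (gt_mem_nhds hg0)).and hmax)
  obtain ⟨μ, hμ⟩ := hA.exists_isAdmissible_const ht' (hS hm) ha
  have hdist : ∀ x ∈ Icc t r, ‖μ x - m‖ ≤ C * (x - t) := fun x hx => by
    have := hμ.norm_sub_le hA hC ht.1 (left_mem_Icc.2 ht.2.le) ⟨hx.1, hx.2.trans hrT.le⟩
    rwa [hμ.start ht.2.le, abs_of_nonneg (sub_nonneg.2 hx.1)] at this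
  have hμS := fun x hx => hr x hx (μ x) (hμ.mem_simplex x ⟨hx.1, hx.2.trans hrT.le⟩) (hdist x hx)
  obtain ⟨hi, he⟩ := hμ.test_add_cost hA hφ ht.1 htr.le hrT.le
    (fun x hx => ⟨ht.1.trans hx.1, hx.2.trans_lt hrT⟩) (fun x hx => (hμS x hx).1)
  have h1 := hμ.V_le_integral_add ⟨htr.le, hrT.le⟩ hA ht.1
  have h2 : P.V r (μ r) - φ r (μ r) ≤ P.V t m - φ t m := (hμS r (right_mem_Icc.2 htr.le)).2.2
  have h3 : ∫ x in t..r, (φt x (μ x) + ∑ i, p x (μ x) i * P.drift x a (μ x) i +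
      P.F x a (μ x)) < 0 := by
    have := intervalIntegral.intervalIntegral_pos_of_pos_on (f := fun x => -(φt x (μ x) +
      ∑ i, p x (μ x) i * P.drift x a (μ x) i + P.F x a (μ x))) hi.neg
      (fun x hx => neg_pos.2 (hμS x (Ioo_subset_Icc_self hx)).2.1) htr
    rw [intervalIntegral.integral_neg] at this
    linarith
  linarith

theorem AssumptionA.V_isViscositySupersolution (hA : P.AssumptionA) {S : Set (Fin d → ℝ)}
    (hS : S ⊆ stdSimplex ℝ (Fin d))
    (hS' : ∀ m ∈ S, ∀ᶠ q in 𝓝[stdSimplex ℝ (Fin d)] m, q ∈ S) :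
    P.IsViscositySupersolution S P.V := by
  obtain ⟨C, hC⟩ := hA.exists_bounds
  refine ⟨hA.continuousOn_V.mono (prod_mono Ico_subset_Icc_self le_rfl), ?_⟩
  intro φ φt p hφ t ht m hm hmin
  have ht' : t ∈ Icc 0 P.T := Ico_subset_Icc_self ht
  by_contra! hneg
  let g : ℝ × (Fin d → ℝ) → ℝ := fun x => φt x.1 x.2 - P.totalH x.1 x.2 (p x.1 x.2)
  have hg : ContinuousOn g (Ico 0 P.T ×ˢ S) := by
    refine hφ.cont_time.sub ?_
    exact hA.continuousOn_totalH.comp (f := fun x : ℝ × (Fin d → ℝ) => (x.1, x.2, p x.1 x.2))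
      (continuousOn_fst.prodMk (continuousOn_snd.prodMk hφ.cont_space))
      fun x hx => ⟨Ico_subset_Icc_self hx.1, hS hx.2, mem_univ _⟩
  obtain ⟨c, hc0, hc⟩ : ∃ c, 0 < c ∧ c < g (t, m) :=
    exists_between (by simp only [g]; linarith)
  obtain ⟨r, htr, hrT, hr⟩ := exists_short_time hC.pos.le ht (hS' m hm)
    (((hg (t, m) ⟨ht, hm⟩).eventually (lt_mem_nhds hc)).and hmin)
  -- a nearly optimal control for the initial point `(t, m)`
  obtain ⟨α, μ, hμ, hlt⟩ := hA.exists_J_lt ht' (hS hm) (mul_pos hc0 (sub_pos.2 htr))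
  have hdist : ∀ x ∈ Icc t r, ‖μ x - m‖ ≤ C * (x - t) := fun x hx => by
    have := hμ.norm_sub_le hA hC ht.1 (left_mem_Icc.2 ht.2.le) ⟨hx.1, hx.2.trans hrT.le⟩
    rwa [hμ.start ht.2.le, abs_of_nonneg (sub_nonneg.2 hx.1)] at this
  have hμS := fun x hx => hr x hx (μ x) (hμ.mem_simplex x ⟨hx.1, hx.2.trans hrT.le⟩) (hdist x hx)
  obtain ⟨hi, he⟩ := hμ.test_add_cost hA hφ ht.1 htr.le hrT.le
    (fun x hx => ⟨ht.1.trans hx.1, hx.2.trans_lt hrT⟩) (fun x hx => (hμS x hx).1)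
  have h1 := hμ.integral_add_V_le ⟨htr.le, hrT.le⟩ hA ht.1
  have h2 : P.V t m - φ t m ≤ P.V r (μ r) - φ r (μ r) := (hμS r (right_mem_Icc.2 htr.le)).2.2
  have h3 : ∫ _ in t..r, c ≤ ∫ x in t..r, (φt x (μ x) +
      ∑ i, p x (μ x) i * P.drift x (α x) (μ x) i + P.F x (α x) (μ x)) := by
    refine intervalIntegral.integral_mono_on htr.le (by simp) hi fun x hx => ?_
    have hx' : x ∈ Icc t P.T := ⟨hx.1, hx.2.trans hrT.le⟩
    have e1 := hA.le_totalH ⟨ht.1.trans hx.1, hx'.2⟩ (hμ.mem_simplex x hx') (p x (μ x))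
      (hμ.mem_A x hx')
    have e2 : c < φt x (μ x) - P.totalH x (μ x) (p x (μ x)) := (hμS x hx).2.1
    linarith
  rw [intervalIntegral.integral_const, smul_eq_mul] at h3
  linarith

theorem AssumptionA.V_isViscositySolution (hA : P.AssumptionA) {S : Set (Fin d → ℝ)}
    (hS : S ⊆ stdSimplex ℝ (Fin d))
    (hS' : ∀ m ∈ S, ∀ᶠ q in 𝓝[stdSimplex ℝ (Fin d)] m, q ∈ S) :
    P.IsViscositySolution S P.V :=
  ⟨hA.continuousOn_V, hA.V_isViscositySubsolution hS hS', hA.V_isViscositySupersolution hS hS',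
    fun _ hm => hA.V_terminal hm⟩

end MFCP

/-! ### Test functions and barriers -/

theorem IsC1On.add {d : ℕ} {I : Set ℝ} {S : Set (Fin d → ℝ)} {φ φt ψ ψt : ℝ → (Fin d → ℝ) → ℝ}
    {p q : ℝ → (Fin d → ℝ) → (Fin d → ℝ)} (hφ : IsC1On I S φ φt p) (hψ : IsC1On I S ψ ψt q) :
    IsC1On I S (fun t m => φ t m + ψ t m) (fun t m => φt t m + ψt t m)
      (fun t m i => p t m i + q t m i) where
  hasDeriv t ht m hm := by
    refine ((hφ.hasDeriv t ht m hm).add (hψ.hasDeriv t ht m hm)).congr_fderiv ?_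
    refine ContinuousLinearMap.ext fun ⟨h, k⟩ => ?_
    simp only [add_apply, timeSpaceForm_apply, add_mul, Finset.sum_add_distrib]
    ring
  cont_time := hφ.cont_time.add hψ.cont_time
  cont_space := hφ.cont_space.add hψ.cont_space

theorem IsC1On.const_mul {d : ℕ} {I : Set ℝ} {S : Set (Fin d → ℝ)} {φ φt : ℝ → (Fin d → ℝ) → ℝ}
    {p : ℝ → (Fin d → ℝ) → (Fin d → ℝ)} (hφ : IsC1On I S φ φt p) (c : ℝ) :
    IsC1On I S (fun t m => c * φ t m) (fun t m => c * φt t m) (fun t m i => c * p t m i) where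
  hasDeriv t ht m hm := by
    refine ((hφ.hasDeriv t ht m hm).const_mul c).congr_fderiv ?_
    refine ContinuousLinearMap.ext fun ⟨h, k⟩ => ?_
    simp only [smul_apply, timeSpaceForm_apply, mul_assoc, smul_eq_mul, ← Finset.mul_sum]
    ring
  cont_time := continuousOn_const.mul hφ.cont_time
  cont_space := hφ.cont_space.const_smul c

theorem IsC1On.mono {d : ℕ} {I I' : Set ℝ} {S S' : Set (Fin d → ℝ)} {φ φt : ℝ → (Fin d → ℝ) → ℝ}
    {p : ℝ → (Fin d → ℝ) → (Fin d → ℝ)} (hφ : IsC1On I S φ φt p) (hI : I' ⊆ I) (hS : S' ⊆ S) :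
    IsC1On I' S' φ φt p where
  hasDeriv t ht m hm := (hφ.hasDeriv t (hI ht) m (hS hm)).mono (prod_mono hI hS)
  cont_time := hφ.cont_time.mono (prod_mono hI hS)
  cont_space := hφ.cont_space.mono (prod_mono hI hS)

theorem isC1On_affine_time {d : ℕ} (I : Set ℝ) (S : Set (Fin d → ℝ)) (c e : ℝ) :
    IsC1On I S (fun t _ => c * (e - t)) (fun _ _ => -c) (fun _ _ _ => 0) where
  hasDeriv t _ m _ := by
    have h : HasFDerivAt (fun q : ℝ × (Fin d → ℝ) => c * (e - q.1))
        (c • -ContinuousLinearMap.fst ℝ ℝ (Fin d → ℝ)) (t, m) :=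
      ((hasFDerivAt_fst (𝕜 := ℝ) (p := (t, m))).const_sub e).const_mul c
    refine h.hasFDerivWithinAt.congr_fderiv ?_
    refine ContinuousLinearMap.ext fun ⟨h, k⟩ => ?_
    simp [timeSpaceForm_apply]
  cont_time := continuousOn_const
  cont_space := continuousOn_const

theorem isC1On_sq_dist {d : ℕ} (I : Set ℝ) (S : Set (Fin d → ℝ)) (s : ℝ) (q : Fin d → ℝ) :
    IsC1On I S (fun t m => (t - s) ^ 2 + ∑ i, (m i - q i) ^ 2) (fun t _ => 2 * (t - s))
      (fun _ m i => 2 * (m i - q i)) where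
  hasDeriv t _ m _ := by
    have h1 : HasFDerivAt (fun x : ℝ × (Fin d → ℝ) => (x.1 - s) ^ 2)
        ((2 * (t - s) ^ 1) • ContinuousLinearMap.fst ℝ ℝ (Fin d → ℝ)) (t, m) := by
      have := ((hasFDerivAt_fst (𝕜 := ℝ) (p := (t, m))).sub_const s).pow 2
      exact this.congr_fderiv (by ext <;> simp)
    have h2 : ∀ i ∈ Finset.univ, HasFDerivAt (fun x : ℝ × (Fin d → ℝ) => (x.2 i - q i) ^ 2)
        ((2 * (m i - q i) ^ 1) • (ContinuousLinearMap.proj (R := ℝ) (φ := fun _ : Fin d => ℝ) i).comp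
          (ContinuousLinearMap.snd ℝ ℝ (Fin d → ℝ))) (t, m) := by
      intro i _
      have h3 : HasFDerivAt (fun x : ℝ × (Fin d → ℝ) => x.2 i)
        ((ContinuousLinearMap.proj (R := ℝ) (φ := fun _ : Fin d => ℝ) i).comp
          (ContinuousLinearMap.snd ℝ ℝ (Fin d → ℝ))) (t, m) :=
        ((ContinuousLinearMap.proj (R := ℝ) (φ := fun _ : Fin d => ℝ) i).comp
          (ContinuousLinearMap.snd ℝ ℝ (Fin d → ℝ))).hasFDerivAt
      exact ((h3.sub_const (q i)).pow 2).congr_fderiv (by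
        refine ContinuousLinearMap.ext fun ⟨h, k⟩ => ?_
        simp)
    refine (h1.add (HasFDerivAt.fun_sum h2)).hasFDerivWithinAt.congr_fderiv ?_
    refine ContinuousLinearMap.ext fun ⟨h, k⟩ => ?_
    simp [timeSpaceForm_apply]
  cont_time := Continuous.continuousOn (by fun_prop)
  cont_space := Continuous.continuousOn (by fun_prop)

theorem mix_mem_intSimplex {d : ℕ} {m : Fin d → ℝ} (hm : m ∈ stdSimplex ℝ (Fin d)) {τ : ℝ}
    (h0 : 0 < τ) (h1 : τ ≤ 1) : (fun i => (1 - τ) * m i + τ * (d : ℝ)⁻¹) ∈ intSimplex d := by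
  have hd : 0 < d := by
    rcases Nat.eq_zero_or_pos d with rfl | h
    · have := hm.2; simp at this
    · exact h
  have hd' : (0 : ℝ) < d := Nat.cast_pos.2 hd
  refine ⟨fun i => ?_, ?_⟩
  · have := mul_nonneg (sub_nonneg.2 h1) (hm.1 i)
    positivity
  · rw [Finset.sum_add_distrib, ← Finset.mul_sum, hm.2]
    simp only [Finset.sum_const, Finset.card_univ, Fintype.card_fin, nsmul_eq_mul]
    field_simp
    ring

theorem tendsto_mix {d : ℕ} (m : Fin d → ℝ) :
    Tendsto (fun τ : ℝ => fun i => (1 - τ) * m i + τ * (d : ℝ)⁻¹) (𝓝[>] 0) (𝓝 m) := by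
  have h : Continuous (fun τ : ℝ => fun i => (1 - τ) * m i + τ * (d : ℝ)⁻¹) := by fun_prop
  have := h.tendsto 0
  simp only [sub_zero, one_mul, zero_mul, add_zero] at this
  exact this.mono_left nhdsWithin_le_nhds

theorem eventually_mix_mem_intSimplex {d : ℕ} {m : Fin d → ℝ} (hm : m ∈ stdSimplex ℝ (Fin d)) :
    ∀ᶠ τ : ℝ in 𝓝[>] 0, (fun i => (1 - τ) * m i + τ * (d : ℝ)⁻¹) ∈ intSimplex d := by
  filter_upwards [Ioc_mem_nhdsGT (zero_lt_one (α := ℝ))] with τ hτ using mix_mem_intSimplex hm hτ.1 hτ.2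

theorem mem_closure_intSimplex {d : ℕ} {m : Fin d → ℝ} (hm : m ∈ stdSimplex ℝ (Fin d)) :
    m ∈ closure (intSimplex d) :=
  mem_closure_of_tendsto (tendsto_mix m) (eventually_mix_mem_intSimplex hm)

namespace MFCP

variable {d : ℕ} {X : Type*}

/-- A penalization `β ≥ 0` on `S`, with gradient `γ`, which is large away from the compact subsets of
`S` and does not grow too fast along any controlled trajectory. It keeps the maximum points in the
doubling of variables inside `S`. -/
structure Barrier (P : MFCP d X) (S : Set (Fin d → ℝ)) (β : (Fin d → ℝ) → ℝ)
    (γ : (Fin d → ℝ) → (Fin d → ℝ)) (C : ℝ) : Prop where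
  subset : S ⊆ stdSimplex ℝ (Fin d)
  dense : ∀ m ∈ stdSimplex ℝ (Fin d), m ∈ closure S
  c1 : IsC1On univ S (fun _ m => β m) (fun _ _ => 0) (fun _ m => γ m)
  nonneg : ∀ m ∈ S, 0 ≤ β m
  exists_compact : ∀ c, ∃ K ⊆ S, IsCompact K ∧ ∀ m ∈ S, m ∉ K → c < β m
  drift_le : ∀ t ∈ Icc 0 P.T, ∀ a, (∀ i, a i ∈ P.A) → ∀ m ∈ S, ∑ i, γ m i * P.drift t a m i ≤ C

theorem barrier_stdSimplex (P : MFCP d X) :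
    P.Barrier (stdSimplex ℝ (Fin d)) (fun _ => 0) (fun _ _ => 0) 0 where
  subset := le_rfl
  dense _ hm := subset_closure hm
  c1 := by simpa using isC1On_affine_time univ (stdSimplex ℝ (Fin d)) 0 0
  nonneg _ _ := le_rfl
  exists_compact _ := ⟨_, le_rfl, isCompact_stdSimplex ℝ (Fin d), fun _ h h' => absurd h h'⟩
  drift_le _ _ _ _ _ _ := by simp

/-- The logarithmic barrier in the interior: `b_i ≥ -C m_i` makes `-∑ log m_i` grow at a bounded
rate. -/
theorem Bounds.barrier_intSimplex {P : MFCP d X} {C : ℝ} (hC : P.Bounds C) :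
    P.Barrier (intSimplex d) (fun m => ∑ i, -Real.log (m i)) (fun m i => -(m i)⁻¹) (d * C) where
  subset := intSimplex_subset
  dense _ hm := mem_closure_intSimplex hm
  c1 :=
    { hasDeriv := fun t _ m hm => by
        have h2 : ∀ i ∈ Finset.univ, HasFDerivAt (fun x : ℝ × (Fin d → ℝ) => -Real.log (x.2 i))
            (-((m i)⁻¹ • (ContinuousLinearMap.proj (R := ℝ) (φ := fun _ : Fin d => ℝ) i).comp
              (ContinuousLinearMap.snd ℝ ℝ (Fin d → ℝ)))) (t, m) := by
          intro i _
          have h3 : HasFDerivAt (fun x : ℝ × (Fin d → ℝ) => x.2 i)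
            ((ContinuousLinearMap.proj (R := ℝ) (φ := fun _ : Fin d => ℝ) i).comp
              (ContinuousLinearMap.snd ℝ ℝ (Fin d → ℝ))) (t, m) :=
            ((ContinuousLinearMap.proj (R := ℝ) (φ := fun _ : Fin d => ℝ) i).comp
              (ContinuousLinearMap.snd ℝ ℝ (Fin d → ℝ))).hasFDerivAt
          exact (h3.log (hm.1 i).ne').neg
        refine (HasFDerivAt.fun_sum h2).hasFDerivWithinAt.congr_fderiv ?_
        refine ContinuousLinearMap.ext fun ⟨h, k⟩ => ?_
        simp [timeSpaceForm_apply]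
      cont_time := continuousOn_const
      cont_space := by
        refine continuousOn_pi.2 fun i => ContinuousOn.neg (ContinuousOn.inv₀ (by fun_prop) ?_)
        exact fun x hx => (hx.2.1 i).ne' }
  nonneg m hm := Finset.sum_nonneg fun i _ => neg_nonneg.2 (Real.log_nonpos (hm.1 i).le
    (stdSimplex_le_one (intSimplex_subset hm) i))
  exists_compact c := by
    refine ⟨stdSimplex ℝ (Fin d) ∩ {m | ∀ i, Real.exp (-c) ≤ m i}, fun m hm =>
      ⟨fun i => (Real.exp_pos _).trans_le (hm.2 i), hm.1.2⟩,
      (isCompact_stdSimplex ℝ (Fin d)).inter_right ?_, fun m hm hmK => ?_⟩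
    · rw [ofPred_forall]
      exact isClosed_iInter fun i => isClosed_le continuous_const (continuous_apply i)
    · have : ∃ i, m i < Real.exp (-c) := by
        by_contra! h
        exact hmK ⟨intSimplex_subset hm, h⟩
      obtain ⟨i, hi⟩ := this
      have h1 : c < -Real.log (m i) := by
        rw [lt_neg, Real.log_lt_iff_lt_exp (hm.1 i)]
        exact hi
      exact h1.trans_le (Finset.single_le_sum (f := fun i => -Real.log (m i)) (fun i _ =>
        neg_nonneg.2 (Real.log_nonpos (hm.1 i).le
          (stdSimplex_le_one (intSimplex_subset hm) i))) (Finset.mem_univ i))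
  drift_le t ht a ha m hm := by
    have h1 : ∀ i ∈ Finset.univ, -(m i)⁻¹ * P.drift t a m i ≤ C := by
      intro i _
      have h2 := hC.inward t ht a ha m (intSimplex_subset hm) i
      have h3 := hm.1 i
      rw [neg_mul, neg_le_iff_add_nonneg]
      have h4 : C + (m i)⁻¹ * P.drift t a m i = (m i)⁻¹ * (C * m i + P.drift t a m i) := by
        field_simp
      rw [h4]
      positivity
    refine (Finset.sum_le_sum h1).trans_eq ?_
    simp

theorem AssumptionA.totalH_le_barrier [MetricSpace X] {P : MFCP d X} (hA : P.AssumptionA)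
    {S : Set (Fin d → ℝ)} {β : (Fin d → ℝ) → ℝ} {γ : (Fin d → ℝ) → (Fin d → ℝ)} {B : ℝ}
    (hB : P.Barrier S β γ B) {t : ℝ} (ht : t ∈ Icc 0 P.T) {m : Fin d → ℝ} (hm : m ∈ S)
    (p : Fin d → ℝ) {δ : ℝ} (hδ : 0 ≤ δ) :
    P.totalH t m p - δ * B ≤ P.totalH t m (fun i => p i + δ * γ m i) ∧
      P.totalH t m (fun i => p i + -δ * γ m i) ≤ P.totalH t m p + δ * B := by
  constructor
  · obtain ⟨a, ha, h⟩ := hA.exists_eq_totalH ht (hB.subset hm) p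
    have h1 := hA.le_totalH ht (hB.subset hm) (fun i => p i + δ * γ m i) ha
    have h2 := mul_le_mul_of_nonneg_left (hB.drift_le t ht a ha m hm) hδ
    simp only [add_mul, Finset.sum_add_distrib, mul_assoc, ← Finset.mul_sum] at h1
    linarith
  · obtain ⟨a, ha, h⟩ := hA.exists_eq_totalH ht (hB.subset hm) (fun i => p i + -δ * γ m i)
    have h1 := hA.le_totalH ht (hB.subset hm) p ha
    have h2 := mul_le_mul_of_nonneg_left (hB.drift_le t ht a ha m hm) hδ
    simp only [add_mul, Finset.sum_add_distrib, mul_assoc, ← Finset.mul_sum] at h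
    linarith

/-! ### The comparison principle -/

/-- Combination of the two viscosity inequalities at a maximum point of the doubled function. -/
theorem AssumptionA.doubling_le [MetricSpace X] {P : MFCP d X} (hA : P.AssumptionA) {C : ℝ}
    (hC : P.Bounds C) {S : Set (Fin d → ℝ)} {β : (Fin d → ℝ) → ℝ}
    {γ : (Fin d → ℝ) → (Fin d → ℝ)} {B : ℝ} (hB : P.Barrier S β γ B)
    {v w : ℝ → (Fin d → ℝ) → ℝ} (hv : P.IsViscositySubsolution S v)
    (hw : P.IsViscositySupersolution S w) {η δ k : ℝ} (hδ : 0 ≤ δ) (hk : 0 ≤ k)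
    {t s : ℝ} (ht : t ∈ Ico 0 P.T) (hs : s ∈ Ico 0 P.T) {m q : Fin d → ℝ} (hm : m ∈ S) (hq : q ∈ S)
    (hmax : ∀ t' ∈ Icc 0 P.T, ∀ s' ∈ Icc 0 P.T, ∀ m' ∈ S, ∀ q' ∈ S,
      v t' m' - w s' q' - η * (P.T - t') - k * ((t' - s') ^ 2 + ∑ i, (m' i - q' i) ^ 2)
        - δ * (β m' + β q') ≤
      v t m - w s q - η * (P.T - t) - k * ((t - s) ^ 2 + ∑ i, (m i - q i) ^ 2)
        - δ * (β m + β q)) :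
    η ≤ 2 * δ * B + C * (|t - s| + ‖m - q‖) + 2 * d * C * k * (|t - s| + ‖m - q‖) ^ 2 := by
  have ht' := Ico_subset_Icc_self ht
  have hs' := Ico_subset_Icc_self hs
  have h1 := hv.2 _ _ _ (((isC1On_affine_time (Ico 0 P.T) S η P.T).add
    ((isC1On_sq_dist (Ico 0 P.T) S s q).const_mul k)).add
    ((hB.c1.mono (subset_univ _) le_rfl).const_mul δ)) t ht m hm (by
      refine Filter.eventually_of_mem self_mem_nhdsWithin fun x hx => ?_
      have := hmax x.1 (Ico_subset_Icc_self hx.1) s hs' x.2 hx.2 q hq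
      simp only
      linarith)
  have h2 := hw.2 _ _ _ (((isC1On_sq_dist (Ico 0 P.T) S t m).const_mul (-k)).add
    ((hB.c1.mono (subset_univ _) le_rfl).const_mul (-δ))) s hs q hq (by
      refine Filter.eventually_of_mem self_mem_nhdsWithin fun x hx => ?_
      have := hmax t ht' x.1 (Ico_subset_Icc_self hx.1) m hm x.2 hx.2
      have e1 : (x.1 - t) ^ 2 = (t - x.1) ^ 2 := by ring
      have e2 : (s - t) ^ 2 = (t - s) ^ 2 := by ring
      have e3 : ∀ y : Fin d → ℝ, ∑ i, (y i - m i) ^ 2 = ∑ i, (m i - y i) ^ 2 := fun y =>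
        Finset.sum_congr rfl fun i _ => by ring
      simp only [e1, e2, e3]
      linarith)
  set p : Fin d → ℝ := fun i => k * (2 * (m i - q i)) with hp
  have hp1 : (fun i => 0 + k * (2 * (m i - q i)) + δ * γ m i) = fun i => p i + δ * γ m i := by
    ext i; simp [hp]
  have hp2 : (fun i => -k * (2 * (q i - m i)) + -δ * γ q i) = fun i => p i + -δ * γ q i := by
    ext i; simp only [hp]; ring
  rw [hp1] at h1
  rw [hp2] at h2
  have h3 := (hA.totalH_le_barrier hB ht' hm p hδ).1
  have h4 := (hA.totalH_le_barrier hB hs' hq p hδ).2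
  have h5 := hA.totalH_sub_le hC hs' ht' (hB.subset hq) (hB.subset hm) p p
  rw [sub_self, norm_zero, mul_zero, add_zero, abs_sub_comm s t, norm_sub_rev q m] at h5
  have hpn : ‖p‖ = 2 * k * ‖m - q‖ := by
    have : p = (2 * k) • (m - q) := by ext i; simp [hp]; ring
    rw [this, norm_smul, Real.norm_of_nonneg (by positivity)]
  set ρ := |t - s| + ‖m - q‖ with hρ
  have hρ1 : ‖m - q‖ ≤ ρ := by rw [hρ]; linarith [abs_nonneg (t - s)]
  have hρ0 : 0 ≤ ρ := by positivity
  have h6 : C * (1 + d * ‖p‖) * ρ ≤ C * ρ + 2 * d * C * k * ρ ^ 2 := by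
    have hC0 := hC.pos
    rw [hpn]
    calc C * (1 + d * (2 * k * ‖m - q‖)) * ρ ≤ C * (1 + d * (2 * k * ρ)) * ρ := by gcongr
      _ = _ := by ring
  linarith

/-- Viscosity subsolutions lie below viscosity supersolutions. -/
theorem AssumptionA.comparison [MetricSpace X] {P : MFCP d X} (hA : P.AssumptionA)
    {S : Set (Fin d → ℝ)} {β : (Fin d → ℝ) → ℝ} {γ : (Fin d → ℝ) → (Fin d → ℝ)} {B : ℝ}
    (hB : P.Barrier S β γ B) {v w : ℝ → (Fin d → ℝ) → ℝ}
    (hvc : ContinuousOn (fun q : ℝ × (Fin d → ℝ) => v q.1 q.2) (Icc 0 P.T ×ˢ stdSimplex ℝ (Fin d)))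
    (hwc : ContinuousOn (fun q : ℝ × (Fin d → ℝ) => w q.1 q.2) (Icc 0 P.T ×ˢ stdSimplex ℝ (Fin d)))
    (hv : P.IsViscositySubsolution S v) (hw : P.IsViscositySupersolution S w)
    (hT : ∀ m ∈ stdSimplex ℝ (Fin d), v P.T m ≤ w P.T m) :
    ∀ t ∈ Icc 0 P.T, ∀ m ∈ stdSimplex ℝ (Fin d), v t m ≤ w t m := by
  intro t₀ ht₀ m₀ hm₀
  by_contra! hlt
  obtain ⟨C, hC⟩ := hA.exists_bounds
  have hC0 := hC.pos
  have hT0 := hA.T_pos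
  -- a point of `S` where `v > w`
  obtain ⟨m₁, hm₁, hlt₁⟩ : ∃ m₁ ∈ S, w t₀ m₁ < v t₀ m₁ := by
    have hpair : MapsTo (fun m : Fin d → ℝ => (t₀, m)) (stdSimplex ℝ (Fin d))
      (Icc 0 P.T ×ˢ stdSimplex ℝ (Fin d)) := fun m hm => ⟨ht₀, hm⟩
    have hc1 : ContinuousOn (fun m => v t₀ m) (stdSimplex ℝ (Fin d)) :=
      hvc.comp (f := fun m => (t₀, m)) (by fun_prop) hpair
    have hc2 : ContinuousOn (fun m => w t₀ m) (stdSimplex ℝ (Fin d)) :=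
      hwc.comp (f := fun m => (t₀, m)) (by fun_prop) hpair
    have h1 : ∀ᶠ m in 𝓝[stdSimplex ℝ (Fin d)] m₀, 0 < v t₀ m - w t₀ m :=
      ((hc1.sub hc2) m₀ hm₀).eventually (lt_mem_nhds (sub_pos.2 hlt))
    have h2 : (𝓝[S] m₀).NeBot := mem_closure_iff_nhdsWithin_neBot.1 (hB.dense m₀ hm₀)
    obtain ⟨m, h3, h4⟩ := ((h1.filter_mono (nhdsWithin_mono _ hB.subset)).and
      self_mem_nhdsWithin).exists
    exact ⟨m, h4, by linarith⟩
  set θ := v t₀ m₁ - w t₀ m₁ with hθ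
  have hθ0 : 0 < θ := sub_pos.2 hlt₁
  have hβ₁ := hB.nonneg m₁ hm₁
  set η := θ / (4 * P.T) with hη
  have hη0 : 0 < η := by positivity
  have hηT : η * (P.T - t₀) ≤ θ / 4 := by
    have : η * P.T = θ / 4 := by rw [hη]; field_simp
    nlinarith [ht₀.1]
  obtain ⟨δ, hδ0, hδ1, hδ2⟩ : ∃ δ, 0 < δ ∧ 2 * δ * β m₁ ≤ θ / 4 ∧ 2 * δ * B ≤ η / 2 := by
    have e1 : 0 < θ / (8 * (β m₁ + 1)) := by positivity
    have e2 : 0 < η / (4 * (|B| + 1)) := by positivity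
    refine ⟨min (θ / (8 * (β m₁ + 1))) (η / (4 * (|B| + 1))), lt_min e1 e2, ?_, ?_⟩
    · have h1 : θ / (8 * (β m₁ + 1)) * (β m₁ + 1) = θ / 8 := by field_simp
      nlinarith [min_le_left (θ / (8 * (β m₁ + 1))) (η / (4 * (|B| + 1)))]
    · have h1 : η / (4 * (|B| + 1)) * (|B| + 1) = η / 4 := by field_simp
      have h2 := min_le_right (θ / (8 * (β m₁ + 1))) (η / (4 * (|B| + 1)))
      have h3 : 0 < min (θ / (8 * (β m₁ + 1))) (η / (4 * (|B| + 1))) := lt_min e1 e2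
      nlinarith [le_abs_self B, abs_nonneg B]
  have hcomp : IsCompact (Icc 0 P.T ×ˢ stdSimplex ℝ (Fin d)) :=
    isCompact_Icc.prod (isCompact_stdSimplex ℝ (Fin d))
  obtain ⟨N₁, hN₁⟩ := hcomp.exists_bound_of_continuousOn hvc
  obtain ⟨N₂, hN₂⟩ := hcomp.exists_bound_of_continuousOn hwc
  obtain ⟨K, hKS, hKc, hK⟩ := hB.exists_compact (max ((|N₁| + |N₂|) / δ) (β m₁))
  have hm₁K : m₁ ∈ K := by
    by_contra h
    exact absurd (hK m₁ hm₁ h) (not_lt.2 (le_max_right _ _))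
  -- the doubled function, with penalization parameter `k`
  let pen : ℝ × (Fin d → ℝ) × ℝ × (Fin d → ℝ) → ℝ := fun z =>
    (z.1 - z.2.2.1) ^ 2 + ∑ i, (z.2.1 i - z.2.2.2 i) ^ 2
  have hpen0 : ∀ z, 0 ≤ pen z := fun z => by positivity
  let Φ : ℝ → ℝ × (Fin d → ℝ) × ℝ × (Fin d → ℝ) → ℝ := fun k z =>
    v z.1 z.2.1 - w z.2.2.1 z.2.2.2 - η * (P.T - z.1) - k * pen z - δ * (β z.2.1 + β z.2.2.2)
  have hβc : ContinuousOn β S := by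
    have h1 : ContinuousOn (fun q : ℝ × (Fin d → ℝ) => β q.2) (univ ×ˢ S) := fun q hq =>
      (hB.c1.hasDeriv q.1 hq.1 q.2 hq.2).continuousWithinAt
    exact h1.comp (f := fun m => ((0 : ℝ), m)) (by fun_prop) fun m hm => ⟨mem_univ _, hm⟩
  let KK : Set (ℝ × (Fin d → ℝ) × ℝ × (Fin d → ℝ)) := Icc 0 P.T ×ˢ K ×ˢ Icc 0 P.T ×ˢ K
  have hKK : IsCompact KK := isCompact_Icc.prod (hKc.prod (isCompact_Icc.prod hKc))
  have hΦc : ∀ k, ContinuousOn (Φ k) KK := by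
    intro k
    refine ContinuousOn.sub (ContinuousOn.sub (ContinuousOn.sub (ContinuousOn.sub ?_ ?_) ?_) ?_)
      (continuousOn_const.mul (ContinuousOn.add ?_ ?_))
    · exact hvc.comp (f := fun z : ℝ × (Fin d → ℝ) × ℝ × (Fin d → ℝ) => (z.1, z.2.1))
        (by fun_prop) fun z hz => ⟨hz.1, hB.subset (hKS hz.2.1)⟩
    · exact hwc.comp (f := fun z : ℝ × (Fin d → ℝ) × ℝ × (Fin d → ℝ) => (z.2.2.1, z.2.2.2))
        (by fun_prop) fun z hz => ⟨hz.2.2.1, hB.subset (hKS hz.2.2.2)⟩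
    · fun_prop
    · exact Continuous.continuousOn (by fun_prop)
    · exact hβc.comp (by fun_prop) fun z hz => hKS hz.2.1
    · exact hβc.comp (by fun_prop) fun z hz => hKS hz.2.2.2
  let z₁ : ℝ × (Fin d → ℝ) × ℝ × (Fin d → ℝ) := (t₀, m₁, t₀, m₁)
  have hz₁ : z₁ ∈ KK := ⟨ht₀, hm₁K, ht₀, hm₁K⟩
  have hΦ₁ : ∀ k, θ / 2 ≤ Φ k z₁ := by
    intro k
    have : pen z₁ = 0 := by simp [pen, z₁]
    simp only [Φ, this, mul_zero, sub_zero]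
    simp only [z₁]
    linarith
  choose z hzKK hzmax using fun n : ℕ => hKK.exists_isMaxOn ⟨z₁, hz₁⟩ (hΦc (2 ^ n))
  have hzlow : ∀ n, θ / 2 ≤ Φ (2 ^ n) (z n) := fun n => (hΦ₁ _).trans (hzmax n hz₁)
  -- the maximum over `KK` is a maximum over all of `S`
  have hglobal : ∀ n, ∀ t ∈ Icc 0 P.T, ∀ s ∈ Icc 0 P.T, ∀ m ∈ S, ∀ q ∈ S,
      Φ (2 ^ n) (t, m, s, q) ≤ Φ (2 ^ n) (z n) := by
    intro n t ht s hs m hm q hq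
    by_cases h : m ∈ K ∧ q ∈ K
    · exact hzmax n (show (t, m, s, q) ∈ KK from ⟨ht, h.1, hs, h.2⟩)
    · refine le_trans ?_ (hzlow n)
      have e1 := hB.nonneg m hm
      have e2 := hB.nonneg q hq
      have e3 : (|N₁| + |N₂|) / δ ≤ β m + β q := by
        rcases not_and_or.1 h with h | h
        · have := (le_max_left _ _).trans (hK m hm h).le
          linarith
        · have := (le_max_left _ _).trans (hK q hq h).le
          linarith
      rw [div_le_iff₀ hδ0] at e3
      have e4 : v t m ≤ |N₁| := (le_abs_self _).trans
        ((hN₁ (t, m) ⟨ht, hB.subset hm⟩).trans (le_abs_self _))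
      have e5 : -w s q ≤ |N₂| := (neg_le_abs _).trans
        ((hN₂ (s, q) ⟨hs, hB.subset hq⟩).trans (le_abs_self _))
      have e6 : 0 ≤ η * (P.T - t) := mul_nonneg hη0.le (sub_nonneg.2 ht.2)
      have e7 : 0 ≤ 2 ^ n * pen (t, m, s, q) := mul_nonneg (by positivity) (hpen0 _)
      simp only [Φ]
      linarith
  -- the penalization tends to zero because the maxima form a convergent monotone sequence
  have hstep : ∀ n, Φ (2 ^ (n + 1)) (z (n + 1)) + 2 ^ n * pen (z (n + 1)) ≤ Φ (2 ^ n) (z n) := by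
    intro n
    have h1 := hzmax n (hzKK (n + 1))
    simp only [mem_ofPred_eq] at h1
    refine le_trans (le_of_eq ?_) h1
    simp only [Φ, pow_succ]
    ring
  have hlim : Tendsto (fun n => 2 ^ (n + 1) * pen (z (n + 1))) atTop (𝓝 0) := by
    have hanti : Antitone fun n => Φ (2 ^ n) (z n) := antitone_nat_of_succ_le fun n => by
      have := hstep n
      have h2 : 0 ≤ 2 ^ n * pen (z (n + 1)) := mul_nonneg (by positivity) (hpen0 _)
      linarith
    have hbdd : BddBelow (range fun n => Φ (2 ^ n) (z n)) :=
      ⟨θ / 2, by rintro _ ⟨n, rfl⟩; exact hzlow n⟩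
    have h1 := tendsto_atTop_ciInf hanti hbdd
    have h2 := (h1.sub ((tendsto_add_atTop_iff_nat 1).2 h1)).const_mul 2
    rw [sub_self, mul_zero] at h2
    refine squeeze_zero (fun n => mul_nonneg (by positivity) (hpen0 _)) (fun n => ?_) h2
    have := hstep n
    have e : (2 : ℝ) ^ (n + 1) * pen (z (n + 1)) = 2 * (2 ^ n * pen (z (n + 1))) := by ring
    rw [e]
    linarith
  -- uniform continuity of `v` and `w`
  obtain ⟨ω₁, hω₁, huc₁⟩ := Metric.uniformContinuousOn_iff.1
    (hcomp.uniformContinuousOn_of_continuous hvc) (θ / 2) (by positivity)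
  obtain ⟨ω₂, hω₂, huc₂⟩ := Metric.uniformContinuousOn_iff.1
    (hcomp.uniformContinuousOn_of_continuous hwc) (θ / 2) (by positivity)
  set D := C * (1 + 8 * d) with hD
  have hD0 : 0 < D := by positivity
  obtain ⟨ω, hω0, hωa, hωb, hωD⟩ : ∃ ω, 0 < ω ∧ ω < ω₁ ∧ ω < ω₂ ∧ D * ω < η / 2 := by
    have h1 : 0 < min (min ω₁ ω₂) (η / (2 * D)) := by positivity
    refine ⟨min (min ω₁ ω₂) (η / (2 * D)) / 2, by positivity, ?_, ?_, ?_⟩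
    · linarith [(min_le_left (min ω₁ ω₂) (η / (2 * D))).trans (min_le_left _ _)]
    · linarith [(min_le_left (min ω₁ ω₂) (η / (2 * D))).trans (min_le_right _ _)]
    · have h2 := min_le_right (min ω₁ ω₂) (η / (2 * D))
      have h3 : D * (η / (2 * D)) = η / 2 := by field_simp
      nlinarith
  obtain ⟨n, hn⟩ := (hlim.eventually (gt_mem_nhds (show 0 < min ω (ω ^ 2 / 4) by positivity))).exists
  set Z := z (n + 1) with hZ
  set k : ℝ := 2 ^ (n + 1) with hk
  have hk1 : 1 ≤ k := one_le_pow₀ (by norm_num)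
  have hkpen := hn.trans_le (min_le_left _ _)
  have hpen : pen Z ≤ ω ^ 2 / 4 :=
    (le_mul_of_one_le_left (hpen0 Z) hk1).trans (hn.trans_le (min_le_right _ _)).le
  obtain ⟨htZ, hmZ, hsZ, hqZ⟩ := hzKK (n + 1)
  rw [← hZ] at htZ hmZ hsZ hqZ
  have hsq1 : |Z.1 - Z.2.2.1| ^ 2 ≤ pen Z := by
    rw [sq_abs]
    exact le_add_of_nonneg_right (by positivity)
  have hsq2 : ‖Z.2.1 - Z.2.2.2‖ ^ 2 ≤ pen Z := by
    rw [← Real.sqrt_le_sqrt_iff (hpen0 Z), Real.sqrt_sq (norm_nonneg _),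
      pi_norm_le_iff_of_nonneg (Real.sqrt_nonneg _)]
    intro i
    rw [Real.norm_eq_abs]
    refine Real.abs_le_sqrt ?_
    have h1 : (Z.2.1 i - Z.2.2.2 i) ^ 2 ≤ ∑ i, (Z.2.1 i - Z.2.2.2 i) ^ 2 :=
      Finset.single_le_sum (f := fun i => (Z.2.1 i - Z.2.2.2 i) ^ 2)
        (fun _ _ => sq_nonneg _) (Finset.mem_univ i)
    exact h1.trans (le_add_of_nonneg_left (sq_nonneg _))
  set ρ := |Z.1 - Z.2.2.1| + ‖Z.2.1 - Z.2.2.2‖ with hρ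
  have hρ0 : 0 ≤ ρ := by positivity
  have hρ2 : ρ ^ 2 ≤ 4 * pen Z := by
    rw [hρ]
    nlinarith [sq_nonneg (|Z.1 - Z.2.2.1| - ‖Z.2.1 - Z.2.2.2‖)]
  have hρω : ρ ≤ ω := abs_le_of_sq_le_sq' (by linarith) hω0.le |>.2
  have hdist : dist (Z.1, Z.2.1) (Z.2.2.1, Z.2.2.2) ≤ ω := by
    rw [Prod.dist_eq, Real.dist_eq, dist_eq_norm]
    refine max_le ?_ ?_
    · linarith [norm_nonneg (Z.2.1 - Z.2.2.2)]
    · linarith [abs_nonneg (Z.1 - Z.2.2.1)]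
  have hlow : θ / 2 ≤ v Z.1 Z.2.1 - w Z.2.2.1 Z.2.2.2 := by
    have h1 := hzlow (n + 1)
    have e1 : 0 ≤ η * (P.T - Z.1) := mul_nonneg hη0.le (sub_nonneg.2 htZ.2)
    have e2 : 0 ≤ k * pen Z := mul_nonneg (by positivity) (hpen0 _)
    have e3 : 0 ≤ δ * (β Z.2.1 + β Z.2.2.2) := mul_nonneg hδ0.le
      (add_nonneg (hB.nonneg _ (hKS hmZ)) (hB.nonneg _ (hKS hqZ)))
    simp only [Φ, ← hZ] at h1
    linarith
  have htT : Z.1 < P.T := by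
    refine lt_of_le_of_ne htZ.2 fun h => ?_
    have h1 := hT _ (hB.subset (hKS hmZ))
    have h2 := huc₂ (Z.1, Z.2.1) ⟨htZ, hB.subset (hKS hmZ)⟩ (Z.2.2.1, Z.2.2.2)
      ⟨hsZ, hB.subset (hKS hqZ)⟩ (hdist.trans_lt hωb)
    rw [Real.dist_eq] at h2
    have h3 := (abs_lt.1 h2).2
    simp only [h] at h3 hlow
    linarith
  have hsT : Z.2.2.1 < P.T := by
    refine lt_of_le_of_ne hsZ.2 fun h => ?_
    have h1 := hT _ (hB.subset (hKS hqZ))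
    have h2 := huc₁ (Z.1, Z.2.1) ⟨htZ, hB.subset (hKS hmZ)⟩ (Z.2.2.1, Z.2.2.2)
      ⟨hsZ, hB.subset (hKS hqZ)⟩ (hdist.trans_lt hωa)
    rw [Real.dist_eq] at h2
    have h3 := (abs_lt.1 h2).2
    simp only [h] at h3 hlow
    linarith
  have hfin := hA.doubling_le hC hB hv hw hδ0.le (by positivity : 0 ≤ k) ⟨htZ.1, htT⟩ ⟨hsZ.1, hsT⟩
    (hKS hmZ) (hKS hqZ) (η := η) fun t' ht' s' hs' m' hm' q' hq' =>
      hglobal (n + 1) t' ht' s' hs' m' hm' q' hq'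
  have h1 : C * ρ ≤ C * ω := mul_le_mul_of_nonneg_left hρω hC0.le
  have h2 : 2 * d * C * k * ρ ^ 2 ≤ 8 * d * C * ω := by
    calc 2 * d * C * k * ρ ^ 2 ≤ 2 * d * C * k * (4 * pen Z) := by gcongr
      _ = 8 * d * C * (k * pen Z) := by ring
      _ ≤ 8 * d * C * ω := by gcongr
  have h3 : D * ω = C * ω + 8 * d * C * ω := by rw [hD]; ring
  linarith

theorem AssumptionA.viscosity_unique [MetricSpace X] [MeasurableSpace X] [BorelSpace X]
    {P : MFCP d X} (hA : P.AssumptionA) {S : Set (Fin d → ℝ)} {β : (Fin d → ℝ) → ℝ}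
    {γ : (Fin d → ℝ) → (Fin d → ℝ)} {B : ℝ} (hB : P.Barrier S β γ B)
    {v w : ℝ → (Fin d → ℝ) → ℝ} (hv : P.IsViscositySolution S v) (hw : P.IsViscositySolution S w) :
    ∀ t ∈ Icc 0 P.T, ∀ m ∈ stdSimplex ℝ (Fin d), v t m = w t m := fun t ht m hm =>
  le_antisymm
    (hA.comparison hB hv.continuousOn hw.continuousOn hv.sub hw.super
      (fun m hm => by rw [hv.terminal m hm, hw.terminal m hm]) t ht m hm)
    (hA.comparison hB hw.continuousOn hv.continuousOn hw.sub hv.super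
      (fun m hm => by rw [hv.terminal m hm, hw.terminal m hm]) t ht m hm)

theorem eventually_mem_intSimplex {m : Fin d → ℝ} (hm : m ∈ intSimplex d) :
    ∀ᶠ q in 𝓝[stdSimplex ℝ (Fin d)] m, q ∈ intSimplex d := by
  have h1 : ∀ᶠ q : Fin d → ℝ in 𝓝 m, ∀ i, 0 < q i := by
    rw [eventually_all]
    exact fun i => (continuous_apply i).continuousAt.eventually (lt_mem_nhds (hm.1 i))
  filter_upwards [nhdsWithin_le_nhds h1, self_mem_nhdsWithin] with q h2 h3 using ⟨h2, h3.2⟩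

/-- The value function is the unique viscosity solution, on the simplex and on its interior. -/
theorem AssumptionA.viscosity_characterization [MetricSpace X] [MeasurableSpace X] [BorelSpace X]
    {P : MFCP d X} (hA : P.AssumptionA) {S : Set (Fin d → ℝ)}
    (hS : S = stdSimplex ℝ (Fin d) ∨ S = intSimplex d) :
    P.IsViscositySolution S P.V ∧ ∀ v, P.IsViscositySolution S v →
      ∀ t ∈ Icc 0 P.T, ∀ m ∈ stdSimplex ℝ (Fin d), v t m = P.V t m := by
  obtain ⟨C, hC⟩ := hA.exists_bounds
  rcases hS with rfl | rfl
  · have h := hA.V_isViscositySolution le_rfl fun m _ => eventually_mem_nhdsWithin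
    exact ⟨h, fun v hv => hA.viscosity_unique P.barrier_stdSimplex hv h⟩
  · have h := hA.V_isViscositySolution intSimplex_subset fun m hm => eventually_mem_intSimplex hm
    exact ⟨h, fun v hv => hA.viscosity_unique hC.barrier_intSimplex hv h⟩

end MFCP

/-! ### Weak limits in Hilbert spaces along ultrafilters -/

theorem exists_weak_limit {H : Type*} [NormedAddCommGroup H] [InnerProductSpace ℝ H]
    [CompleteSpace H] {x : ℕ → H} {R : ℝ} (hx : ∀ n, ‖x n‖ ≤ R) (U : Ultrafilter ℕ) :
    ∃ z : H, ∀ y, Tendsto (fun n => inner ℝ (x n) y) U (𝓝 (inner ℝ z y)) := by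
  have hb : ∀ y n, |inner ℝ (x n) y| ≤ R * ‖y‖ := fun y n =>
    (abs_real_inner_le_norm _ _).trans (mul_le_mul_of_nonneg_right (hx n) (norm_nonneg _))
  have hlim : ∀ y, ∃ l ∈ Icc (-(R * ‖y‖)) (R * ‖y‖),
      Tendsto (fun n => inner ℝ (x n) y) U (𝓝 l) := by
    intro y
    have := isCompact_Icc.ultrafilter_le_nhds' (s := Icc (-(R * ‖y‖)) (R * ‖y‖))
      (U.map fun n => inner ℝ (x n) y)
      (Ultrafilter.mem_map.2 (Filter.univ_mem' fun n => abs_le.1 (hb y n)))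
    exact this
  choose l hl hlt using hlim
  let L : H →ₗ[ℝ] ℝ :=
    { toFun := l
      map_add' := fun y z => by
        refine tendsto_nhds_unique (hlt (y + z)) ?_
        simpa only [inner_add_right] using (hlt y).add (hlt z)
      map_smul' := fun c y => by
        refine tendsto_nhds_unique (hlt (c • y)) ?_
        simpa only [real_inner_smul_right, RingHom.id_apply, smul_eq_mul] using
          (hlt y).const_mul c }
  let L' : H →L[ℝ] ℝ := L.mkContinuous R fun y => abs_le.2 (hl y)
  refine ⟨(InnerProductSpace.toDual ℝ H).symm L', fun y => ?_⟩
  rw [InnerProductSpace.toDual_symm_apply]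
  exact hlt y

/-- Closed convex sets contain the weak limits of their points (Mazur). -/
theorem mem_of_weak_limit {H : Type*} [NormedAddCommGroup H] [InnerProductSpace ℝ H]
    [CompleteSpace H] {x : ℕ → H} {z : H} {U : Ultrafilter ℕ}
    (hz : ∀ y, Tendsto (fun n => inner ℝ (x n) y) U (𝓝 (inner ℝ z y)))
    {C : Set H} (hC : Convex ℝ C) (hC' : IsClosed C) (hx : ∀ᶠ n in U, x n ∈ C) : z ∈ C := by
  by_contra h
  obtain ⟨f, u, hf, hu⟩ := geometric_hahn_banach_point_closed hC hC' h
  have hfr : ∀ b, f b = inner ℝ b ((InnerProductSpace.toDual ℝ H).symm f) := fun b => by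
    rw [real_inner_comm, InnerProductSpace.toDual_symm_apply]
  have h1 := hz ((InnerProductSpace.toDual ℝ H).symm f)
  rw [← hfr] at h1
  refine absurd (ge_of_tendsto h1 ?_) (not_le.2 hf)
  filter_upwards [hx] with n hn
  rw [← hfr]
  exact (hu _ hn).le

/-- Pointwise convergence of equi-Lipschitz curves is uniform. -/
theorem eventually_norm_sub_le_of_lipschitz {d : ℕ} {μ : ℕ → ℝ → Fin d → ℝ} {ν : ℝ → Fin d → ℝ}
    {a b C : ℝ} (hC : 0 < C)
    (hμ : ∀ n, ∀ s ∈ Icc a b, ∀ s' ∈ Icc a b, ‖μ n s' - μ n s‖ ≤ C * |s' - s|)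
    {U : Filter ℕ} [U.NeBot] (hlim : ∀ s ∈ Icc a b, Tendsto (fun n => μ n s) U (𝓝 (ν s))) :
    (∀ s ∈ Icc a b, ∀ s' ∈ Icc a b, ‖ν s' - ν s‖ ≤ C * |s' - s|) ∧
    ∀ ε, 0 < ε → ∀ᶠ n in U, ∀ s ∈ Icc a b, ‖μ n s - ν s‖ ≤ ε := by
  have hν : ∀ s ∈ Icc a b, ∀ s' ∈ Icc a b, ‖ν s' - ν s‖ ≤ C * |s' - s| := fun s hs s' hs' =>
    le_of_tendsto ((hlim s' hs').sub (hlim s hs)).norm (Eventually.of_forall fun n => hμ n s hs s' hs')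
  refine ⟨hν, fun ε hε => ?_⟩
  obtain ⟨t, hts, htf, hcov⟩ := (isCompact_Icc (a := a) (b := b)).finite_cover_balls
    (show 0 < ε / (4 * C) by positivity)
  have h1 : ∀ᶠ n in U, ∀ s ∈ t, ‖μ n s - ν s‖ ≤ ε / 2 := by
    rw [eventually_all_finite htf]
    intro s hs
    have := tendsto_iff_norm_sub_tendsto_zero.1 (hlim s (hts hs))
    exact (this.eventually (gt_mem_nhds (half_pos hε))).mono fun _ h => h.le
  filter_upwards [h1] with n hn s hs
  obtain ⟨y, hy, hys⟩ := mem_iUnion₂.1 (hcov hs)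
  rw [Metric.mem_ball, Real.dist_eq] at hys
  have e1 := hμ n y (hts hy) s hs
  have e2 := hν y (hts hy) s hs
  have e3 := hn y hy
  have e4 : C * |s - y| ≤ ε / 4 := by
    have : C * (ε / (4 * C)) = ε / 4 := by field_simp
    rw [← this]
    exact mul_le_mul_of_nonneg_left hys.le hC.le
  have e5 : μ n s - ν s = (μ n s - μ n y) + (μ n y - ν y) - (ν s - ν y) := by abel
  rw [e5]
  refine (norm_sub_le _ _).trans ?_
  have := norm_add_le (μ n s - μ n y) (μ n y - ν y)
  linarith

namespace MFCP

variable {d : ℕ} {P : MFCP d (Fin d → ℝ)} {M : ℝ} {K : Fin d → Finset (Fin d)}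

/-! ### Existence of optimal controls under Assumption B -/

theorem AssumptionB.convex_A (hB : P.AssumptionB M K) : Convex ℝ P.A := by
  rw [hB.A_eq]; exact convex_Icc _ _

theorem AssumptionB.drift_eq (hB : P.AssumptionB M K) {t : ℝ} (ht : t ∈ Icc 0 P.T)
    {a : Fin d → Fin d → ℝ} (ha : ∀ i, a i ∈ P.A) {m : Fin d → ℝ} (hm : m ∈ stdSimplex ℝ (Fin d))
    (i : Fin d) : P.drift t a m i = ∑ j, (m j * a j i - m i * a i j) := by
  rw [drift]
  refine Finset.sum_congr rfl fun j _ => ?_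
  rcases eq_or_ne j i with rfl | hj
  · simp
  · rw [hB.Q_eq j i hj.symm t ht _ (ha j) m hm, hB.Q_eq i j hj t ht _ (ha i) m hm]

theorem AssumptionB.f_mix_le (hB : P.AssumptionB M K) {t : ℝ} (ht : t ∈ Icc 0 P.T) (i : Fin d)
    {m : Fin d → ℝ} (hm : m ∈ stdSimplex ℝ (Fin d)) {a b : Fin d → ℝ} (ha : a ∈ P.A) (hb : b ∈ P.A)
    {u w : ℝ} (hu : 0 ≤ u) (hw : 0 ≤ w) (huw : u + w = 1) :
    P.f i t (u • a + w • b) m ≤ u * P.f i t a m + w * P.f i t b m := by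
  obtain ⟨D, -, -, -, l, hl, hD⟩ := hB.f_convex
  have hc := hB.convex_A ha hb hu hw huw
  have h1 := hD i t ht m hm _ hc a ha
  have h2 := hD i t ht m hm _ hc b hb
  set c := u • a + w • b with hcdef
  have h3 : 0 ≤ l * ∑ j ∈ K i, (a j - c j) ^ 2 := by positivity
  have h4 : 0 ≤ l * ∑ j ∈ K i, (b j - c j) ^ 2 := by positivity
  have h5 : u * ∑ j, D i t c m j * (a j - c j) + w * ∑ j, D i t c m j * (b j - c j) = 0 := by
    rw [Finset.mul_sum, Finset.mul_sum, ← Finset.sum_add_distrib]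
    refine Finset.sum_eq_zero fun j _ => ?_
    have e : c j = u * a j + w * b j := by simp [hcdef]
    have e2 : u * (a j - c j) + w * (b j - c j) = 0 := by
      rw [e]
      have : w = 1 - u := by linarith
      rw [this]; ring
    calc _ = D i t c m j * (u * (a j - c j) + w * (b j - c j)) := by ring
      _ = 0 := by rw [e2, mul_zero]
  have h6 := mul_le_mul_of_nonneg_left h1 hu
  have h7 := mul_le_mul_of_nonneg_left h2 hw
  have h8 : P.f i t c m = u * P.f i t c m + w * P.f i t c m := by rw [← add_mul, huw, one_mul]
  have h9 := mul_nonneg hu h3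
  have h10 := mul_nonneg hw h4
  linarith

theorem AssumptionB.F_mix_le (hB : P.AssumptionB M K) {t : ℝ} (ht : t ∈ Icc 0 P.T)
    {m : Fin d → ℝ} (hm : m ∈ stdSimplex ℝ (Fin d)) {a b : Fin d → Fin d → ℝ}
    (ha : ∀ i, a i ∈ P.A) (hb : ∀ i, b i ∈ P.A)
    {u w : ℝ} (hu : 0 ≤ u) (hw : 0 ≤ w) (huw : u + w = 1) :
    P.F t (fun i => u • a i + w • b i) m ≤ u * P.F t a m + w * P.F t b m := by
  rw [F, F, F, Finset.mul_sum, Finset.mul_sum, ← Finset.sum_add_distrib]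
  refine Finset.sum_le_sum fun i _ => ?_
  have := mul_le_mul_of_nonneg_left (hB.f_mix_le ht i hm (ha i) (hb i) hu hw huw) (hm.1 i)
  linarith

theorem AssumptionB.nonneg_M (hB : P.AssumptionB M K) (i : Fin d) : 0 ≤ M := by
  obtain ⟨a, ha⟩ := hB.toA.A_nonempty
  rw [hB.A_eq] at ha
  exact (ha.1 i).trans (ha.2 i)

/-- A square integrable function with values a.e. in the box agrees a.e. with a control. -/
theorem AssumptionB.exists_control (hB : P.AssumptionB M K) {ν : Measure ℝ}
    {x : ℝ → EuclideanSpace ℝ (Fin d × Fin d)} (hx : AEStronglyMeasurable x ν)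
    (hbox : ∀ᵐ r ∂ν, ∀ i j, 0 ≤ x r (i, j) ∧ x r (i, j) ≤ M) :
    ∃ α : ℝ → Fin d → Fin d → ℝ, (∀ i, Measurable fun r => α r i) ∧ (∀ r i, α r i ∈ P.A) ∧
      ∀ᵐ r ∂ν, α r = fun i j => x r (i, j) := by
  refine ⟨fun r i j => max 0 (min M (hx.mk x r (i, j))), fun i => ?_, fun r i => ?_, ?_⟩
  · refine measurable_pi_lambda _ fun j => measurable_const.max (measurable_const.min ?_)
    have h1 : Continuous fun y : EuclideanSpace ℝ (Fin d × Fin d) => y (i, j) := by fun_prop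
    exact h1.measurable.comp hx.stronglyMeasurable_mk.measurable
  · rw [hB.A_eq]
    exact ⟨fun j => le_max_left _ _, fun j => max_le (hB.nonneg_M i) (min_le_left _ _)⟩
  · filter_upwards [hx.ae_eq_mk, hbox] with r hr hb
    ext i j
    rw [← hr, min_eq_right (hb i j).2, max_eq_right (hb i j).1]

/-- The controls with running cost at most `c` along the fixed curve `μ`. -/
def sublevel (P : MFCP d (Fin d → ℝ)) (M t₀ : ℝ) (μ : ℝ → Fin d → ℝ) (c : ℝ) :
    Set (Lp (EuclideanSpace ℝ (Fin d × Fin d)) 2 (volume.restrict (Icc t₀ P.T))) :=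
  {x | (∀ᵐ r ∂(volume.restrict (Icc t₀ P.T)), ∀ i j, 0 ≤ x r (i, j) ∧ x r (i, j) ≤ M) ∧
    ∫ r, P.F r (fun i j => x r (i, j)) (μ r) ∂(volume.restrict (Icc t₀ P.T)) ≤ c}

section

variable {t₀ : ℝ} {μ : ℝ → Fin d → ℝ}

theorem AssumptionB.integrable_F_of_box (hB : P.AssumptionB M K) (ht₀ : t₀ ∈ Icc 0 P.T)
    (hμc : ContinuousOn μ (Icc t₀ P.T)) (hμS : ∀ s ∈ Icc t₀ P.T, μ s ∈ stdSimplex ℝ (Fin d))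
    {x : ℝ → EuclideanSpace ℝ (Fin d × Fin d)}
    (hx : AEStronglyMeasurable x (volume.restrict (Icc t₀ P.T)))
    (hbox : ∀ᵐ r ∂(volume.restrict (Icc t₀ P.T)), ∀ i j, 0 ≤ x r (i, j) ∧ x r (i, j) ≤ M) :
    Integrable (fun r => P.F r (fun i j => x r (i, j)) (μ r)) (volume.restrict (Icc t₀ P.T)) := by
  obtain ⟨C, hC⟩ := hB.toA.exists_bounds
  obtain ⟨α, hαm, hαA, hα⟩ := hB.exists_control hx hbox
  have h1 := hB.toA.intervalIntegrable_F hC ht₀.1 (α := α) (ν := μ)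
    (fun i => (hαm i).comp measurable_subtype_coe) (fun s _ i => hαA s i) hμc hμS
    (left_mem_Icc.2 ht₀.2) (right_mem_Icc.2 ht₀.2)
  rw [intervalIntegrable_iff_integrableOn_Icc_of_le ht₀.2] at h1
  refine h1.congr ?_
  filter_upwards [hα] with r hr
  rw [hr]

theorem AssumptionB.convex_sublevel (hB : P.AssumptionB M K) (ht₀ : t₀ ∈ Icc 0 P.T)
    (hμc : ContinuousOn μ (Icc t₀ P.T)) (hμS : ∀ s ∈ Icc t₀ P.T, μ s ∈ stdSimplex ℝ (Fin d))
    (c : ℝ) : Convex ℝ (P.sublevel M t₀ μ c) := by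
  intro x hx y hy u w hu hw huw
  have hcoe : ∀ᵐ r ∂(volume.restrict (Icc t₀ P.T)), (u • x + w • y :
      Lp (EuclideanSpace ℝ (Fin d × Fin d)) 2 (volume.restrict (Icc t₀ P.T))) r
      = u • x r + w • y r := by
    filter_upwards [Lp.coeFn_add (u • x) (w • y), Lp.coeFn_smul u x, Lp.coeFn_smul w y]
      with r h1 h2 h3
    rw [h1, Pi.add_apply, h2, h3]; rfl
  have hbox : ∀ᵐ r ∂(volume.restrict (Icc t₀ P.T)), ∀ i j,
      0 ≤ (u • x + w • y : Lp (EuclideanSpace ℝ (Fin d × Fin d)) 2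
        (volume.restrict (Icc t₀ P.T))) r (i, j) ∧
      (u • x + w • y : Lp (EuclideanSpace ℝ (Fin d × Fin d)) 2
        (volume.restrict (Icc t₀ P.T))) r (i, j) ≤ M := by
    filter_upwards [hcoe, hx.1, hy.1] with r hr h1 h2 i j
    rw [hr]
    simp only [PiLp.add_apply, PiLp.smul_apply, smul_eq_mul]
    obtain ⟨h3, h4⟩ := h1 i j
    obtain ⟨h5, h6⟩ := h2 i j
    constructor
    · positivity
    · have : M = u * M + w * M := by rw [← add_mul, huw, one_mul]
      rw [this]
      gcongr
  refine ⟨hbox, ?_⟩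
  have ix := hB.integrable_F_of_box ht₀ hμc hμS (Lp.aestronglyMeasurable x) hx.1
  have iy := hB.integrable_F_of_box ht₀ hμc hμS (Lp.aestronglyMeasurable y) hy.1
  have iz := hB.integrable_F_of_box ht₀ hμc hμS (Lp.aestronglyMeasurable (u • x + w • y)) hbox
  refine (integral_mono_ae iz ((ix.const_mul u).add (iy.const_mul w)) ?_).trans ?_
  · filter_upwards [hcoe, hx.1, hy.1, ae_restrict_mem measurableSet_Icc] with r hr h1 h2 hrm
    have := hB.F_mix_le ⟨ht₀.1.trans hrm.1, hrm.2⟩ (hμS r hrm) (a := fun i j => x r (i, j))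
      (b := fun i j => y r (i, j)) (fun i => by
        rw [hB.A_eq]; exact ⟨fun j => (h1 i j).1, fun j => (h1 i j).2⟩) (fun i => by
        rw [hB.A_eq]; exact ⟨fun j => (h2 i j).1, fun j => (h2 i j).2⟩) hu hw huw
    rw [hr]
    exact this
  · rw [integral_add' (ix.const_mul u) (iy.const_mul w), integral_const_mul, integral_const_mul]
    have h1 := mul_le_mul_of_nonneg_left hx.2 hu
    have h2 := mul_le_mul_of_nonneg_left hy.2 hw
    have h3 : c = u * c + w * c := by rw [← add_mul, huw, one_mul]
    linarith

theorem AssumptionB.isClosed_sublevel (hB : P.AssumptionB M K) (ht₀ : t₀ ∈ Icc 0 P.T)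
    (hμc : ContinuousOn μ (Icc t₀ P.T)) (hμS : ∀ s ∈ Icc t₀ P.T, μ s ∈ stdSimplex ℝ (Fin d))
    (c : ℝ) : IsClosed (P.sublevel M t₀ μ c) := by
  obtain ⟨C, hC⟩ := hB.toA.exists_bounds
  refine IsSeqClosed.isClosed fun x z hx hxz => ?_
  obtain ⟨ns, -, hns⟩ := (tendstoInMeasure_of_tendsto_Lp hxz).exists_seq_tendsto_ae
  have hallbox : ∀ᵐ r ∂(volume.restrict (Icc t₀ P.T)), ∀ n, ∀ i j,
      0 ≤ x n r (i, j) ∧ x n r (i, j) ≤ M := ae_all_iff.2 fun n => (hx n).1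
  have hconv : ∀ᵐ r ∂(volume.restrict (Icc t₀ P.T)),
      Tendsto (fun k => fun i j => x (ns k) r (i, j)) atTop (𝓝 fun i j => z r (i, j)) := by
    filter_upwards [hns] with r hr
    have h1 : Continuous fun y : EuclideanSpace ℝ (Fin d × Fin d) => fun i j => y (i, j) := by
      fun_prop
    exact (h1.tendsto _).comp hr
  have hbox : ∀ᵐ r ∂(volume.restrict (Icc t₀ P.T)), ∀ i j, 0 ≤ z r (i, j) ∧ z r (i, j) ≤ M := by
    filter_upwards [hallbox, hconv] with r h1 h2 i j
    have h3 : Tendsto (fun k => x (ns k) r (i, j)) atTop (𝓝 (z r (i, j))) :=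
      tendsto_pi_nhds.1 (tendsto_pi_nhds.1 h2 i) j
    exact ⟨ge_of_tendsto' h3 fun k => (h1 _ i j).1, le_of_tendsto' h3 fun k => (h1 _ i j).2⟩
  refine ⟨hbox, ?_⟩
  have hlim := tendsto_integral_of_dominated_convergence
    (μ := volume.restrict (Icc t₀ P.T))
    (F := fun k r => P.F r (fun i j => x (ns k) r (i, j)) (μ r))
    (f := fun r => P.F r (fun i j => z r (i, j)) (μ r)) (fun _ => C)
    (fun k => (hB.integrable_F_of_box ht₀ hμc hμS (Lp.aestronglyMeasurable _)
      (hx (ns k)).1).aestronglyMeasurable) (integrable_const _) (by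
      intro k
      filter_upwards [hallbox, ae_restrict_mem measurableSet_Icc] with r h1 hrm
      refine hC.F_le r ⟨ht₀.1.trans hrm.1, hrm.2⟩ _ (fun i => ?_) _ (hμS r hrm)
      rw [hB.A_eq]; exact ⟨fun j => (h1 _ i j).1, fun j => (h1 _ i j).2⟩) (by
      filter_upwards [hallbox, hbox, hconv, ae_restrict_mem measurableSet_Icc] with r h1 h2 h3 hrm
      have hF : ContinuousOn (fun a => P.F r a (μ r)) (univ.pi fun _ => P.A) :=
        hB.toA.F_cont.comp (f := fun a => (r, a, μ r)) (by fun_prop) fun a ha =>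
          ⟨⟨ht₀.1.trans hrm.1, hrm.2⟩, ha, hμS r hrm⟩
      have hmem : ∀ y : EuclideanSpace ℝ (Fin d × Fin d), (∀ i j, 0 ≤ y (i, j) ∧ y (i, j) ≤ M) →
          (fun i j => y (i, j)) ∈ (univ.pi fun _ : Fin d => P.A) := fun y hy i _ => by
        rw [hB.A_eq]; exact ⟨fun j => (hy i j).1, fun j => (hy i j).2⟩
      exact (hF _ (hmem _ h2)).tendsto.comp (tendsto_nhdsWithin_iff.2
        ⟨h3, Eventually.of_forall fun k => hmem _ (h1 _)⟩))
  exact le_of_tendsto' hlim fun k => (hx (ns k)).2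

end

/-- Existence of an optimal control by the direct method. Along an ultrafilter a minimizing sequence of
controls converges weakly in `L²` and the trajectories converge uniformly. The drift is affine in
the control and the running cost is convex in it, so both pass to the limit. -/
theorem AssumptionB.exists_isOptimal (hB : P.AssumptionB M K) {t₀ : ℝ} (ht₀ : t₀ ∈ Icc 0 P.T)
    {m₀ : Fin d → ℝ} (hm₀ : m₀ ∈ stdSimplex ℝ (Fin d)) :
    ∃ α μ, P.IsAdmissible t₀ m₀ α μ ∧ P.J t₀ α μ = P.V t₀ m₀ := by
  have hA := hB.toA
  obtain ⟨C, hC⟩ := hA.exists_bounds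
  have hC0 := hC.pos
  have hl : t₀ ∈ Icc t₀ P.T := left_mem_Icc.2 ht₀.2
  have hr : P.T ∈ Icc t₀ P.T := right_mem_Icc.2 ht₀.2
  have hI : ∀ r ∈ Icc t₀ P.T, r ∈ Icc 0 P.T := fun r hr => ⟨ht₀.1.trans hr.1, hr.2⟩
  choose α μ hadm hJ using fun n : ℕ =>
    hA.exists_J_lt ht₀ hm₀ (show (0 : ℝ) < 1 / (n + 1) by positivity)
  obtain ⟨U, hU⟩ : ∃ U : Ultrafilter ℕ, (U : Filter ℕ) ≤ atTop :=
    ⟨Ultrafilter.of atTop, Ultrafilter.of_le _⟩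
  -- the limit trajectory
  have hlim : ∀ r ∈ Icc t₀ P.T, ∃ q ∈ stdSimplex ℝ (Fin d), Tendsto (fun n => μ n r) U (𝓝 q) := by
    intro r hr
    exact (isCompact_stdSimplex ℝ (Fin d)).ultrafilter_le_nhds' (U.map fun n => μ n r)
      (Ultrafilter.mem_map.2 (Filter.univ_mem' fun n => (hadm n).mem_simplex r hr))
  choose! ν hνS hνlim using hlim
  obtain ⟨hνlip, hunif⟩ := eventually_norm_sub_le_of_lipschitz hC0
    (fun n s hs s' hs' => (hadm n).norm_sub_le hA hC ht₀.1 hs hs') hνlim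
  have hνc : ContinuousOn ν (Icc t₀ P.T) := by
    have : LipschitzOnWith (Real.toNNReal C) ν (Icc t₀ P.T) :=
      LipschitzOnWith.of_dist_le_mul fun x hx y hy => by
        rw [dist_eq_norm, Real.dist_eq, Real.coe_toNNReal _ hC0.le]
        exact hνlip y hy x hx
    exact this.continuousOn
  -- the controls as elements of `L²`
  have hαbox : ∀ n, ∀ r ∈ Icc t₀ P.T, ∀ i j, 0 ≤ α n r i j ∧ α n r i j ≤ M := by
    intro n r hr i j
    have := (hadm n).mem_A r hr i
    rw [hB.A_eq] at this
    exact ⟨this.1 j, this.2 j⟩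
  let ξ : ℕ → ℝ → EuclideanSpace ℝ (Fin d × Fin d) := fun n r =>
    WithLp.toLp 2 fun ij => α n r ij.1 ij.2
  have hξm : ∀ n, AEStronglyMeasurable (ξ n) (volume.restrict (Icc t₀ P.T)) := by
    intro n
    refine AEMeasurable.aestronglyMeasurable
      (aemeasurable_restrict_of_measurable_subtype measurableSet_Icc ?_)
    have h1 : Measurable fun s : Icc t₀ P.T => fun ij : Fin d × Fin d => α n s ij.1 ij.2 :=
      measurable_pi_lambda _ fun ij => (measurable_pi_apply ij.2).comp ((hadm n).measurable ij.1)
    exact (PiLp.continuous_toLp 2 _).measurable.comp h1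
  obtain ⟨R, hR⟩ : ∃ R : ℝ, ∀ n, ∀ r ∈ Icc t₀ P.T, ‖ξ n r‖ ≤ R := by
    refine ⟨Real.sqrt (∑ _ij : Fin d × Fin d, M ^ 2), fun n r hr => ?_⟩
    rw [EuclideanSpace.norm_eq]
    refine Real.sqrt_le_sqrt (Finset.sum_le_sum fun ij _ => ?_)
    have := hαbox n r hr ij.1 ij.2
    simp only [ξ, Real.norm_eq_abs, sq_abs]
    exact pow_le_pow_left₀ this.1 this.2 2
  have hξL : ∀ n, MemLp (ξ n) 2 (volume.restrict (Icc t₀ P.T)) := fun n =>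
    MemLp.of_bound (hξm n) R (by
      filter_upwards [ae_restrict_mem measurableSet_Icc] with r hr using hR n r hr)
  let x : ℕ → Lp (EuclideanSpace ℝ (Fin d × Fin d)) 2 (volume.restrict (Icc t₀ P.T)) := fun n =>
    (hξL n).toLp
  have hxξ : ∀ n, ∀ᵐ r ∂(volume.restrict (Icc t₀ P.T)), x n r = ξ n r := fun n => (hξL n).coeFn_toLp
  obtain ⟨R', hR'⟩ : ∃ R', ∀ n, ‖x n‖ ≤ R' := by
    refine ⟨_, fun n => Lp.norm_le_of_ae_bound (C := |R|) (abs_nonneg R) ?_⟩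
    filter_upwards [hxξ n, ae_restrict_mem measurableSet_Icc] with r h1 hrm
    rw [h1]
    exact (hR n r hrm).trans (le_abs_self _)
  obtain ⟨z, hz⟩ := exists_weak_limit hR' U
  have hFx : ∀ n, ∫ r, P.F r (fun i j => x n r (i, j)) (ν r) ∂(volume.restrict (Icc t₀ P.T)) =
      ∫ r in t₀..P.T, P.F r (α n r) (ν r) := by
    intro n
    rw [intervalIntegral.integral_of_le ht₀.2, ← integral_Icc_eq_integral_Ioc]
    refine integral_congr_ae ?_
    filter_upwards [hxξ n] with r h1
    rw [h1]
  have hxbox : ∀ n, ∀ᵐ r ∂(volume.restrict (Icc t₀ P.T)), ∀ i j,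
      0 ≤ x n r (i, j) ∧ x n r (i, j) ≤ M := by
    intro n
    filter_upwards [hxξ n, ae_restrict_mem measurableSet_Icc] with r h1 hrm i j
    rw [h1]
    exact hαbox n r hrm i j
  -- lower semicontinuity of the cost
  have hcost : ∀ ε, 0 < ε → z ∈ P.sublevel M t₀ ν (P.V t₀ m₀ - P.G (ν P.T) + ε) := by
    intro ε hε
    refine mem_of_weak_limit hz (hB.convex_sublevel ht₀ hνc hνS _)
      (hB.isClosed_sublevel ht₀ hνc hνS _) ?_
    have hT0 := hA.T_pos
    have h1 := hunif (ε / (2 * C * (P.T + 1))) (by positivity)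
    have h2 : ∀ᶠ n : ℕ in U, 1 / ((n : ℝ) + 1) < ε / 2 :=
      hU (tendsto_one_div_add_atTop_nhds_zero_nat.eventually (gt_mem_nhds (half_pos hε)))
    filter_upwards [h1, h2] with n h3 h4
    refine ⟨hxbox n, ?_⟩
    rw [hFx]
    have i1 := (hadm n).intervalIntegrable_F hA ht₀.1 hl hr
    have i2 := hA.intervalIntegrable_F hC ht₀.1 (hadm n).measurable (hadm n).mem_A hνc hνS hl hr
    have e1 : |∫ r in t₀..P.T, (P.F r (α n r) (ν r) - P.F r (α n r) (μ n r))| ≤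
        C * (ε / (2 * C * (P.T + 1))) * |P.T - t₀| := by
      refine abs_integral_le_of_le (fun r hr => ?_) hl hr
      have := hC.F_lip r (hI r hr) r (hI r hr) _ ((hadm n).mem_A r hr) _ (hνS r hr) _
        ((hadm n).mem_simplex r hr)
      rw [sub_self, abs_zero, zero_add, norm_sub_rev] at this
      exact this.trans (mul_le_mul_of_nonneg_left (h3 r hr) hC0.le)
    rw [intervalIntegral.integral_sub i2 i1] at e1
    have e2 := hC.G_lip _ (hνS P.T hr) _ ((hadm n).mem_simplex P.T hr)
    have e3 := mul_le_mul_of_nonneg_left (h3 P.T hr) hC0.le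
    rw [norm_sub_rev] at e3
    have e4 := hJ n
    rw [J] at e4
    have e5 : |P.T - t₀| ≤ P.T := by
      rw [abs_of_nonneg (sub_nonneg.2 ht₀.2)]; linarith [ht₀.1]
    have e6 : C * (ε / (2 * C * (P.T + 1))) * |P.T - t₀| + C * (ε / (2 * C * (P.T + 1))) ≤ ε / 2 := by
      calc _ ≤ C * (ε / (2 * C * (P.T + 1))) * P.T + C * (ε / (2 * C * (P.T + 1))) := by gcongr
        _ = ε / 2 := by field_simp
    have e7 := (abs_le.1 e1).2
    have e8 := (abs_le.1 e2).2
    linarith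
  have hzbox := (hcost 1 one_pos).1
  obtain ⟨β, hβm, hβA, hβ⟩ := hB.exists_control (Lp.aestronglyMeasurable z) hzbox
  -- the limit of the state equation
  have hdrift : ∀ s ∈ Icc t₀ P.T, ∀ i, Tendsto
      (fun n => ∫ r in t₀..s, P.drift r (α n r) (ν r) i) U
      (𝓝 (∫ r in t₀..s, P.drift r (β r) (ν r) i)) := by
    intro s hs i
    let c : ℝ → EuclideanSpace ℝ (Fin d × Fin d) := fun r => WithLp.toLp 2 fun kl =>
      (if kl.2 = i then ν r kl.1 else 0) - if kl.1 = i then ν r i else 0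
    have hcc : ContinuousOn c (Icc t₀ P.T) := by
      refine (PiLp.continuous_toLp 2 _).comp_continuousOn (continuousOn_pi.2 fun kl => ?_)
      have h1 : ∀ k, ContinuousOn (fun r => ν r k) (Icc t₀ P.T) := fun k =>
        (continuous_apply k).comp_continuousOn hνc
      refine ContinuousOn.sub ?_ ?_
      · by_cases h : kl.2 = i
        · simpa [h] using h1 kl.1
        · simpa [h] using continuousOn_const
      · by_cases h : kl.1 = i
        · simpa [h] using h1 i
        · simpa [h] using continuousOn_const
    have hcL : MemLp ((Icc t₀ s).indicator c) 2 (volume.restrict (Icc t₀ P.T)) := by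
      obtain ⟨N, hN⟩ := isCompact_Icc.exists_bound_of_continuousOn hcc
      refine (MemLp.of_bound (hcc.aestronglyMeasurable measurableSet_Icc) N ?_).indicator
        measurableSet_Icc
      filter_upwards [ae_restrict_mem measurableSet_Icc] with r hr using hN r hr
    have key : ∀ (y : Lp (EuclideanSpace ℝ (Fin d × Fin d)) 2 (volume.restrict (Icc t₀ P.T)))
        (a : ℝ → Fin d → Fin d → ℝ), (∀ r ∈ Icc t₀ P.T, ∀ i, a r i ∈ P.A) →
        (∀ᵐ r ∂(volume.restrict (Icc t₀ P.T)), ∀ i j, y r (i, j) = a r i j) →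
        inner ℝ y hcL.toLp = ∫ r in t₀..s, P.drift r (a r) (ν r) i := by
      intro y a haA hya
      rw [L2.inner_def, intervalIntegral.integral_of_le hs.1, ← integral_Icc_eq_integral_Ioc]
      have hsub : Icc t₀ s ⊆ Icc t₀ P.T := Icc_subset_Icc_right hs.2
      have h2 : ∫ r in Icc t₀ s, P.drift r (a r) (ν r) i =
          ∫ r, (Icc t₀ s).indicator (fun r => P.drift r (a r) (ν r) i) r
            ∂(volume.restrict (Icc t₀ P.T)) := by
        rw [integral_indicator measurableSet_Icc, Measure.restrict_restrict measurableSet_Icc,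
          inter_eq_self_of_subset_left hsub]
      rw [h2]
      refine integral_congr_ae ?_
      filter_upwards [hya, hcL.coeFn_toLp, ae_restrict_mem measurableSet_Icc] with r h3 h4 hrm
      rw [h4]
      by_cases hrs : r ∈ Icc t₀ s
      · rw [indicator_of_mem hrs, indicator_of_mem hrs, hB.drift_eq (hI r hrm) (haA r hrm) (hνS r hrm),
          PiLp.inner_apply]
        simp only [c, RCLike.inner_apply, conj_trivial, Fintype.sum_prod_type, h3]
        simp only [sub_mul, ite_mul, zero_mul, Finset.sum_sub_distrib, Finset.sum_ite_eq',
          Finset.mem_univ, if_true, Finset.sum_ite_irrel, Finset.sum_const_zero]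
      · rw [indicator_of_notMem hrs, indicator_of_notMem hrs, inner_zero_right]
    have h5 := hz hcL.toLp
    rw [key z β (fun r _ i => hβA r i) (by
      filter_upwards [hβ] with r hr i j
      rw [hr])] at h5
    refine h5.congr fun n => key (x n) (α n) (fun r hr i => (hadm n).mem_A r hr i) ?_
    filter_upwards [hxξ n] with r hr i j
    rw [hr]
  have hstate : ∀ s ∈ Icc t₀ P.T, ∀ i, ν s i = m₀ i + ∫ r in t₀..s, P.drift r (β r) (ν r) i := by
    intro s hs i
    have h1 : Tendsto (fun n => (∫ r in t₀..s, P.drift r (α n r) (μ n r) i) -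
        ∫ r in t₀..s, P.drift r (α n r) (ν r) i) U (𝓝 0) := by
      rw [Metric.tendsto_nhds]
      intro ε hε
      have hT0 := hA.T_pos
      filter_upwards [hunif (ε / (2 * C * (P.T + 1))) (by positivity)] with n hn
      rw [← intervalIntegral.integral_sub ((hadm n).intervalIntegrable_drift hA ht₀.1 hl hs i)
        (hA.intervalIntegrable_drift hC ht₀.1 (hadm n).measurable (hadm n).mem_A hνc hνS hl hs i),
        dist_zero_right, Real.norm_eq_abs]
      refine (abs_integral_le_of_le (C := C * (ε / (2 * C * (P.T + 1)))) (fun r hr => ?_)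
        hl hs).trans_lt ?_
      · have := hC.drift_lip r (hI r hr) r (hI r hr) _ ((hadm n).mem_A r hr) _
          ((hadm n).mem_simplex r hr) _ (hνS r hr)
        rw [sub_self, abs_zero, zero_add] at this
        refine (norm_le_pi_norm (P.drift r (α n r) (μ n r) - P.drift r (α n r) (ν r)) i).trans ?_
        exact this.trans (mul_le_mul_of_nonneg_left (hn r hr) hC0.le)
      · have e5 : |s - t₀| ≤ P.T := by
          rw [abs_of_nonneg (sub_nonneg.2 hs.1)]; linarith [ht₀.1, hs.2]
        calc _ ≤ C * (ε / (2 * C * (P.T + 1))) * P.T := by gcongr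
          _ < C * (ε / (2 * C * (P.T + 1))) * (P.T + 1) := by
            gcongr
            linarith
          _ = ε / 2 := by field_simp
          _ < ε := by linarith
    have h2 := (h1.add (hdrift s hs i)).const_add (m₀ i)
    have h3 : Tendsto (fun n => μ n s i) U (𝓝 (ν s i)) := tendsto_pi_nhds.1 (hνlim s hs) i
    refine tendsto_nhds_unique h3 ?_
    simp only [sub_add_cancel, zero_add] at h2
    exact h2.congr fun n => ((hadm n).state_eq s hs i).symm
  have hadmβ : P.IsAdmissible t₀ m₀ β ν :=
    ⟨fun i => (hβm i).comp measurable_subtype_coe, fun s _ i => hβA s i, hνS, hνc, hstate⟩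
  refine ⟨β, ν, hadmβ, le_antisymm (le_of_forall_pos_le_add fun ε hε => ?_) (hadmβ.V_le hA ht₀)⟩
  have h1 := (hcost ε hε).2
  have h2 : ∫ r, P.F r (fun i j => z r (i, j)) (ν r) ∂(volume.restrict (Icc t₀ P.T)) =
      ∫ r in t₀..P.T, P.F r (β r) (ν r) := by
    rw [intervalIntegral.integral_of_le ht₀.2, ← integral_Icc_eq_integral_Ioc]
    refine integral_congr_ae ?_
    filter_upwards [hβ] with r hr
    rw [hr]
  rw [h2] at h1
  rw [J]
  linarith

end MFCP

/-! ### Convex and semiconcave functions on the simplex -/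

theorem sum_sq_le {d : ℕ} (h : Fin d → ℝ) : ∑ i, h i ^ 2 ≤ d * ‖h‖ ^ 2 := by
  calc ∑ i, h i ^ 2 ≤ ∑ _i : Fin d, ‖h‖ ^ 2 := Finset.sum_le_sum fun i _ => by
        rw [← sq_abs]
        exact pow_le_pow_left₀ (abs_nonneg _) (norm_le_pi_norm h i) 2
    _ = d * ‖h‖ ^ 2 := by simp

theorem norm_sq_le_sum_sq {d : ℕ} (h : Fin d → ℝ) : ‖h‖ ^ 2 ≤ ∑ i, h i ^ 2 := by
  have h0 : 0 ≤ ∑ i, h i ^ 2 := by positivity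
  rw [← Real.sqrt_le_sqrt_iff h0, Real.sqrt_sq (norm_nonneg _),
    pi_norm_le_iff_of_nonneg (Real.sqrt_nonneg _)]
  intro i
  rw [Real.norm_eq_abs]
  exact Real.abs_le_sqrt (Finset.single_le_sum (f := fun i => h i ^ 2)
    (fun _ _ => sq_nonneg _) (Finset.mem_univ i))

theorem sum_mix_sq {d : ℕ} (m q : Fin d → ℝ) {u w : ℝ} (h : u + w = 1) :
    u * ∑ i, m i ^ 2 + w * ∑ i, q i ^ 2 - ∑ i, (u • m + w • q) i ^ 2 =
      u * w * ∑ i, (m i - q i) ^ 2 := by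
  have hw : w = 1 - u := by linarith
  subst hw
  simp only [Finset.mul_sum, ← Finset.sum_add_distrib, ← Finset.sum_sub_distrib]
  refine Finset.sum_congr rfl fun i _ => ?_
  simp only [Pi.add_apply, Pi.smul_apply, smul_eq_mul]
  ring

/-- The vector `p` is the gradient at `m`, normalized by `⟨m, p⟩ = 0`, of a function `W` on the simplex
which is convex and `c`-semiconcave. -/
structure IsSimplexGradient {d : ℕ} (W : (Fin d → ℝ) → ℝ) (c L : ℝ) (m p : Fin d → ℝ) : Prop where
  norm_le : ‖p‖ ≤ L
  sum_eq : ∑ i, m i * p i = 0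
  lower : ∀ q ∈ stdSimplex ℝ (Fin d), 0 ≤ W q - W m - ∑ i, p i * (q i - m i)
  upper : ∀ q ∈ stdSimplex ℝ (Fin d), W q - W m - ∑ i, p i * (q i - m i) ≤ c * ‖q - m‖ ^ 2

/-- A convex and semiconcave function on the simplex is differentiable up to the boundary. The
components of the gradient are limits of the difference quotients in the directions of the vertices;
semiconcavity makes the directional derivative linear. -/
theorem exists_isSimplexGradient {d : ℕ} {W : (Fin d → ℝ) → ℝ} {c L : ℝ} (hc : 0 ≤ c) (hL : 0 ≤ L)
    (hconv : ConvexOn ℝ (stdSimplex ℝ (Fin d)) W)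
    (hconc : ConcaveOn ℝ (stdSimplex ℝ (Fin d)) fun m => W m - c * ∑ i, m i ^ 2)
    (hlip : ∀ m ∈ stdSimplex ℝ (Fin d), ∀ q ∈ stdSimplex ℝ (Fin d), |W m - W q| ≤ L * ‖m - q‖)
    {m : Fin d → ℝ} (hm : m ∈ stdSimplex ℝ (Fin d)) : ∃ p, IsSimplexGradient W (c * d) L m p := by
  have hS := convex_stdSimplex ℝ (Fin d)
  let τ : ℕ → ℝ := fun n => 1 / ((n : ℝ) + 1)
  have hτ0 : ∀ n, 0 < τ n := fun n => by positivity
  have hτ1 : ∀ n, τ n ≤ 1 := fun n => by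
    rw [div_le_one (by positivity)]; linarith [Nat.cast_nonneg (α := ℝ) n]
  have hτlim : Tendsto τ atTop (𝓝 0) := tendsto_one_div_add_atTop_nhds_zero_nat
  let pt : ℕ → (Fin d → ℝ) → (Fin d → ℝ) := fun n q => (1 - τ n) • m + τ n • q
  have hpt : ∀ n, ∀ q ∈ stdSimplex ℝ (Fin d), pt n q ∈ stdSimplex ℝ (Fin d) := fun n q hq =>
    hS hm hq (sub_nonneg.2 (hτ1 n)) (hτ0 n).le (by ring)
  let s : ℕ → Fin d → ℝ := fun n i => (W (pt n (Pi.single i 1)) - W m) / τ n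
  have hsL : ∀ n, s n ∈ Metric.closedBall (0 : Fin d → ℝ) L := by
    intro n
    rw [mem_closedBall_zero_iff, pi_norm_le_iff_of_nonneg hL]
    intro i
    rw [Real.norm_eq_abs, abs_div, abs_of_pos (hτ0 n), div_le_iff₀ (hτ0 n)]
    refine (hlip _ (hpt n _ (single_mem_stdSimplex ℝ i)) m hm).trans ?_
    have : pt n (Pi.single i 1) - m = τ n • (Pi.single i 1 - m) := by
      simp only [pt]; module
    rw [this, norm_smul, Real.norm_of_nonneg (hτ0 n).le]
    have := stdSimplex_norm_sub_le (single_mem_stdSimplex ℝ i) hm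
    have := mul_le_mul_of_nonneg_left this (hτ0 n).le
    have := mul_le_mul_of_nonneg_left this hL
    linarith
  obtain ⟨p, hp, φ, hφ, hlim⟩ := (isCompact_closedBall (0 : Fin d → ℝ) L).tendsto_subseq hsL
  have hτφ : Tendsto (fun n => τ (φ n)) atTop (𝓝 0) := hτlim.comp hφ.tendsto_atTop
  have hsum : ∀ q : Fin d → ℝ, Tendsto (fun n => ∑ i, q i * s (φ n) i) atTop (𝓝 (∑ i, q i * p i)) :=
    fun q => tendsto_finsetSum _ fun i _ => ((tendsto_pi_nhds.1 hlim i).const_mul (q i))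
  -- a point of the segment is a convex combination of the points towards the vertices
  have hcomb : ∀ n, ∀ q ∈ stdSimplex ℝ (Fin d), pt n q = ∑ i, q i • pt n (Pi.single i 1) := by
    intro n q hq
    simp only [pt, smul_add, Finset.sum_add_distrib, ← Finset.sum_smul, hq.2, one_smul]
    congr 1
    ext j
    simp [Finset.sum_apply, Pi.single_apply, mul_comm]
  have hW : ∀ n, ∀ q : Fin d → ℝ, q ∈ stdSimplex ℝ (Fin d) →
      ∑ i, q i * W (pt n (Pi.single i 1)) = W m + τ n * ∑ i, q i * s n i := by
    intro n q hq
    have e : ∀ i, W (pt n (Pi.single i 1)) = W m + τ n * s n i := fun i => by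
      have := (hτ0 n).ne'
      simp only [s]; field_simp; ring
    simp only [e, mul_add, Finset.sum_add_distrib, ← Finset.sum_mul, hq.2, one_mul, Finset.mul_sum]
    congr 1
    exact Finset.sum_congr rfl fun i _ => by ring
  have hupW : ∀ n, ∀ q ∈ stdSimplex ℝ (Fin d), W (pt n q) ≤ W m + τ n * ∑ i, q i * s n i := by
    intro n q hq
    rw [← hW n q hq, hcomb n q hq]
    exact hconv.map_sum_le (fun i _ => hq.1 i) hq.2 fun i _ => hpt n _ (single_mem_stdSimplex ℝ i)
  have hsq : ∀ n, ∀ q : Fin d → ℝ, ∑ j, pt n q j ^ 2 = ∑ j, m j ^ 2 +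
      τ n * (2 * ∑ j, m j * (q j - m j)) + τ n ^ 2 * ∑ j, (q j - m j) ^ 2 := by
    intro n q
    simp only [Finset.mul_sum, ← Finset.sum_add_distrib]
    refine Finset.sum_congr rfl fun j _ => ?_
    simp only [pt, Pi.add_apply, Pi.smul_apply, smul_eq_mul]
    ring
  have hloW : ∀ n, ∀ q ∈ stdSimplex ℝ (Fin d),
      W m + τ n * ∑ i, q i * s n i - c * d * τ n ^ 2 ≤ W (pt n q) := by
    intro n q hq
    have h1 := hconc.le_map_sum (t := Finset.univ) (w := q) (p := fun i => pt n (Pi.single i 1))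
      (fun i _ => hq.1 i) hq.2 fun i _ => hpt n _ (single_mem_stdSimplex ℝ i)
    rw [← hcomb n q hq] at h1
    simp only [smul_eq_mul, mul_sub, Finset.sum_sub_distrib] at h1
    rw [hW n q hq] at h1
    have h2 : ∑ i, q i * (c * ∑ j, pt n (Pi.single i 1) j ^ 2) ≤
        c * ∑ j, pt n q j ^ 2 + c * d * τ n ^ 2 := by
      have e1 : ∀ i ∈ Finset.univ, q i * (c * ∑ j, pt n (Pi.single i 1) j ^ 2) ≤
          q i * (c * (∑ j, m j ^ 2 - τ n * (2 * ∑ j, m j * m j) + τ n ^ 2 * d)) +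
          c * (2 * τ n) * (q i * m i) := by
        intro i _
        rw [hsq]
        have e2 : ∑ j, m j * ((Pi.single i 1 : Fin d → ℝ) j - m j) = m i - ∑ j, m j * m j := by
          simp [mul_sub, Finset.sum_sub_distrib, Pi.single_apply]
        have e3 : ∑ j, ((Pi.single i 1 : Fin d → ℝ) j - m j) ^ 2 ≤ d := by
          refine (sum_sq_le (Pi.single i 1 - m)).trans ?_
          have h3 := stdSimplex_norm_sub_le (single_mem_stdSimplex ℝ i) hm
          have h4 := pow_le_one₀ (n := 2) (norm_nonneg _) h3
          have h5 : (0 : ℝ) ≤ d := Nat.cast_nonneg d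
          nlinarith
        rw [e2]
        have e4 := mul_le_mul_of_nonneg_left (mul_le_mul_of_nonneg_left
          (mul_le_mul_of_nonneg_left e3 (sq_nonneg (τ n))) hc) (hq.1 i)
        linarith
      refine (Finset.sum_le_sum e1).trans ?_
      rw [Finset.sum_add_distrib, ← Finset.sum_mul, hq.2, ← Finset.mul_sum, hsq]
      have e5 : ∑ j, m j * (q j - m j) = ∑ j, q j * m j - ∑ j, m j * m j := by
        rw [← Finset.sum_sub_distrib]
        exact Finset.sum_congr rfl fun j _ => by ring
      rw [e5]
      have e6 : 0 ≤ c * (τ n ^ 2 * ∑ j, (q j - m j) ^ 2) := by positivity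
      linarith
    linarith
  have hlower : ∀ q ∈ stdSimplex ℝ (Fin d), ∑ i, q i * p i ≤ W q - W m := by
    intro q hq
    have h0 := ((hτφ.const_mul (c * d)).const_sub (0 : ℝ)).add (hsum q)
    simp only [mul_zero, sub_zero, zero_add] at h0
    refine le_of_tendsto' h0 fun n => ?_
    have h1 := hloW (φ n) q hq
    have h2 := hconv.2 hm hq (sub_nonneg.2 (hτ1 (φ n))) (hτ0 (φ n)).le (by ring)
    simp only [smul_eq_mul] at h2
    have h3 : τ (φ n) * (0 - c * d * τ (φ n) + ∑ i, q i * s (φ n) i) ≤ τ (φ n) * (W q - W m) := by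
      change W (pt (φ n) q) ≤ _ at h2
      linarith
    exact le_of_mul_le_mul_left h3 (hτ0 _)
  have hupper : ∀ q ∈ stdSimplex ℝ (Fin d),
      W q - W m ≤ ∑ i, q i * p i + c * ∑ i, (q i - m i) ^ 2 := by
    intro q hq
    refine ge_of_tendsto' ((hsum q).add_const _) fun n => ?_
    have h1 := hupW (φ n) q hq
    have h2 := hconc.2 hm hq (sub_nonneg.2 (hτ1 (φ n))) (hτ0 (φ n)).le (by ring)
    simp only [smul_eq_mul] at h2
    change _ ≤ W (pt (φ n) q) - c * ∑ j, pt (φ n) q j ^ 2 at h2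
    have h4 := sum_mix_sq m q (u := 1 - τ (φ n)) (w := τ (φ n)) (by ring)
    change (1 - τ (φ n)) * ∑ i, m i ^ 2 + τ (φ n) * ∑ i, q i ^ 2 - ∑ i, pt (φ n) q i ^ 2 = _ at h4
    have h5 : ∑ i, (m i - q i) ^ 2 = ∑ i, (q i - m i) ^ 2 :=
      Finset.sum_congr rfl fun i _ => by ring
    rw [h5] at h4
    have h6 : 0 ≤ c * (τ (φ n) ^ 2 * ∑ i, (q i - m i) ^ 2) := by positivity
    have h7 : c * _ = c * _ := congrArg (c * ·) h4
    have h3 : τ (φ n) * (W q - W m) ≤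
        τ (φ n) * (∑ i, q i * s (φ n) i + c * ∑ i, (q i - m i) ^ 2) := by
      linarith
    exact le_of_mul_le_mul_left h3 (hτ0 _)
  have hmp : ∑ i, m i * p i = 0 := by
    refine le_antisymm (by simpa using hlower m hm) ?_
    simpa using hupper m hm
  have hpair : ∀ q : Fin d → ℝ, ∑ i, p i * (q i - m i) = ∑ i, q i * p i := by
    intro q
    have : ∑ i, p i * (q i - m i) = ∑ i, q i * p i - ∑ i, m i * p i := by
      rw [← Finset.sum_sub_distrib]
      exact Finset.sum_congr rfl fun i _ => by ring
    rw [this, hmp, sub_zero]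
  refine ⟨p, mem_closedBall_zero_iff.1 hp, hmp, fun q hq => ?_, fun q hq => ?_⟩
  · rw [hpair]; linarith [hlower q hq]
  · rw [hpair]
    have h1 := hupper q hq
    have h2 := mul_le_mul_of_nonneg_left (sum_sq_le (q - m)) hc
    simp only [Pi.sub_apply] at h2
    linarith

/-- The gradient of a convex and semiconcave function is Lipschitz, up to the boundary: compare the
expansions at `m` and `q` at the point `(1 - r) m + r e_i`, with `r = ‖m - q‖`. -/
theorem IsSimplexGradient.norm_sub_le {d : ℕ} {W : (Fin d → ℝ) → ℝ} {c L : ℝ}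
    (hlip : ∀ m ∈ stdSimplex ℝ (Fin d), ∀ q ∈ stdSimplex ℝ (Fin d), |W m - W q| ≤ L * ‖m - q‖)
    (hc : 0 ≤ c) {m q p p' : Fin d → ℝ} (hm : m ∈ stdSimplex ℝ (Fin d))
    (hq : q ∈ stdSimplex ℝ (Fin d))
    (hp : IsSimplexGradient W c L m p) (hp' : IsSimplexGradient W c L q p') :
    ‖p - p'‖ ≤ (2 * c + L) * ‖m - q‖ := by
  have hL : 0 ≤ L := (norm_nonneg _).trans hp.norm_le
  have pairing : ∀ {m p : Fin d → ℝ}, IsSimplexGradient W c L m p → ∀ q : Fin d → ℝ,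
      ∑ i, p i * (q i - m i) = ∑ i, q i * p i := by
    intro m p h q
    have : ∑ i, p i * (q i - m i) = ∑ i, q i * p i - ∑ i, m i * p i := by
      rw [← Finset.sum_sub_distrib]
      exact Finset.sum_congr rfl fun i _ => by ring
    rw [this, h.sum_eq, sub_zero]
  have key : ∀ {m q p p' : Fin d → ℝ}, m ∈ stdSimplex ℝ (Fin d) → q ∈ stdSimplex ℝ (Fin d) →
      IsSimplexGradient W c L m p → IsSimplexGradient W c L q p' → 0 < ‖m - q‖ → ∀ i,
      p' i - p i ≤ (2 * c + L) * ‖m - q‖ := by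
    intro m q p p' hm hq hp hp' hr i
    set r := ‖m - q‖ with hrdef
    have hr1 : r ≤ 1 := stdSimplex_norm_sub_le hm hq
    set x : Fin d → ℝ := (1 - r) • m + r • Pi.single i 1 with hx
    have hxS : x ∈ stdSimplex ℝ (Fin d) := convex_stdSimplex ℝ (Fin d) hm (single_mem_stdSimplex ℝ i)
      (sub_nonneg.2 hr1) hr.le (by ring)
    have hxm : ‖x - m‖ ≤ r := by
      have : x - m = r • (Pi.single i 1 - m) := by rw [hx]; module
      rw [this, norm_smul, Real.norm_of_nonneg hr.le]
      have := stdSimplex_norm_sub_le (single_mem_stdSimplex ℝ i) hm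
      nlinarith
    have e : ∀ y : Fin d → ℝ, ∑ j, x j * y j = (1 - r) * ∑ j, m j * y j + r * y i := by
      intro y
      simp [hx, add_mul, Finset.sum_add_distrib, Finset.mul_sum, mul_assoc, Pi.single_apply]
    have h1 := hp.upper x hxS
    rw [pairing hp, e, hp.sum_eq] at h1
    have h2 := hp'.lower x hxS
    rw [pairing hp', e] at h2
    have h3 := hp'.upper m hm
    rw [pairing hp', ← hrdef] at h3
    have h4 := hp'.lower m hm
    rw [pairing hp'] at h4
    have h5 := (abs_le.1 (hlip m hm q hq)).2
    have h6 : c * ‖x - m‖ ^ 2 ≤ c * r ^ 2 := by gcongr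
    have h7 : r * (∑ j, m j * p' j) ≤ r * (L * r) :=
      mul_le_mul_of_nonneg_left (by linarith) hr.le
    have h8 : r * (p' i - p i) ≤ r * ((2 * c + L) * r) := by linarith
    exact le_of_mul_le_mul_left h8 hr
  rcases (norm_nonneg (m - q)).eq_or_lt with h0 | hr
  · have hmq : m = q := sub_eq_zero.1 (norm_eq_zero.1 h0.symm)
    subst hmq
    -- two gradients at the same point agree, by the expansions towards the vertices
    have : ∀ {p p' : Fin d → ℝ}, IsSimplexGradient W c L m p → IsSimplexGradient W c L m p' → ∀ i,
        p' i ≤ p i := by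
      intro p p' hp hp' i
      refine le_of_forall_pos_le_add fun ε hε => ?_
      set r := min 1 (ε / (c + 1)) with hr
      have hr0 : 0 < r := by positivity
      have hr1 : r ≤ 1 := min_le_left _ _
      set x : Fin d → ℝ := (1 - r) • m + r • Pi.single i 1 with hx
      have hxS : x ∈ stdSimplex ℝ (Fin d) := convex_stdSimplex ℝ (Fin d) hm
        (single_mem_stdSimplex ℝ i) (sub_nonneg.2 hr1) hr0.le (by ring)
      have hxm : ‖x - m‖ ≤ r := by
        have : x - m = r • (Pi.single i 1 - m) := by rw [hx]; module
        rw [this, norm_smul, Real.norm_of_nonneg hr0.le]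
        have := stdSimplex_norm_sub_le (single_mem_stdSimplex ℝ i) hm
        nlinarith
      have e : ∀ y : Fin d → ℝ, ∑ j, x j * y j = (1 - r) * ∑ j, m j * y j + r * y i := by
        intro y
        simp [hx, add_mul, Finset.sum_add_distrib, Finset.mul_sum, mul_assoc, Pi.single_apply]
      have h1 := hp.upper x hxS
      rw [pairing hp, e, hp.sum_eq] at h1
      have h2 := hp'.lower x hxS
      rw [pairing hp', e, hp'.sum_eq] at h2
      have h6 : c * ‖x - m‖ ^ 2 ≤ c * r ^ 2 := by gcongr
      have h7 : c * r ≤ ε := by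
        have h8 := min_le_right 1 (ε / (c + 1))
        rw [← hr, le_div_iff₀ (by positivity)] at h8
        linarith
      have h9 := mul_le_mul_of_nonneg_left h7 hr0.le
      have h8 : r * p' i ≤ r * (p i + ε) := by linarith
      exact le_of_mul_le_mul_left h8 hr0
    have hpp : p = p' := funext fun i => le_antisymm (this hp' hp i) (this hp hp' i)
    simp [hpp]
  · rw [pi_norm_le_iff_of_nonneg (by positivity)]
    intro i
    rw [Pi.sub_apply, Real.norm_eq_abs, abs_le]
    have h1 := key hm hq hp hp' hr i
    have h2 := key hq hm hp' hp (by rwa [norm_sub_rev]) i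
    rw [norm_sub_rev] at h2
    constructor <;> linarith

/-! ### Semiconcavity of `C^{1,1}` functions -/

theorem IsC11OnWith.le_add {d : ℕ} {L : ℝ} {I : Set ℝ} {φ φt : ℝ → (Fin d → ℝ) → ℝ}
    {p : ℝ → (Fin d → ℝ) → (Fin d → ℝ)} (h : IsC11OnWith L I (stdSimplex ℝ (Fin d)) φ φt p)
    {t : ℝ} (ht : t ∈ I) {m q : Fin d → ℝ} (hm : m ∈ stdSimplex ℝ (Fin d))
    (hq : q ∈ stdSimplex ℝ (Fin d)) :
    φ t q ≤ φ t m + ∑ j, p t m j * (q j - m j) + d * |L| * ‖q - m‖ ^ 2 := by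
  let γ : ℝ → Fin d → ℝ := fun τ => m + τ • (q - m)
  have hγS : ∀ τ ∈ Icc (0 : ℝ) 1, γ τ ∈ stdSimplex ℝ (Fin d) := fun τ hτ => by
    have := convex_stdSimplex ℝ (Fin d) hm hq (sub_nonneg.2 hτ.2) hτ.1 (by ring)
    have e : γ τ = (1 - τ) • m + τ • q := by simp only [γ]; module
    rwa [e]
  have hder : ∀ τ ∈ Icc (0 : ℝ) 1, HasDerivWithinAt (fun τ => φ t (γ τ))
      (∑ j, p t (γ τ) j * (q j - m j)) (Icc 0 1) τ := by
    intro τ hτ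
    have h1 : HasDerivWithinAt (fun τ => (t, γ τ)) ((0 : ℝ), q - m) (Icc 0 1) τ := by
      have h2 : HasDerivAt γ (q - m) τ := by
        exact (((hasDerivAt_id τ).smul_const (q - m)).const_add m).congr_deriv (one_smul ℝ _)
      exact (hasDerivAt_const τ t).hasDerivWithinAt.prodMk h2.hasDerivWithinAt
    have h3 := (h.c1.hasDeriv t ht (γ τ) (hγS τ hτ)).comp_hasDerivWithinAt τ h1
      (show MapsTo (fun τ => (t, γ τ)) (Icc 0 1) (I ×ˢ stdSimplex ℝ (Fin d)) from
        fun x hx => ⟨ht, hγS x hx⟩)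
    rw [timeSpaceForm_apply] at h3
    simpa [Function.comp_def] using h3
  obtain ⟨ξ, hξ, hslope⟩ := exists_hasDerivAt_eq_slope (fun τ => φ t (γ τ))
    (fun τ => ∑ j, p t (γ τ) j * (q j - m j)) zero_lt_one
    (fun τ hτ => (hder τ hτ).continuousWithinAt)
    (fun τ hτ => (hder τ (Ioo_subset_Icc_self hτ)).hasDerivAt (Icc_mem_nhds hτ.1 hτ.2))
  have hξ' := Ioo_subset_Icc_self hξ
  have e1 : γ 1 = q := by simp [γ]
  have e0 : γ 0 = m := by simp [γ]
  simp only [e1, e0, sub_zero, div_one] at hslope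
  have h4 : ∑ j, p t (γ ξ) j * (q j - m j) - ∑ j, p t m j * (q j - m j) ≤
      d * |L| * ‖q - m‖ ^ 2 := by
    have h5 := (le_abs_self _).trans (abs_sum_mul_le (p t (γ ξ) - p t m) (q - m))
    simp only [Pi.sub_apply, sub_mul, Finset.sum_sub_distrib] at h5
    refine h5.trans ?_
    have h6 := h.lip_space t ht t ht (γ ξ) (hγS ξ hξ') m hm
    have h7 : ‖γ ξ - m‖ ≤ ‖q - m‖ := by
      simp only [γ, add_sub_cancel_left, norm_smul, Real.norm_of_nonneg hξ'.1]
      exact mul_le_of_le_one_left (norm_nonneg _) hξ'.2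
    rw [sub_self, abs_zero, zero_add] at h6
    have h8 : ‖p t (γ ξ) - p t m‖ ≤ |L| * ‖q - m‖ :=
      h6.trans (mul_le_mul (le_abs_self L) h7 (norm_nonneg _) (abs_nonneg _))
    calc (d : ℝ) * ‖p t (γ ξ) - p t m‖ * ‖q - m‖ ≤ d * (|L| * ‖q - m‖) * ‖q - m‖ := by gcongr
      _ = d * |L| * ‖q - m‖ ^ 2 := by ring
  linarith

theorem IsC11OnWith.mix_le {d : ℕ} {L : ℝ} {I : Set ℝ} {φ φt : ℝ → (Fin d → ℝ) → ℝ}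
    {p : ℝ → (Fin d → ℝ) → (Fin d → ℝ)} (h : IsC11OnWith L I (stdSimplex ℝ (Fin d)) φ φt p)
    {t : ℝ} (ht : t ∈ I) {m q : Fin d → ℝ} (hm : m ∈ stdSimplex ℝ (Fin d))
    (hq : q ∈ stdSimplex ℝ (Fin d)) {u w : ℝ} (hu : 0 ≤ u) (hw : 0 ≤ w) (huw : u + w = 1) :
    u * φ t m + w * φ t q ≤ φ t (u • m + w • q) + d * |L| * (u * w * ‖m - q‖ ^ 2) := by
  have hx := convex_stdSimplex ℝ (Fin d) hm hq hu hw huw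
  have h1 := h.le_add ht hx hm
  have h2 := h.le_add ht hx hq
  set x := u • m + w • q with hxdef
  have hu' : u = 1 - w := by linarith
  have e1 : m - x = w • (m - q) := by rw [hxdef, hu']; module
  have e2 : q - x = (-u) • (m - q) := by rw [hxdef, hu']; module
  have s1 : ∑ j, p t x j * (m j - x j) = w * ∑ j, p t x j * (m j - q j) := by
    rw [Finset.mul_sum]
    refine Finset.sum_congr rfl fun j _ => ?_
    have := congrFun e1 j
    simp only [Pi.sub_apply, Pi.smul_apply, smul_eq_mul] at this
    rw [this]; ring
  have s2 : ∑ j, p t x j * (q j - x j) = -u * ∑ j, p t x j * (m j - q j) := by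
    rw [Finset.mul_sum]
    refine Finset.sum_congr rfl fun j _ => ?_
    have := congrFun e2 j
    simp only [Pi.sub_apply, Pi.smul_apply, smul_eq_mul] at this
    rw [this]; ring
  rw [e1, norm_smul, Real.norm_of_nonneg hw, s1] at h1
  rw [e2, norm_smul, norm_neg, Real.norm_of_nonneg hu, s2] at h2
  have h3 := mul_le_mul_of_nonneg_left h1 hu
  have h4 := mul_le_mul_of_nonneg_left h2 hw
  have h5 : u * φ t x + w * φ t x = φ t x := by rw [← add_mul, huw, one_mul]
  have h6 : u * (d * |L| * (w * ‖m - q‖) ^ 2) + w * (d * |L| * (u * ‖m - q‖) ^ 2) =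
      (u + w) * (d * |L| * (u * w * ‖m - q‖ ^ 2)) := by ring
  rw [huw, one_mul] at h6
  linarith

/-! ### Convexity and semiconcavity of the value function -/

namespace MFCP

variable {d : ℕ} {P : MFCP d (Fin d → ℝ)} {M : ℝ} {K : Fin d → Finset (Fin d)}

theorem IsAdmissible.measurable_apply {t₀ : ℝ} {m : Fin d → ℝ} {α : ℝ → Fin d → Fin d → ℝ}
    {μ : ℝ → Fin d → ℝ} (h : P.IsAdmissible t₀ m α μ) (i : Fin d) :
    Measurable fun s : Icc t₀ P.T => μ s i :=
  ((continuous_apply i).comp h.continuousOn.domRestrict).measurable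

/-- In the variables `w_{i,j} = m_i a_{i,j}` the state equation is linear, so that convex combinations
of trajectories are trajectories; joint convexity of the running cost in `(w, m)` bounds the cost. -/
theorem AssumptionC.exists_mix (hP : P.AssumptionC M K) {t₀ : ℝ} (ht₀ : t₀ ∈ Icc 0 P.T)
    {m q : Fin d → ℝ} (hm : m ∈ intSimplex d) (hq : q ∈ intSimplex d)
    {α β : ℝ → Fin d → Fin d → ℝ} {μ ν : ℝ → Fin d → ℝ} (hμ : P.IsAdmissible t₀ m α μ)
    (hν : P.IsAdmissible t₀ q β ν) {u w : ℝ} (hu : 0 ≤ u) (hw : 0 ≤ w) (huw : u + w = 1) :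
    ∃ γ, P.IsAdmissible t₀ (u • m + w • q) γ (fun s => u • μ s + w • ν s) ∧
      P.J t₀ γ (fun s => u • μ s + w • ν s) ≤ u * P.J t₀ α μ + w * P.J t₀ β ν := by
  have hB := hP.toB
  have hA := hB.toA
  have hS := convex_stdSimplex ℝ (Fin d)
  have hIcc : ∀ s ∈ Icc t₀ P.T, s ∈ Icc 0 P.T := fun s hs => ⟨ht₀.1.trans hs.1, hs.2⟩
  have hTmem : P.T ∈ Icc t₀ P.T := ⟨ht₀.2, le_rfl⟩
  have h0mem : t₀ ∈ Icc t₀ P.T := ⟨le_rfl, ht₀.2⟩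
  have hμpos : ∀ s ∈ Icc t₀ P.T, ∀ i, 0 < μ s i := fun s hs i => hμ.pos hA ht₀.1 hs (hm.1 i)
  have hνpos : ∀ s ∈ Icc t₀ P.T, ∀ i, 0 < ν s i := fun s hs i => hν.pos hA ht₀.1 hs (hq.1 i)
  have hπpos : ∀ s ∈ Icc t₀ P.T, ∀ i, 0 < u * μ s i + w * ν s i := by
    intro s hs i
    have h1 := hμpos s hs i
    have h2 := hνpos s hs i
    rcases hu.eq_or_lt with rfl | hu'
    · have : w = 1 := by linarith
      subst this; linarith
    · have := mul_pos hu' h1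
      have := mul_nonneg hw h2.le
      linarith
  let γ : ℝ → Fin d → Fin d → ℝ := fun s i j =>
    (u * (μ s i * α s i j) + w * (ν s i * β s i j)) / (u * μ s i + w * ν s i)
  have hbox : ∀ {a : Fin d → ℝ}, a ∈ P.A → ∀ j, 0 ≤ a j ∧ a j ≤ M := by
    intro a ha j
    rw [hB.A_eq] at ha
    exact ⟨ha.1 j, ha.2 j⟩
  have hγA : ∀ s ∈ Icc t₀ P.T, ∀ i, γ s i ∈ P.A := by
    intro s hs i
    rw [hB.A_eq]
    have h1 := fun j => hbox (hμ.mem_A s hs i) j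
    have h2 := fun j => hbox (hν.mem_A s hs i) j
    have h3 := mul_nonneg hu (hμpos s hs i).le
    have h4 := mul_nonneg hw (hνpos s hs i).le
    refine ⟨fun j => div_nonneg ?_ (hπpos s hs i).le, fun j => (div_le_iff₀ (hπpos s hs i)).2 ?_⟩
    · have := mul_nonneg h3 (h1 j).1
      have := mul_nonneg h4 (h2 j).1
      linarith
    · have := mul_le_mul_of_nonneg_left (h1 j).2 h3
      have := mul_le_mul_of_nonneg_left (h2 j).2 h4
      linarith
  have hπγ : ∀ s ∈ Icc t₀ P.T, ∀ i j, (u * μ s i + w * ν s i) * γ s i j =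
      u * (μ s i * α s i j) + w * (ν s i * β s i j) := fun s hs i j =>
    mul_div_cancel₀ _ (hπpos s hs i).ne'
  have hπS : ∀ s ∈ Icc t₀ P.T, u • μ s + w • ν s ∈ stdSimplex ℝ (Fin d) := fun s hs =>
    hS (hμ.mem_simplex s hs) (hν.mem_simplex s hs) hu hw huw
  have hdrift : ∀ s ∈ Icc t₀ P.T, ∀ i, P.drift s (γ s) (u • μ s + w • ν s) i =
      u * P.drift s (α s) (μ s) i + w * P.drift s (β s) (ν s) i := by
    intro s hs i
    rw [hB.drift_eq (hIcc s hs) (hγA s hs) (hπS s hs),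
      hB.drift_eq (hIcc s hs) (hμ.mem_A s hs) (hμ.mem_simplex s hs),
      hB.drift_eq (hIcc s hs) (hν.mem_A s hs) (hν.mem_simplex s hs),
      Finset.mul_sum, Finset.mul_sum, ← Finset.sum_add_distrib]
    refine Finset.sum_congr rfl fun j _ => ?_
    simp only [Pi.add_apply, Pi.smul_apply, smul_eq_mul]
    rw [hπγ s hs, hπγ s hs]
    ring
  have hadm : P.IsAdmissible t₀ (u • m + w • q) γ (fun s => u • μ s + w • ν s) := by
    refine ⟨fun i => ?_, hγA, hπS, ?_, fun s hs i => ?_⟩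
    · refine measurable_pi_iff.2 fun j => ?_
      have h1 := hμ.measurable_apply i
      have h2 := hν.measurable_apply i
      have h3 := measurable_pi_iff.1 (hμ.measurable i) j
      have h4 := measurable_pi_iff.1 (hν.measurable i) j
      exact (((h1.mul h3).const_mul u).add ((h2.mul h4).const_mul w)).div
        ((h1.const_mul u).add (h2.const_mul w))
    · exact (hμ.continuousOn.const_smul u).add (hν.continuousOn.const_smul w)
    · have e : ∫ r in t₀..s, P.drift r (γ r) (u • μ r + w • ν r) i =
          ∫ r in t₀..s, (u * P.drift r (α r) (μ r) i + w * P.drift r (β r) (ν r) i) := by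
        refine integral_congr_uIoc fun r hr => ?_
        rw [uIoc_of_le hs.1] at hr
        exact hdrift r ⟨hr.1.le, hr.2.trans hs.2⟩ i
      rw [e, intervalIntegral.integral_add
        ((hμ.intervalIntegrable_drift hA ht₀.1 h0mem hs i).const_mul u)
        ((hν.intervalIntegrable_drift hA ht₀.1 h0mem hs i).const_mul w),
        intervalIntegral.integral_const_mul, intervalIntegral.integral_const_mul]
      simp only [Pi.add_apply, Pi.smul_apply, smul_eq_mul]
      rw [hμ.state_eq s hs i, hν.state_eq s hs i]
      ring
  refine ⟨γ, hadm, ?_⟩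
  have hint : ∀ s ∈ Icc t₀ P.T, u • μ s + w • ν s ∈ intSimplex d := fun s hs =>
    ⟨fun i => hπpos s hs i, (hπS s hs).2⟩
  have hF : ∀ s ∈ Icc t₀ P.T, P.F s (γ s) (u • μ s + w • ν s) ≤
      u * P.F s (α s) (μ s) + w * P.F s (β s) (ν s) := by
    intro s hs
    have mem : ∀ {a : Fin d → Fin d → ℝ} {x : Fin d → ℝ}, (∀ i, a i ∈ P.A) → (∀ i, 0 < x i) →
        x ∈ stdSimplex ℝ (Fin d) → ((fun i j => x i * a i j, x) : (Fin d → Fin d → ℝ) × (Fin d → ℝ)) ∈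
        {q : (Fin d → Fin d → ℝ) × (Fin d → ℝ) |
          q.2 ∈ intSimplex d ∧ ∀ i j, 0 ≤ q.1 i j ∧ q.1 i j ≤ M * q.2 i} := by
      intro a x ha hx hxS
      refine ⟨⟨hx, hxS.2⟩, fun i j => ⟨mul_nonneg (hx i).le (hbox (ha i) j).1, ?_⟩⟩
      have := mul_le_mul_of_nonneg_left (hbox (ha i) j).2 (hx i).le
      dsimp only
      linarith
    have val : ∀ {a : Fin d → Fin d → ℝ} {x : Fin d → ℝ}, (∀ i, 0 < x i) →
        ∑ i, x i * P.f i s (fun j => x i * a i j / x i) x = P.F s a x := by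
      intro a x hx
      refine Finset.sum_congr rfl fun i _ => ?_
      congr 2
      exact funext fun j => mul_div_cancel_left₀ _ (hx i).ne'
    have h := (hP.F_convex s (hIcc s hs)).2
      (mem (hμ.mem_A s hs) (hμpos s hs) (hμ.mem_simplex s hs))
      (mem (hν.mem_A s hs) (hνpos s hs) (hν.mem_simplex s hs)) hu hw huw
    simp only [smul_eq_mul] at h
    rw [val (hμpos s hs), val (hνpos s hs)] at h
    exact h
  have hJ := intervalIntegral.integral_mono_on ht₀.2
    (hadm.intervalIntegrable_F hA ht₀.1 h0mem hTmem)
    (((hμ.intervalIntegrable_F hA ht₀.1 h0mem hTmem).const_mul u).add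
      ((hν.intervalIntegrable_F hA ht₀.1 h0mem hTmem).const_mul w)) hF
  rw [intervalIntegral.integral_add
        ((hμ.intervalIntegrable_F hA ht₀.1 h0mem hTmem).const_mul u)
        ((hν.intervalIntegrable_F hA ht₀.1 h0mem hTmem).const_mul w),
        intervalIntegral.integral_const_mul, intervalIntegral.integral_const_mul] at hJ
  have hG := hP.G_convex.2 (hμ.mem_simplex _ hTmem) (hν.mem_simplex _ hTmem) hu hw huw
  simp only [smul_eq_mul] at hG
  simp only [J]
  linarith

theorem AssumptionC.convexOn_V (hP : P.AssumptionC M K) {t : ℝ} (ht : t ∈ Icc 0 P.T) :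
    ConvexOn ℝ (stdSimplex ℝ (Fin d)) (P.V t) := by
  have hA := hP.toB.toA
  have hint : ∀ m ∈ intSimplex d, ∀ q ∈ intSimplex d, ∀ u w : ℝ, 0 ≤ u → 0 ≤ w → u + w = 1 →
      P.V t (u • m + w • q) ≤ u * P.V t m + w * P.V t q := by
    intro m hm q hq u w hu hw huw
    refine le_of_forall_pos_le_add fun ε hε => ?_
    obtain ⟨α, μ, hμ, hμJ⟩ := hA.exists_J_lt ht (intSimplex_subset hm) hε
    obtain ⟨β, ν, hν, hνJ⟩ := hA.exists_J_lt ht (intSimplex_subset hq) hε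
    obtain ⟨γ, hγ, hγJ⟩ := hP.exists_mix ht hm hq hμ hν hu hw huw
    have h1 := hγ.V_le hA ht
    have h2 := mul_le_mul_of_nonneg_left hμJ.le hu
    have h3 := mul_le_mul_of_nonneg_left hνJ.le hw
    have h4 : u * ε + w * ε = ε := by rw [← add_mul, huw, one_mul]
    linarith
  refine ⟨convex_stdSimplex ℝ (Fin d), fun m hm q hq u w hu hw huw => ?_⟩
  have hx := convex_stdSimplex ℝ (Fin d) hm hq hu hw huw
  have hlim : ∀ y ∈ stdSimplex ℝ (Fin d),
      Tendsto (fun τ : ℝ => P.V t fun i => (1 - τ) * y i + τ * (d : ℝ)⁻¹) (𝓝[>] 0) (𝓝 (P.V t y)) := by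
    intro y hy
    have hc : ContinuousOn (P.V t) (stdSimplex ℝ (Fin d)) :=
      hA.continuousOn_V.comp (f := fun z => (t, z)) (by fun_prop) fun z hz => ⟨ht, hz⟩
    refine (hc y hy).tendsto.comp (tendsto_nhdsWithin_iff.2 ⟨tendsto_mix y, ?_⟩)
    filter_upwards [eventually_mix_mem_intSimplex hy] with τ hτ using intSimplex_subset hτ
  refine le_of_tendsto_of_tendsto (hlim _ hx)
    (((hlim m hm).const_mul u).add ((hlim q hq).const_mul w)) ?_
  filter_upwards [eventually_mix_mem_intSimplex hm, eventually_mix_mem_intSimplex hq] with τ h1 h2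
  have h := hint _ h1 _ h2 u w hu hw huw
  refine le_trans (le_of_eq ?_) h
  congr 1
  ext i
  simp only [Pi.add_apply, Pi.smul_apply, smul_eq_mul]
  linear_combination -(τ * (d : ℝ)⁻¹) * huw

/-- For a fixed control the state equation is linear in the state, so that the cost is as semiconcave
in the initial condition as `F` and `G` are in `m`. -/
theorem AssumptionC.exists_concaveOn_V (hP : P.AssumptionC M K) :
    ∃ c, 0 ≤ c ∧ ∀ t ∈ Icc 0 P.T,
      ConcaveOn ℝ (stdSimplex ℝ (Fin d)) fun m => P.V t m - c * ∑ i, m i ^ 2 := by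
  have hB := hP.toB
  have hA := hB.toA
  have hS := convex_stdSimplex ℝ (Fin d)
  obtain ⟨C, hC⟩ := hA.exists_bounds
  obtain ⟨L, hL⟩ := hP.F_C11
  obtain ⟨L', Gt, pG, hG⟩ := hP.G_C11
  set E := Real.exp (C * P.T) with hE
  have hT := hA.T_pos
  refine ⟨d * (|L| * P.T + |L'|) * E ^ 2, by positivity, fun t ht => ⟨hS, ?_⟩⟩
  intro m hm q hq u w hu hw huw
  have hx := hS hm hq hu hw huw
  have hIcc : ∀ s ∈ Icc t P.T, s ∈ Icc 0 P.T := fun s hs => ⟨ht.1.trans hs.1, hs.2⟩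
  have hTmem : P.T ∈ Icc t P.T := ⟨ht.2, le_rfl⟩
  have h0mem : t ∈ Icc t P.T := ⟨le_rfl, ht.2⟩
  have huw0 : 0 ≤ u * w := mul_nonneg hu hw
  set k := d * (|L| * P.T + |L'|) * E ^ 2 with hk
  have key : u * P.V t m + w * P.V t q ≤ P.V t (u • m + w • q) + k * (u * w * ‖m - q‖ ^ 2) := by
    refine le_of_forall_pos_le_add fun ε hε => ?_
    obtain ⟨α, π, hπ, hπJ⟩ := hA.exists_J_lt ht hx hε
    obtain ⟨μ, hμ⟩ := hA.exists_isAdmissible ht hm hπ.measurable hπ.mem_A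
    obtain ⟨ν, hν⟩ := hA.exists_isAdmissible ht hq hπ.measurable hπ.mem_A
    have hyS : ∀ s ∈ Icc t P.T, u • μ s + w • ν s ∈ stdSimplex ℝ (Fin d) := fun s hs =>
      hS (hμ.mem_simplex s hs) (hν.mem_simplex s hs) hu hw huw
    have hadm : P.IsAdmissible t (u • m + w • q) α (fun s => u • μ s + w • ν s) := by
      refine ⟨hπ.measurable, hπ.mem_A, hyS, ?_, fun s hs i => ?_⟩
      · exact (hμ.continuousOn.const_smul u).add (hν.continuousOn.const_smul w)
      · have e : ∫ r in t..s, P.drift r (α r) (u • μ r + w • ν r) i =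
            ∫ r in t..s, (u * P.drift r (α r) (μ r) i + w * P.drift r (α r) (ν r) i) := by
          refine integral_congr_uIoc fun r hr => ?_
          rw [uIoc_of_le hs.1] at hr
          have hr' : r ∈ Icc t P.T := ⟨hr.1.le, hr.2.trans hs.2⟩
          simp only [hB.drift_eq (hIcc r hr') (hπ.mem_A r hr') (hyS r hr'),
            hB.drift_eq (hIcc r hr') (hπ.mem_A r hr') (hμ.mem_simplex r hr'),
            hB.drift_eq (hIcc r hr') (hπ.mem_A r hr') (hν.mem_simplex r hr'),
            Finset.mul_sum, ← Finset.sum_add_distrib]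
          refine Finset.sum_congr rfl fun j _ => ?_
          simp only [Pi.add_apply, Pi.smul_apply, smul_eq_mul]
          ring
        rw [e, intervalIntegral.integral_add
          ((hμ.intervalIntegrable_drift hA ht.1 h0mem hs i).const_mul u)
          ((hν.intervalIntegrable_drift hA ht.1 h0mem hs i).const_mul w),
          intervalIntegral.integral_const_mul, intervalIntegral.integral_const_mul]
        simp only [Pi.add_apply, Pi.smul_apply, smul_eq_mul]
        rw [hμ.state_eq s hs i, hν.state_eq s hs i]
        ring
    -- the trajectory is determined by the control
    have heq : ∀ s ∈ Icc t P.T, u • μ s + w • ν s = π s := by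
      intro s hs
      have := hadm.norm_sub_le_mul hπ hA hC ht.1 hs
      rw [sub_self, norm_zero, mul_zero] at this
      exact sub_eq_zero.1 (norm_le_zero_iff.1 this)
    have hdist : ∀ s ∈ Icc t P.T, ‖μ s - ν s‖ ^ 2 ≤ E ^ 2 * ‖m - q‖ ^ 2 := by
      intro s hs
      rw [← mul_pow]
      exact pow_le_pow_left₀ (norm_nonneg _) (hμ.norm_sub_le_mul hν hA hC ht.1 hs) 2
    have hFle : ∀ s ∈ Icc t P.T, u * P.F s (α s) (μ s) + w * P.F s (α s) (ν s) ≤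
        P.F s (α s) (π s) + d * |L| * (u * w * (E ^ 2 * ‖m - q‖ ^ 2)) := by
      intro s hs
      obtain ⟨Ft, p, hF⟩ := hL (α s) (hπ.mem_A s hs)
      have h1 := hF.mix_le (hIcc s hs) (hμ.mem_simplex s hs) (hν.mem_simplex s hs) hu hw huw
      rw [heq s hs] at h1
      have h2 : (d : ℝ) * |L| * (u * w * ‖μ s - ν s‖ ^ 2) ≤
          d * |L| * (u * w * (E ^ 2 * ‖m - q‖ ^ 2)) := by
        gcongr
        exact hdist s hs
      linarith
    have hGle := hG.mix_le ht (hμ.mem_simplex _ hTmem) (hν.mem_simplex _ hTmem) hu hw huw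
    rw [heq _ hTmem] at hGle
    have hG2 : (d : ℝ) * |L'| * (u * w * ‖μ P.T - ν P.T‖ ^ 2) ≤
          d * |L'| * (u * w * (E ^ 2 * ‖m - q‖ ^ 2)) := by
      gcongr
      exact hdist _ hTmem
    have iμ := (hμ.intervalIntegrable_F hA ht.1 h0mem hTmem).const_mul u
    have iν := (hν.intervalIntegrable_F hA ht.1 h0mem hTmem).const_mul w
    have iπ := hπ.intervalIntegrable_F hA ht.1 h0mem hTmem
    have hI := intervalIntegral.integral_mono_on ht.2 (iμ.add iν)
      (iπ.add intervalIntegrable_const) hFle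
    rw [intervalIntegral.integral_add iμ iν, intervalIntegral.integral_add iπ
      intervalIntegrable_const, intervalIntegral.integral_const_mul,
      intervalIntegral.integral_const_mul, intervalIntegral.integral_const, smul_eq_mul] at hI
    have h1 := mul_le_mul_of_nonneg_left (hμ.V_le hA ht) hu
    have h2 := mul_le_mul_of_nonneg_left (hν.V_le hA ht) hw
    simp only [J] at h1 h2 hπJ
    have h3 : (P.T - t) * (d * |L| * (u * w * (E ^ 2 * ‖m - q‖ ^ 2))) ≤
        P.T * (d * |L| * (u * w * (E ^ 2 * ‖m - q‖ ^ 2))) := by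
      have := ht.1
      gcongr
      linarith
    have h4 : k * (u * w * ‖m - q‖ ^ 2) = P.T * (d * |L| * (u * w * (E ^ 2 * ‖m - q‖ ^ 2))) +
        d * |L'| * (u * w * (E ^ 2 * ‖m - q‖ ^ 2)) := by
      rw [hk]; ring
    linarith
  have h1 := sum_mix_sq m q huw
  have h2 := norm_sq_le_sum_sq (m - q)
  simp only [Pi.sub_apply] at h2
  have h3 : k * (u * w * ‖m - q‖ ^ 2) ≤ k * (u * w * ∑ i, (m i - q i) ^ 2) := by gcongr
  rw [← h1] at h3
  simp only [smul_eq_mul]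
  linarith

end MFCP

/-! ### Regularity of the value function under Assumption C -/

namespace MFCP

variable {d : ℕ} {P : MFCP d (Fin d → ℝ)} {M : ℝ} {K : Fin d → Finset (Fin d)}

/-- `p` is the (normalized) gradient of the value function, which is `L`-Lipschitz, convex and
`c`-semiconcave in space. -/
structure IsGradientField (P : MFCP d (Fin d → ℝ)) (c L : ℝ)
    (p : ℝ → (Fin d → ℝ) → (Fin d → ℝ)) : Prop where
  c_nonneg : 0 ≤ c
  L_nonneg : 0 ≤ L
  grad : ∀ t ∈ Icc 0 P.T, ∀ m ∈ stdSimplex ℝ (Fin d), IsSimplexGradient (P.V t) c L m (p t m)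
  lip : ∀ t ∈ Icc 0 P.T, ∀ m ∈ stdSimplex ℝ (Fin d), ∀ q ∈ stdSimplex ℝ (Fin d),
    |P.V t m - P.V t q| ≤ L * ‖m - q‖

theorem AssumptionC.exists_isGradientField (hP : P.AssumptionC M K) :
    ∃ c L p, P.IsGradientField c L p := by
  obtain ⟨c, hc, hconc⟩ := hP.exists_concaveOn_V
  obtain ⟨L, hL, hlip⟩ := hP.toB.toA.V_lipschitz
  have hlip' : ∀ t ∈ Icc 0 P.T, ∀ m ∈ stdSimplex ℝ (Fin d), ∀ q ∈ stdSimplex ℝ (Fin d),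
      |P.V t m - P.V t q| ≤ L * ‖m - q‖ := fun t ht m hm q hq => by
    simpa using hlip t ht t ht m hm q hq
  have h : ∀ t m, ∃ p, t ∈ Icc 0 P.T → m ∈ stdSimplex ℝ (Fin d) →
      IsSimplexGradient (P.V t) (c * d) L m p := by
    intro t m
    by_cases ht : t ∈ Icc 0 P.T
    · by_cases hm : m ∈ stdSimplex ℝ (Fin d)
      · obtain ⟨p, hp⟩ :=
          exists_isSimplexGradient hc hL (hP.convexOn_V ht) (hconc t ht) (hlip' t ht) hm
        exact ⟨p, fun _ _ => hp⟩
      · exact ⟨0, fun _ h => absurd h hm⟩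
    · exact ⟨0, fun h => absurd h ht⟩
  choose p hp using h
  exact ⟨c * d, L, p, by positivity, hL, fun t ht m hm => hp t m ht hm, hlip'⟩

namespace IsGradientField

variable {c L : ℝ} {p : ℝ → (Fin d → ℝ) → (Fin d → ℝ)}

theorem norm_sub_le (h : P.IsGradientField c L p) {t : ℝ} (ht : t ∈ Icc 0 P.T) {m q : Fin d → ℝ}
    (hm : m ∈ stdSimplex ℝ (Fin d)) (hq : q ∈ stdSimplex ℝ (Fin d)) :
    ‖p t m - p t q‖ ≤ (2 * c + L) * ‖m - q‖ :=
  (h.grad t ht m hm).norm_sub_le (h.lip t ht) h.c_nonneg hm hq (h.grad t ht q hq)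

/-- Run an optimal control for `(t, m)` from the nearby initial conditions `(t, q)`: the dynamic
programming principle compares the variations of `V(t, ·)` around `m` and of `V(s, ·)` around the
position at time `s`. -/
theorem sum_sub_mul_le (h : P.IsGradientField c L p) (hB : P.AssumptionB M K) {C : ℝ}
    (hC : P.Bounds C) {t s : ℝ} (ht : 0 ≤ t) (hts : t ≤ s) (hs : s ≤ P.T) {m q : Fin d → ℝ}
    (hm : m ∈ stdSimplex ℝ (Fin d)) (hq : q ∈ stdSimplex ℝ (Fin d)) :
    ∑ i, (p t m i - p s m i) * (q i - m i) ≤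
      Real.exp (C * P.T) * C * (1 + d * (2 * c + L) + d * L) * (s - t) * ‖q - m‖ +
        c * Real.exp (C * P.T) ^ 2 * ‖q - m‖ ^ 2 := by
  have hA := hB.toA
  have htI : t ∈ Icc 0 P.T := ⟨ht, hts.trans hs⟩
  have hsI : s ∈ Icc 0 P.T := ⟨ht.trans hts, hs⟩
  have hst : s ∈ Icc t P.T := ⟨hts, hs⟩
  have h0 : t ∈ Icc t P.T := ⟨le_rfl, htI.2⟩
  have hC0 := hC.pos
  have hc := h.c_nonneg
  have hL := h.L_nonneg
  set E := Real.exp (C * P.T) with hE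
  obtain ⟨α, μ, hμ, hJ⟩ := hB.exists_isOptimal htI hm
  obtain ⟨ν, hν⟩ := hA.exists_isAdmissible htI hq hμ.measurable hμ.mem_A
  have hr : ∀ r ∈ Icc t s, r ∈ Icc t P.T := fun r hr => ⟨hr.1, hr.2.trans hs⟩
  have hdist : ∀ r ∈ Icc t s, ‖ν r - μ r‖ ≤ E * ‖q - m‖ := fun r hr' =>
    hν.norm_sub_le_mul hμ hA hC ht (hr r hr')
  have h1 := hν.V_le_integral_add hst hA ht
  have h2 := hμ.integral_add_V_le hst hA ht
  rw [hJ] at h2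
  have iν := hν.intervalIntegrable_F hA ht h0 hst
  have iμ := hμ.intervalIntegrable_F hA ht h0 hst
  have h3 : (∫ r in t..s, P.F r (α r) (ν r)) - ∫ r in t..s, P.F r (α r) (μ r) ≤
      C * (E * ‖q - m‖) * (s - t) := by
    rw [← intervalIntegral.integral_sub iν iμ]
    have h4 := abs_integral_le_of_le (f := fun r => P.F r (α r) (ν r) - P.F r (α r) (μ r))
      (t₀ := t) (T := s) (C := C * (E * ‖q - m‖)) (fun r hr' => ?_) ⟨le_rfl, hts⟩ ⟨hts, le_rfl⟩
    · rw [abs_of_nonneg (sub_nonneg.2 hts)] at h4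
      exact (le_abs_self _).trans h4
    · have hr0 : r ∈ Icc 0 P.T := ⟨ht.trans hr'.1, hr'.2.trans hs⟩
      refine (hC.F_lip r hr0 r hr0 (α r) (hμ.mem_A r (hr r hr')) _ (hν.mem_simplex r (hr r hr')) _
        (hμ.mem_simplex r (hr r hr'))).trans ?_
      rw [sub_self, abs_zero, zero_add]
      exact mul_le_mul_of_nonneg_left (hdist r hr') hC0.le
  have hμs := hμ.mem_simplex s hst
  have hνs := hν.mem_simplex s hst
  have h5 := (h.grad s hsI _ hμs).upper _ hνs
  have h6 := (h.grad t htI _ hm).lower _ hq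
  have h7 : c * ‖ν s - μ s‖ ^ 2 ≤ c * E ^ 2 * ‖q - m‖ ^ 2 := by
    rw [mul_assoc, ← mul_pow]
    gcongr
    exact hdist s ⟨hts, le_rfl⟩
  have h8 : ∑ i, p s (μ s) i * (ν s i - μ s i) - ∑ i, p s m i * (ν s i - μ s i) ≤
      d * ((2 * c + L) * (C * (s - t))) * (E * ‖q - m‖) := by
    have h9 := (le_abs_self _).trans (abs_sum_mul_le (p s (μ s) - p s m) (ν s - μ s))
    simp only [Pi.sub_apply, sub_mul, Finset.sum_sub_distrib] at h9
    refine h9.trans ?_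
    have h10 := h.norm_sub_le hsI hμs hm
    have h11 := hμ.norm_sub_le hA hC ht h0 hst
    rw [hμ.start htI.2, abs_of_nonneg (sub_nonneg.2 hts)] at h11
    have h12 : ‖p s (μ s) - p s m‖ ≤ (2 * c + L) * (C * (s - t)) :=
      h10.trans (mul_le_mul_of_nonneg_left h11 (by positivity))
    have h13 := hdist s ⟨hts, le_rfl⟩
    gcongr
  have h14 : ∑ i, p s m i * (ν s i - μ s i) - ∑ i, p s m i * (q i - m i) ≤
      d * L * (C * (E * ‖q - m‖) * (s - t)) := by
    have h15 := (le_abs_self _).trans (abs_sum_mul_le (p s m) ((ν s - μ s) - (q - m)))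
    simp only [Pi.sub_apply, mul_sub, Finset.sum_sub_distrib] at h15
    have h16 : ‖(ν s - μ s) - (q - m)‖ ≤ C * (E * ‖q - m‖) * (s - t) := by
      have hst0 := sub_nonneg.2 hts
      rw [pi_norm_le_iff_of_nonneg (by positivity)]
      intro i
      have e : ((ν s - μ s) - (q - m)) i = ∫ r in t..s,
          (P.drift r (α r) (ν r) i - P.drift r (α r) (μ r) i) := by
        rw [intervalIntegral.integral_sub (hν.intervalIntegrable_drift hA ht h0 hst i)
          (hμ.intervalIntegrable_drift hA ht h0 hst i)]
        simp only [Pi.sub_apply]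
        rw [hν.state_eq s hst i, hμ.state_eq s hst i]
        ring
      rw [e, Real.norm_eq_abs, ← abs_of_nonneg hst0]
      refine abs_integral_le_of_le (t₀ := t) (T := s) (fun r hr' => ?_) ⟨le_rfl, hts⟩ ⟨hts, le_rfl⟩
      have hr0 : r ∈ Icc 0 P.T := ⟨ht.trans hr'.1, hr'.2.trans hs⟩
      have h17 := hC.drift_lip r hr0 r hr0 (α r) (hμ.mem_A r (hr r hr')) _
        (hν.mem_simplex r (hr r hr')) _ (hμ.mem_simplex r (hr r hr'))
      rw [sub_self, abs_zero, zero_add] at h17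
      have h18 := norm_le_pi_norm (P.drift r (α r) (ν r) - P.drift r (α r) (μ r)) i
      exact h18.trans (h17.trans (mul_le_mul_of_nonneg_left (hdist r hr') hC0.le))
    have h19 : (d : ℝ) * ‖p s m‖ * ‖(ν s - μ s) - (q - m)‖ ≤
        d * L * (C * (E * ‖q - m‖) * (s - t)) := by
      have := (h.grad s hsI m hm).norm_le
      gcongr
    simp only [mul_sub, Finset.sum_sub_distrib]
    linarith
  simp only [sub_mul, Finset.sum_sub_distrib]
  have h20 : E * C * (1 + d * (2 * c + L) + d * L) * (s - t) * ‖q - m‖ =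
      C * (E * ‖q - m‖) * (s - t) + d * ((2 * c + L) * (C * (s - t))) * (E * ‖q - m‖) +
        d * L * (C * (E * ‖q - m‖) * (s - t)) := by ring
  rw [h20]
  linarith

theorem exists_norm_sub_le_time (h : P.IsGradientField c L p) (hB : P.AssumptionB M K) :
    ∃ k, 0 ≤ k ∧ ∀ t ∈ Icc 0 P.T, ∀ s ∈ Icc 0 P.T, ∀ m ∈ stdSimplex ℝ (Fin d),
      ‖p t m - p s m‖ ≤ k * |t - s| := by
  have hA := hB.toA
  obtain ⟨C, hC⟩ := hA.exists_bounds
  have hC0 := hC.pos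
  have hc := h.c_nonneg
  have hL := h.L_nonneg
  set k := Real.exp (C * P.T) * C * (1 + d * (2 * c + L) + d * L) with hk
  have hk0 : 0 ≤ k := by positivity
  set k' := c * Real.exp (C * P.T) ^ 2 with hk'
  have hk'0 : 0 ≤ k' := by positivity
  have hint : ∀ t s, 0 ≤ t → t ≤ s → s ≤ P.T → ∀ m ∈ intSimplex d,
      ‖p t m - p s m‖ ≤ k * (s - t) := by
    intro t s ht hts hs m hm
    have hmS := intSimplex_subset hm
    have hst := sub_nonneg.2 hts
    have htI : t ∈ Icc 0 P.T := ⟨ht, hts.trans hs⟩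
    have hsI : s ∈ Icc 0 P.T := ⟨ht.trans hts, hs⟩
    have key := fun q hq => h.sum_sub_mul_le hB hC ht hts hs (m := m) (q := q) hmS hq
    rw [pi_norm_le_iff_of_nonneg (by positivity)]
    intro i
    -- test with the points `m ± τ (e_i - m)` of the simplex
    have main : ∀ σ : ℝ, |σ| = 1 → σ * (p t m i - p s m i) ≤ k * (s - t) := by
      intro σ hσ
      have hτ : ∀ τ : ℝ, 0 < τ → τ < m i →
          σ * (p t m i - p s m i) ≤ k * (s - t) + k' * τ := by
        intro τ hτ0 hτi
        have hσ' := abs_le.1 hσ.le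
        have hmi := stdSimplex_le_one hmS i
        obtain ⟨q, hqdef⟩ : ∃ q : Fin d → ℝ, q = m + (σ * τ) • (Pi.single i 1 - m) := ⟨_, rfl⟩
        have hq : q ∈ stdSimplex ℝ (Fin d) := by
          rw [hqdef]
          refine ⟨fun j => ?_, ?_⟩
          · simp only [Pi.add_apply, Pi.smul_apply, Pi.sub_apply, smul_eq_mul]
            have h1 := (hm.1 j).le
            have h2 : σ * τ ≤ 1 := by nlinarith
            by_cases hji : j = i
            · subst hji
              rw [Pi.single_eq_same]
              have h3 := mul_nonneg (mul_nonneg (sub_nonneg.2 hσ'.1) hτ0.le) (sub_nonneg.2 hmi)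
              have h4 := mul_nonneg hτ0.le h1
              linarith
            · rw [Pi.single_eq_of_ne hji]
              nlinarith
          · simp [Finset.sum_add_distrib, ← Finset.mul_sum, Finset.sum_sub_distrib, hm.2]
        have h1 := key _ hq
        have e1 : q - m = (σ * τ) • (Pi.single i 1 - m) := by
          rw [hqdef, add_sub_cancel_left]
        have hn : ‖q - m‖ ≤ τ := by
          rw [e1, norm_smul, norm_mul, Real.norm_eq_abs, hσ, one_mul,
            Real.norm_of_nonneg hτ0.le]
          have := stdSimplex_norm_sub_le (single_mem_stdSimplex ℝ i) hmS
          nlinarith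
        have e2 : ∑ j, (p t m j - p s m j) * (q j - m j) =
            τ * (σ * (p t m i - p s m i)) := by
          have hz : ∑ j, m j * (p t m j - p s m j) = 0 := by
            simp only [mul_sub, Finset.sum_sub_distrib]
            rw [(h.grad t htI m hmS).sum_eq, (h.grad s hsI m hmS).sum_eq, sub_zero]
          have : ∀ j, (p t m j - p s m j) * (q j - m j) =
              (σ * τ) * ((p t m j - p s m j) * (Pi.single i 1 : Fin d → ℝ) j) -
                (σ * τ) * (m j * (p t m j - p s m j)) := by
            intro j
            simp only [hqdef, Pi.add_apply, Pi.smul_apply, Pi.sub_apply, smul_eq_mul]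
            ring
          simp only [this, Finset.sum_sub_distrib, ← Finset.mul_sum, hz]
          simp [Pi.single_apply]
          ring
        rw [e2] at h1
        have h2 : k * (s - t) * ‖q - m‖ ≤ k * (s - t) * τ := by
          gcongr
        have h3 : k' * ‖q - m‖ ^ 2 ≤ k' * τ ^ 2 := by
          gcongr
        have h4 : τ * (σ * (p t m i - p s m i)) ≤ τ * (k * (s - t) + k' * τ) := by
          linarith
        exact le_of_mul_le_mul_left h4 hτ0
      have hlim : Tendsto (fun τ : ℝ => k * (s - t) + k' * τ) (𝓝[>] 0)
          (𝓝 (k * (s - t) + k' * 0)) :=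
        ((continuous_const.add (continuous_const.mul continuous_id)).tendsto 0).mono_left
          nhdsWithin_le_nhds
      rw [mul_zero, add_zero] at hlim
      refine ge_of_tendsto hlim ?_
      filter_upwards [Ioo_mem_nhdsGT (hm.1 i)] with τ hτ' using hτ τ hτ'.1 hτ'.2
    have h1 := main 1 (by simp)
    have h2 := main (-1) (by simp)
    rw [Pi.sub_apply, Real.norm_eq_abs, abs_le]
    constructor <;> linarith
  have hall : ∀ t s, 0 ≤ t → t ≤ s → s ≤ P.T → ∀ m ∈ stdSimplex ℝ (Fin d),
      ‖p t m - p s m‖ ≤ k * (s - t) := by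
    intro t s ht hts hs m hm
    have htI : t ∈ Icc 0 P.T := ⟨ht, hts.trans hs⟩
    have hsI : s ∈ Icc 0 P.T := ⟨ht.trans hts, hs⟩
    have hlim : ∀ r ∈ Icc 0 P.T,
        Tendsto (fun τ : ℝ => p r fun i => (1 - τ) * m i + τ * (d : ℝ)⁻¹) (𝓝[>] 0)
          (𝓝 (p r m)) := by
      intro r hr
      rw [tendsto_iff_norm_sub_tendsto_zero]
      have h1 := (tendsto_iff_norm_sub_tendsto_zero.1 (tendsto_mix m)).const_mul (2 * c + L)
      rw [mul_zero] at h1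
      refine squeeze_zero' (Eventually.of_forall fun _ => norm_nonneg _) ?_ h1
      filter_upwards [eventually_mix_mem_intSimplex hm] with τ hτ
      exact h.norm_sub_le hr (intSimplex_subset hτ) hm
    refine le_of_tendsto ((hlim t htI).sub (hlim s hsI)).norm ?_
    filter_upwards [eventually_mix_mem_intSimplex hm] with τ hτ using hint t s ht hts hs _ hτ
  refine ⟨k, hk0, fun t ht s hs m hm => ?_⟩
  rcases le_total t s with hts | hts
  · rw [abs_sub_comm, abs_of_nonneg (sub_nonneg.2 hts)]
    exact hall t s ht.1 hts hs.2 m hm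
  · rw [abs_of_nonneg (sub_nonneg.2 hts), norm_sub_rev]
    exact hall s t hs.1 hts ht.2 m hm

theorem exists_norm_sub_le (h : P.IsGradientField c L p) (hB : P.AssumptionB M K) :
    ∃ k, 0 ≤ k ∧ ∀ t ∈ Icc 0 P.T, ∀ s ∈ Icc 0 P.T, ∀ m ∈ stdSimplex ℝ (Fin d),
      ∀ q ∈ stdSimplex ℝ (Fin d), ‖p t m - p s q‖ ≤ k * (|t - s| + ‖m - q‖) := by
  obtain ⟨k, hk, htime⟩ := h.exists_norm_sub_le_time hB
  have hc := h.c_nonneg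
  have hL := h.L_nonneg
  refine ⟨k + (2 * c + L), by positivity, fun t ht s hs m hm q hq => ?_⟩
  have h1 := norm_sub_le_norm_sub_add_norm_sub (p t m) (p s m) (p s q)
  have h2 := htime t ht s hs m hm
  have h3 := h.norm_sub_le hs hm hq
  have h4 : 0 ≤ k * ‖m - q‖ := by positivity
  have h5 : 0 ≤ (2 * c + L) * |t - s| := by positivity
  linarith

/-- Second-order expansion of the value function in time: by dynamic programming the time derivative
is the Hamiltonian at the gradient. -/
theorem exists_abs_time_expansion_le (h : P.IsGradientField c L p) (hA : P.AssumptionA) {k : ℝ}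
    (hk : 0 ≤ k) (hp : ∀ t ∈ Icc 0 P.T, ∀ s ∈ Icc 0 P.T, ∀ m ∈ stdSimplex ℝ (Fin d),
      ∀ q ∈ stdSimplex ℝ (Fin d), ‖p t m - p s q‖ ≤ k * (|t - s| + ‖m - q‖)) :
    ∃ k', 0 ≤ k' ∧ ∀ t s, 0 ≤ t → t ≤ s → s ≤ P.T → ∀ m ∈ stdSimplex ℝ (Fin d),
      |P.V s m - P.V t m - (s - t) * P.totalH t m (p t m)| ≤ k' * (s - t) ^ 2 := by
  obtain ⟨C, hC⟩ := hA.exists_bounds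
  have hC0 := hC.pos
  have hc := h.c_nonneg
  have hL := h.L_nonneg
  set k₁ := d * k * C + (d * L + 1) * (C * (1 + C)) with hk₁
  have hk₁0 : 0 ≤ k₁ := by positivity
  refine ⟨k₁ + c * C ^ 2, by positivity, fun t s ht hts hs m hm => ?_⟩
  have htI : t ∈ Icc 0 P.T := ⟨ht, hts.trans hs⟩
  have hsI : s ∈ Icc 0 P.T := ⟨ht.trans hts, hs⟩
  have hst : s ∈ Icc t P.T := ⟨hts, hs⟩
  have h0 : t ∈ Icc t P.T := ⟨le_rfl, htI.2⟩
  have hst0 := sub_nonneg.2 hts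
  have hr : ∀ r ∈ Icc t s, r ∈ Icc t P.T := fun r hr => ⟨hr.1, hr.2.trans hs⟩
  -- along any trajectory, the integrand is close to its value at the initial point
  have hclose : ∀ {α μ}, P.IsAdmissible t m α μ → ∀ r ∈ Icc t s,
      |(∑ i, p s m i * P.drift r (α r) (μ r) i + P.F r (α r) (μ r)) -
        (∑ i, p t m i * P.drift t (α r) m i + P.F t (α r) m)| ≤ k₁ * (s - t) := by
    intro α μ hμ r hr'
    have hr0 : r ∈ Icc 0 P.T := ⟨ht.trans hr'.1, hr'.2.trans hs⟩
    have hαr := hμ.mem_A r (hr r hr')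
    have hμr := hμ.mem_simplex r (hr r hr')
    have hd : |r - t| + ‖μ r - m‖ ≤ (1 + C) * (s - t) := by
      have h1 := hμ.norm_sub_le hA hC ht h0 (hr r hr')
      rw [hμ.start htI.2] at h1
      have h2 : |r - t| ≤ s - t := by
        rw [abs_of_nonneg (sub_nonneg.2 hr'.1)]; linarith [hr'.2]
      have h3 : C * |r - t| ≤ C * (s - t) := by gcongr
      linarith
    have e1 := abs_sum_mul_le (p s m - p t m) (P.drift r (α r) (μ r))
    have e2 := abs_sum_mul_le (p t m) (P.drift r (α r) (μ r) - P.drift t (α r) m)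
    have e3 := hC.F_lip r hr0 t htI (α r) hαr _ hμr _ hm
    have e4 := hC.drift_lip r hr0 t htI (α r) hαr _ hμr _ hm
    have e5 := hC.drift_le r hr0 (α r) hαr _ hμr
    have e6 : ‖p s m - p t m‖ ≤ k * (s - t) := by
      have := hp s hsI t htI m hm m hm
      rwa [sub_self, norm_zero, add_zero, abs_of_nonneg hst0] at this
    have e7 := (h.grad t htI m hm).norm_le
    have f1 : (d : ℝ) * ‖p s m - p t m‖ * ‖P.drift r (α r) (μ r)‖ ≤ d * (k * (s - t)) * C := by
      gcongr
    have f2 : (d : ℝ) * ‖p t m‖ * ‖P.drift r (α r) (μ r) - P.drift t (α r) m‖ ≤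
        d * L * (C * ((1 + C) * (s - t))) := by
      have := e4.trans (mul_le_mul_of_nonneg_left hd hC0.le)
      gcongr
    have f3 := e3.trans (mul_le_mul_of_nonneg_left hd hC0.le)
    have f4 : (∑ i, p s m i * P.drift r (α r) (μ r) i + P.F r (α r) (μ r)) -
        (∑ i, p t m i * P.drift t (α r) m i + P.F t (α r) m) =
        ∑ i, (p s m - p t m) i * P.drift r (α r) (μ r) i +
        ∑ i, p t m i * (P.drift r (α r) (μ r) - P.drift t (α r) m) i +
        (P.F r (α r) (μ r) - P.F t (α r) m) := by
      simp only [Pi.sub_apply, sub_mul, mul_sub, Finset.sum_sub_distrib]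
      ring
    rw [f4]
    have f5 : k₁ * (s - t) = d * (k * (s - t)) * C + d * L * (C * ((1 + C) * (s - t))) +
        C * ((1 + C) * (s - t)) := by rw [hk₁]; ring
    rw [f5]
    refine (abs_add_le _ _).trans (add_le_add ((abs_add_le _ _).trans (add_le_add ?_ ?_)) f3)
    · exact e1.trans f1
    · exact e2.trans f2
  have hcost : ∀ {α μ}, P.IsAdmissible t m α μ →
      IntervalIntegrable (fun r => ∑ i, p s m i * P.drift r (α r) (μ r) i + P.F r (α r) (μ r))
        volume t s ∧
      ∑ i, p s m i * (μ s i - m i) + ∫ r in t..s, P.F r (α r) (μ r) =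
        ∫ r in t..s, (∑ i, p s m i * P.drift r (α r) (μ r) i + P.F r (α r) (μ r)) := by
    intro α μ hμ
    have hi : ∀ i ∈ Finset.univ, IntervalIntegrable (fun r => p s m i * P.drift r (α r) (μ r) i)
        volume t s := fun i _ => (hμ.intervalIntegrable_drift hA ht h0 hst i).const_mul _
    have hi' : IntervalIntegrable (fun r => ∑ i, p s m i * P.drift r (α r) (μ r) i)
        volume t s := by
      simpa [Finset.sum_fn] using IntervalIntegrable.sum Finset.univ hi
    have hF := hμ.intervalIntegrable_F hA ht h0 hst
    refine ⟨hi'.add hF, ?_⟩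
    rw [intervalIntegral.integral_add hi' hF, intervalIntegral.integral_finsetSum hi]
    congr 1
    refine Finset.sum_congr rfl fun i _ => ?_
    rw [intervalIntegral.integral_const_mul, hμ.state_eq s hst i, add_sub_cancel_left]
  have hgrad := h.grad s hsI m hm
  rw [abs_le]
  constructor
  · -- a constant control which is optimal for the Hamiltonian
    obtain ⟨a, ha, hHa⟩ := hA.exists_eq_totalH htI hm (p t m)
    obtain ⟨μ, hμ⟩ := hA.exists_isAdmissible_const htI hm ha
    have h1 := hμ.V_le_integral_add hst hA ht
    have h2 := hgrad.upper _ (hμ.mem_simplex s hst)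
    have h3 : c * ‖μ s - m‖ ^ 2 ≤ c * C ^ 2 * (s - t) ^ 2 := by
      have h4 := hμ.norm_sub_le hA hC ht h0 hst
      rw [hμ.start htI.2, abs_of_nonneg hst0] at h4
      rw [mul_assoc, ← mul_pow]
      gcongr
    obtain ⟨hi, he⟩ := hcost hμ
    have h5 := intervalIntegral.integral_mono_on hts hi
      (intervalIntegrable_const (c := -P.totalH t m (p t m) + k₁ * (s - t))) fun r hr' => by
        have := (abs_le.1 (hclose hμ r hr')).2
        linarith
    rw [intervalIntegral.integral_const, smul_eq_mul] at h5
    linarith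
  · have h1 : ∀ ε, 0 < ε → P.V s m - P.V t m - (s - t) * P.totalH t m (p t m) ≤
        k₁ * (s - t) ^ 2 + ε := by
      intro ε hε
      obtain ⟨α, μ, hμ, hJ⟩ := hA.exists_J_lt htI hm hε
      have h1 := hμ.integral_add_V_le hst hA ht
      have h2 := hgrad.lower _ (hμ.mem_simplex s hst)
      obtain ⟨hi, he⟩ := hcost hμ
      have h5 := intervalIntegral.integral_mono_on hts
        (intervalIntegrable_const (c := -P.totalH t m (p t m) - k₁ * (s - t))) hi fun r hr' => by
          have h6 := (abs_le.1 (hclose hμ r hr')).1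
          have h7 := hA.le_totalH htI hm (p t m) (hμ.mem_A r (hr r hr'))
          linarith
      rw [intervalIntegral.integral_const, smul_eq_mul] at h5
      linarith
    have h2 := le_of_forall_pos_le_add h1
    have h3 : 0 ≤ c * C ^ 2 * (s - t) ^ 2 := by positivity
    linarith

/-- The value function is of class `C^{1,1}`, and its time derivative is the Hamiltonian at its
gradient. -/
theorem isC11OnWith (h : P.IsGradientField c L p) (hB : P.AssumptionB M K) :
    ∃ L', IsC11OnWith L' (Icc 0 P.T) (stdSimplex ℝ (Fin d)) P.V
      (fun t m => P.totalH t m (p t m)) p := by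
  have hA := hB.toA
  obtain ⟨C, hC⟩ := hA.exists_bounds
  have hC0 := hC.pos
  have hc := h.c_nonneg
  have hL := h.L_nonneg
  obtain ⟨k, hk, hp⟩ := h.exists_norm_sub_le hB
  obtain ⟨k', hk', hexp⟩ := h.exists_abs_time_expansion_le hA hk hp
  set k₂ := C * (1 + d * L) + d * C * k with hk₂
  have hk₂0 : 0 ≤ k₂ := by positivity
  have hH : ∀ t ∈ Icc 0 P.T, ∀ s ∈ Icc 0 P.T, ∀ m ∈ stdSimplex ℝ (Fin d),
      ∀ q ∈ stdSimplex ℝ (Fin d), |P.totalH t m (p t m) - P.totalH s q (p s q)| ≤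
        k₂ * (|t - s| + ‖m - q‖) := by
    intro t ht s hs m hm q hq
    have h1 := hA.abs_totalH_sub_le hC ht hs hm hq (h.grad t ht m hm).norm_le
      (h.grad s hs q hq).norm_le
    have h2 : d * C * ‖p t m - p s q‖ ≤ d * C * (k * (|t - s| + ‖m - q‖)) := by
      have := hp t ht s hs m hm q hq
      gcongr
    have h3 : k₂ * (|t - s| + ‖m - q‖) = C * (1 + d * L) * (|t - s| + ‖m - q‖) +
        d * C * (k * (|t - s| + ‖m - q‖)) := by rw [hk₂]; ring
    linarith
  -- the expansion in time, in both directions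
  have hexp' : ∀ t ∈ Icc 0 P.T, ∀ s ∈ Icc 0 P.T, ∀ m ∈ stdSimplex ℝ (Fin d),
      |P.V s m - P.V t m - (s - t) * P.totalH t m (p t m)| ≤ (k' + k₂) * (s - t) ^ 2 := by
    intro t ht s hs m hm
    have h0 : 0 ≤ k₂ * (s - t) ^ 2 := by positivity
    rcases le_total t s with hts | hts
    · have := hexp t s ht.1 hts hs.2 m hm
      linarith
    · have h1 := hexp s t hs.1 hts ht.2 m hm
      have h2 := hH t ht s hs m hm m hm
      rw [sub_self, norm_zero, add_zero] at h2
      have e : P.V s m - P.V t m - (s - t) * P.totalH t m (p t m) =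
          -(P.V t m - P.V s m - (t - s) * P.totalH s m (p s m)) +
            (t - s) * (P.totalH t m (p t m) - P.totalH s m (p s m)) := by ring
      rw [e]
      refine (abs_add_le _ _).trans ?_
      rw [abs_neg, abs_mul]
      have h3 : |t - s| * |P.totalH t m (p t m) - P.totalH s m (p s m)| ≤
          |t - s| * (k₂ * |t - s|) := by gcongr
      have h4 : |t - s| * (k₂ * |t - s|) = k₂ * (s - t) ^ 2 := by
        rw [← sq_abs (s - t), abs_sub_comm s t]; ring
      have h5 : (t - s) ^ 2 = (s - t) ^ 2 := by ring
      rw [h5] at h1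
      linarith
  have hquad : ∀ t ∈ Icc 0 P.T, ∀ s ∈ Icc 0 P.T, ∀ m ∈ stdSimplex ℝ (Fin d),
      ∀ q ∈ stdSimplex ℝ (Fin d),
      |P.V s q - P.V t m - (P.totalH t m (p t m) * (s - t) + ∑ i, p t m i * (q i - m i))| ≤
        (k' + 2 * k₂ + c) * (max |s - t| ‖q - m‖) ^ 2 := by
    intro t ht s hs m hm q hq
    set D := max |s - t| ‖q - m‖ with hD
    have d1 : |s - t| ≤ D := le_max_left _ _
    have d2 : ‖q - m‖ ≤ D := le_max_right _ _
    have hD0 : 0 ≤ D := (abs_nonneg _).trans d1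
    have h1 := hexp' t ht s hs q hq
    have h2 := hH t ht t ht q hq m hm
    rw [sub_self, abs_zero, zero_add] at h2
    have h3 := (h.grad t ht m hm).lower q hq
    have h4 := (h.grad t ht m hm).upper q hq
    have e : P.V s q - P.V t m - (P.totalH t m (p t m) * (s - t) + ∑ i, p t m i * (q i - m i)) =
        (P.V s q - P.V t q - (s - t) * P.totalH t q (p t q)) +
          (s - t) * (P.totalH t q (p t q) - P.totalH t m (p t m)) +
          (P.V t q - P.V t m - ∑ i, p t m i * (q i - m i)) := by ring
    rw [e]
    have g1 : (k' + k₂) * (s - t) ^ 2 ≤ (k' + k₂) * D ^ 2 := by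
      rw [← sq_abs]
      gcongr
    have g2 : |(s - t) * (P.totalH t q (p t q) - P.totalH t m (p t m))| ≤ k₂ * D ^ 2 := by
      rw [abs_mul]
      have g3 : k₂ * ‖q - m‖ ≤ k₂ * D := by gcongr
      calc |s - t| * |P.totalH t q (p t q) - P.totalH t m (p t m)| ≤ D * (k₂ * D) :=
            mul_le_mul d1 (h2.trans g3) (abs_nonneg _) hD0
        _ = k₂ * D ^ 2 := by ring
    have g4 : |P.V t q - P.V t m - ∑ i, p t m i * (q i - m i)| ≤ c * D ^ 2 := by
      rw [abs_of_nonneg h3]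
      have : c * ‖q - m‖ ^ 2 ≤ c * D ^ 2 := by gcongr
      linarith
    refine (abs_add_le _ _).trans ?_
    have := abs_add_le (P.V s q - P.V t q - (s - t) * P.totalH t q (p t q))
      ((s - t) * (P.totalH t q (p t q) - P.totalH t m (p t m)))
    linarith
  have hcont : ∀ {Y : Type} [NormedAddCommGroup Y] (g : ℝ × (Fin d → ℝ) → Y) (k : ℝ), 0 ≤ k →
      (∀ x ∈ Icc 0 P.T ×ˢ stdSimplex ℝ (Fin d), ∀ y ∈ Icc 0 P.T ×ˢ stdSimplex ℝ (Fin d),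
        ‖g x - g y‖ ≤ k * (|x.1 - y.1| + ‖x.2 - y.2‖)) →
      ContinuousOn g (Icc 0 P.T ×ˢ stdSimplex ℝ (Fin d)) := by
    intro Y _ g k hk hg
    refine (LipschitzOnWith.of_dist_le_mul (K := ⟨2 * k, by positivity⟩) fun x hx y hy => ?_).continuousOn
    rw [dist_eq_norm, dist_eq_norm]
    refine (hg x hx y hy).trans ?_
    have h1 : |x.1 - y.1| ≤ ‖x - y‖ := norm_fst_le (x - y)
    have h2 : ‖x.2 - y.2‖ ≤ ‖x - y‖ := norm_snd_le (x - y)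
    have h3 : k * (|x.1 - y.1| + ‖x.2 - y.2‖) ≤ k * (‖x - y‖ + ‖x - y‖) := by gcongr
    refine h3.trans (le_of_eq ?_)
    change _ = 2 * k * ‖x - y‖
    ring
  refine ⟨max k k₂, ⟨?_, ?_, ?_⟩, ?_, ?_⟩
  · intro t ht m hm
    rw [hasFDerivWithinAt_iff_isLittleO]
    refine Asymptotics.IsBigO.trans_isLittleO ?_
      ((Asymptotics.isLittleO_pow_sub_sub (t, m) one_lt_two).mono nhdsWithin_le_nhds)
    refine Asymptotics.IsBigO.of_bound (k' + 2 * k₂ + c) ?_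
    filter_upwards [self_mem_nhdsWithin] with x hx
    have h1 := hquad t ht x.1 hx.1 m hm x.2 hx.2
    rw [norm_pow, norm_norm, Real.norm_eq_abs]
    have e : timeSpaceForm (P.totalH t m (p t m)) (p t m) (x - (t, m)) =
        P.totalH t m (p t m) * (x.1 - t) + ∑ i, p t m i * (x.2 i - m i) :=
      timeSpaceForm_apply _ _ _ _
    rw [e]
    exact h1
  · exact hcont _ k₂ hk₂0 fun x hx y hy => hH _ hx.1 _ hy.1 _ hx.2 _ hy.2
  · exact hcont _ k hk fun x hx y hy => hp _ hx.1 _ hy.1 _ hx.2 _ hy.2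
  · intro t ht s hs m hm q hq
    exact (hH t ht s hs m hm q hq).trans
      (mul_le_mul_of_nonneg_right (le_max_right _ _) (by positivity))
  · intro t ht s hs m hm q hq
    exact (hp t ht s hs m hm q hq).trans
      (mul_le_mul_of_nonneg_right (le_max_left _ _) (by positivity))

end IsGradientField

/-! ### Classical solutions -/

/-- First-order condition at a maximum over `[0,T) × S_d`: the directions `(1, drift)` point into this
set. -/
theorem AssumptionA.add_sum_drift_nonpos {X : Type*} [MetricSpace X] {P : MFCP d X}
    (hA : P.AssumptionA)
    {ψ ψt : ℝ → (Fin d → ℝ) → ℝ} {p : ℝ → (Fin d → ℝ) → (Fin d → ℝ)}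
    (hψ : IsC1On (Ico 0 P.T) (stdSimplex ℝ (Fin d)) ψ ψt p) {t : ℝ} (ht : t ∈ Ico 0 P.T)
    {m : Fin d → ℝ} (hm : m ∈ stdSimplex ℝ (Fin d))
    (hmax : IsLocalMaxOn (fun q : ℝ × (Fin d → ℝ) => ψ q.1 q.2)
      (Ico 0 P.T ×ˢ stdSimplex ℝ (Fin d)) (t, m))
    {a : Fin d → X} (ha : ∀ i, a i ∈ P.A) : ψt t m + ∑ i, p t m i * P.drift t a m i ≤ 0 := by
  obtain ⟨C, hC⟩ := hA.exists_bounds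
  have hC0 := hC.pos
  have htI : t ∈ Icc 0 P.T := ⟨ht.1, ht.2.le⟩
  set ε := min C⁻¹ ((P.T - t) / 2) with hε
  have hTt : 0 < P.T - t := sub_pos.2 ht.2
  have hε0 : 0 < ε := by positivity
  have hmem : ∀ τ ∈ Icc (0 : ℝ) ε, (t + τ, m + τ • P.drift t a m) ∈
      Ico 0 P.T ×ˢ stdSimplex ℝ (Fin d) := by
    intro τ hτ
    have h1 : τ ≤ (P.T - t) / 2 := hτ.2.trans (min_le_right _ _)
    have h2 : τ * C ≤ 1 := by
      have := mul_le_mul_of_nonneg_right (hτ.2.trans (min_le_left _ _)) hC0.le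
      rwa [inv_mul_cancel₀ hC0.ne'] at this
    refine ⟨⟨add_nonneg ht.1 hτ.1, by dsimp only; linarith⟩, fun i => ?_, ?_⟩
    · have h3 := mul_le_mul_of_nonneg_left (hC.inward t htI a ha m hm i) hτ.1
      have h4 := mul_le_mul_of_nonneg_right h2 (hm.1 i)
      simp only [Pi.add_apply, Pi.smul_apply, smul_eq_mul]
      linarith
    · simp [Finset.sum_add_distrib, ← Finset.mul_sum, sum_drift, hm.2]
  have hcone : ε • ((1 : ℝ), P.drift t a m) ∈
      posTangentConeAt (Ico 0 P.T ×ˢ stdSimplex ℝ (Fin d)) (t, m) := by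
    refine mem_posTangentConeAt_of_segment_subset ?_
    rw [segment_eq_image']
    rintro _ ⟨θ, hθ, rfl⟩
    have h1 := hmem (θ * ε) ⟨mul_nonneg hθ.1 hε0.le, mul_le_of_le_one_left hε0.le hθ.2⟩
    convert h1 using 1
    ext <;> simp [mul_assoc]
  have h := hmax.hasFDerivWithinAt_nonpos (hψ.hasDeriv t ht m hm) hcone
  rw [map_smul, timeSpaceForm_apply, mul_one, smul_eq_mul] at h
  exact nonpos_of_mul_nonpos_right h hε0

theorem IsClassicalSolution.isViscositySolution {X : Type*} [MetricSpace X] {P : MFCP d X}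
    {v : ℝ → (Fin d → ℝ) → ℝ} (hv : P.IsClassicalSolution v) (hA : P.AssumptionA) :
    P.IsViscositySolution (stdSimplex ℝ (Fin d)) v := by
  obtain ⟨⟨vt, p, hC1, hHJB⟩, hT⟩ := hv
  have hcont : ContinuousOn (fun q : ℝ × (Fin d → ℝ) => v q.1 q.2)
      (Icc 0 P.T ×ˢ stdSimplex ℝ (Fin d)) := fun x hx =>
    (hC1.hasDeriv x.1 hx.1 x.2 hx.2).continuousWithinAt
  have hcont' := hcont.mono (prod_mono_left (t := stdSimplex ℝ (Fin d))
    (show Ico 0 P.T ⊆ Icc 0 P.T from Ico_subset_Icc_self))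
  have hC1' := hC1.mono (show Ico 0 P.T ⊆ Icc 0 P.T from Ico_subset_Icc_self) Subset.rfl
  refine ⟨hcont, ⟨hcont', ?_⟩, ⟨hcont', ?_⟩, hT⟩
  · intro φ φt r hφ t ht m hm hmax
    have htI : t ∈ Icc 0 P.T := ⟨ht.1, ht.2.le⟩
    obtain ⟨a, ha, hHa⟩ := hA.exists_eq_totalH htI hm (r t m)
    have hmax' : IsLocalMaxOn (fun q : ℝ × (Fin d → ℝ) => v q.1 q.2 + -1 * φ q.1 q.2)
        (Ico 0 P.T ×ˢ stdSimplex ℝ (Fin d)) (t, m) := by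
      simpa only [neg_one_mul, ← sub_eq_add_neg] using hmax
    have h1 := hA.add_sum_drift_nonpos (hC1'.add (hφ.const_mul (-1))) ht hm hmax' ha
    simp only [add_mul, Finset.sum_add_distrib, neg_mul, one_mul, Finset.sum_neg_distrib] at h1
    have h2 := hA.le_totalH htI hm (p t m) ha
    have h3 := hHJB t htI m hm
    linarith
  · intro φ φt r hφ t ht m hm hmin
    have htI : t ∈ Icc 0 P.T := ⟨ht.1, ht.2.le⟩
    obtain ⟨a, ha, hHa⟩ := hA.exists_eq_totalH htI hm (p t m)
    have hmax' : IsLocalMaxOn (fun q : ℝ × (Fin d → ℝ) => φ q.1 q.2 + -1 * v q.1 q.2)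
        (Ico 0 P.T ×ˢ stdSimplex ℝ (Fin d)) (t, m) := by
      have := hmin.neg
      simpa only [neg_one_mul, ← sub_eq_add_neg, neg_sub] using this
    have h1 := hA.add_sum_drift_nonpos (hφ.add (hC1'.const_mul (-1))) ht hm hmax' ha
    simp only [add_mul, Finset.sum_add_distrib, neg_mul, one_mul, Finset.sum_neg_distrib] at h1
    have h2 := hA.le_totalH htI hm (r t m) ha
    have h3 := hHJB t htI m hm
    linarith

theorem AssumptionC.classical (hP : P.AssumptionC M K) :
    (∃ L Vt p, IsC11OnWith L (Icc 0 P.T) (stdSimplex ℝ (Fin d)) P.V Vt p) ∧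
      P.IsClassicalSolution P.V ∧
      ∀ v, P.IsClassicalSolution v →
        ∀ t ∈ Icc 0 P.T, ∀ m ∈ stdSimplex ℝ (Fin d), v t m = P.V t m := by
  have hA := hP.toB.toA
  obtain ⟨c, L, p, hp⟩ := hP.exists_isGradientField
  obtain ⟨L', hV⟩ := hp.isC11OnWith hP.toB
  refine ⟨⟨L', _, p, hV⟩, ⟨⟨_, p, hV.c1, fun t _ m _ => neg_add_cancel _⟩,
    fun m hm => hA.V_terminal hm⟩, fun v hv => ?_⟩
  exact (hA.viscosity_characterization (Or.inl rfl)).2 v (hv.isViscositySolution hA)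

end MFCP

/-! ### The maximizer of the pre-Hamiltonian -/

namespace MFCP

variable {d : ℕ} {P : MFCP d (Fin d → ℝ)} {M : ℝ} {K : Fin d → Finset (Fin d)}

theorem AssumptionB.preH_eq (hB : P.AssumptionB M K) {t : ℝ} (ht : t ∈ Icc 0 P.T) {i : Fin d}
    {m z : Fin d → ℝ} (hm : m ∈ stdSimplex ℝ (Fin d)) (hz : z i = 0) {a : Fin d → ℝ}
    (ha : a ∈ P.A) : P.preH i t a m z = -(∑ j, a j * z j) - P.f i t a m := by
  have : ∑ j, P.Q i j t a m * z j = ∑ j, a j * z j := by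
    refine Finset.sum_congr rfl fun j _ => ?_
    by_cases hj : j = i
    · subst hj; simp [hz]
    · rw [hB.Q_eq i j hj t ht a ha m hm]
  rw [preH, this]

theorem AssumptionB.continuousOn_f (hB : P.AssumptionB M K) {t : ℝ} (ht : t ∈ Icc 0 P.T)
    (i : Fin d) {m : Fin d → ℝ} (hm : m ∈ stdSimplex ℝ (Fin d)) :
    ContinuousOn (fun a => P.f i t a m) P.A := by
  obtain ⟨D, hD, -⟩ := hB.f_convex
  exact fun a ha => (hD i t ht m hm a ha).continuousWithinAt

theorem AssumptionB.exists_isMaximizer (hB : P.AssumptionB M K) {t : ℝ} (ht : t ∈ Icc 0 P.T)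
    {i : Fin d} {m z : Fin d → ℝ} (hm : m ∈ stdSimplex ℝ (Fin d)) (hz : z i = 0) :
    ∃ a, P.IsMaximizer t i m z a ∧ ∀ j, j ∉ K i → a j = 0 := by
  have hc : ContinuousOn (fun a => P.preH i t a m z) P.A := by
    have h1 : ContinuousOn (fun a : Fin d → ℝ => -(∑ j, a j * z j) - P.f i t a m) P.A :=
      ContinuousOn.sub (by fun_prop) (hB.continuousOn_f ht i hm)
    exact h1.congr fun a ha => hB.preH_eq ht hm hz ha
  obtain ⟨a, ha, hmax⟩ := hB.toA.A_compact.exists_isMaxOn hB.toA.A_nonempty hc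
  have hab := ha
  rw [hB.A_eq] at hab
  set b : Fin d → ℝ := fun j => if j ∈ K i then a j else 0 with hb
  have hbA : b ∈ P.A := by
    rw [hB.A_eq]
    refine ⟨fun j => ?_, fun j => ?_⟩
    · by_cases hj : j ∈ K i
      · simpa [hb, hj] using hab.1 j
      · simp [hb, hj]
    · by_cases hj : j ∈ K i
      · simpa [hb, hj] using hab.2 j
      · simpa [hb, hj] using (hab.1 j).trans (hab.2 j)
  have he : P.preH i t b m z = P.preH i t a m z := by
    rw [hB.preH_eq ht hm hz hbA, hB.preH_eq ht hm hz ha,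
      hB.f_dep i t ht m hm b hbA a ha fun j hj => by simp [hb, hj]]
    congr 2
    refine Finset.sum_congr rfl fun j _ => ?_
    by_cases hj : j ∈ K i
    · simp [hb, hj]
    · have hji : j = i := by_contra fun h => hj (hB.mem_K i j h)
      subst hji
      simp [hz]
  exact ⟨b, ⟨hbA, fun c hc => he ▸ hmax hc⟩, fun j hj => by simp [hb, hj]⟩

theorem AssumptionB.aStar_spec (hB : P.AssumptionB M K) {t : ℝ} (ht : t ∈ Icc 0 P.T)
    {i : Fin d} {m z : Fin d → ℝ} (hm : m ∈ stdSimplex ℝ (Fin d)) (hz : z i = 0) :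
    P.IsMaximizer t i m z (P.aStar K t i m z) ∧ ∀ j, j ∉ K i → P.aStar K t i m z j = 0 :=
  Classical.epsilon_spec (hB.exists_isMaximizer ht hm hz)

/-- Uniform convexity of `f` turns into a quadratic gap below the maximum. -/
theorem AssumptionB.exists_gap (hB : P.AssumptionB M K) :
    ∃ l, 0 < l ∧ ∀ t ∈ Icc 0 P.T, ∀ i, ∀ m ∈ stdSimplex ℝ (Fin d), ∀ z : Fin d → ℝ, z i = 0 →
      ∀ a b, P.IsMaximizer t i m z a → b ∈ P.A →
        P.preH i t b m z + l * ∑ j ∈ K i, (b j - a j) ^ 2 ≤ P.preH i t a m z := by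
  obtain ⟨D, -, -, -, l, hl, hD⟩ := hB.f_convex
  refine ⟨l, hl, fun t ht i m hm z hz a b ha hb => ?_⟩
  set s := ∑ j ∈ K i, (b j - a j) ^ 2 with hs
  -- compare `a` with the points `(1 - τ) a + τ b`, and let `τ → 0`
  have hτ : ∀ τ : ℝ, 0 < τ → τ < 1 →
      P.preH i t b m z + l * (1 - τ) * s ≤ P.preH i t a m z := by
    intro τ h0 h1
    have h1' : 0 < 1 - τ := sub_pos.2 h1
    set x : Fin d → ℝ := (1 - τ) • a + τ • b with hx
    have hxA : x ∈ P.A := hB.convex_A ha.1 hb h1'.le h0.le (by ring)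
    have hxa : ∀ j, a j - x j = -(τ * (b j - a j)) := fun j => by
      simp only [hx, Pi.add_apply, Pi.smul_apply, smul_eq_mul]; ring
    have hxb : ∀ j, b j - x j = (1 - τ) * (b j - a j) := fun j => by
      simp only [hx, Pi.add_apply, Pi.smul_apply, smul_eq_mul]; ring
    have e1 := hD i t ht m hm x hxA a ha.1
    have e2 := hD i t ht m hm x hxA b hb
    simp only [hxa, hxb, neg_sq, mul_pow, mul_neg, Finset.sum_neg_distrib,
      mul_left_comm _ τ, mul_left_comm _ (1 - τ), ← Finset.mul_sum, ← hs] at e1 e2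
    have e3 := ha.2 x hxA
    rw [hB.preH_eq ht hm hz ha.1, hB.preH_eq ht hm hz hxA] at e3
    rw [hB.preH_eq ht hm hz ha.1, hB.preH_eq ht hm hz hb]
    have e4 : ∑ j, x j * z j = (1 - τ) * ∑ j, a j * z j + τ * ∑ j, b j * z j := by
      simp only [Finset.mul_sum, ← Finset.sum_add_distrib]
      refine Finset.sum_congr rfl fun j _ => ?_
      simp only [hx, Pi.add_apply, Pi.smul_apply, smul_eq_mul]; ring
    rw [e4] at e3
    have e5 := mul_le_mul_of_nonneg_left e1 h1'.le
    have e6 := mul_le_mul_of_nonneg_left e2 h0.le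
    have e7 : τ * (-(∑ j, b j * z j) - P.f i t b m + l * (1 - τ) * s) ≤
        τ * (-(∑ j, a j * z j) - P.f i t a m) := by
      nlinarith
    exact le_of_mul_le_mul_left e7 h0
  have hlim : Tendsto (fun τ : ℝ => P.preH i t b m z + l * (1 - τ) * s) (𝓝[>] 0)
      (𝓝 (P.preH i t b m z + l * (1 - 0) * s)) :=
    (Continuous.tendsto (by fun_prop) 0).mono_left nhdsWithin_le_nhds
  rw [sub_zero, mul_one] at hlim
  refine le_of_tendsto hlim ?_
  filter_upwards [Ioo_mem_nhdsGT (zero_lt_one (α := ℝ))] with τ h using hτ τ h.1 h.2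

theorem AssumptionB.eq_aStar (hB : P.AssumptionB M K) {t : ℝ} (ht : t ∈ Icc 0 P.T)
    {i : Fin d} {m z : Fin d → ℝ} (hm : m ∈ stdSimplex ℝ (Fin d)) (hz : z i = 0) {a : Fin d → ℝ}
    (ha : P.IsMaximizer t i m z a) {j : Fin d} (hj : j ∈ K i) : a j = P.aStar K t i m z j := by
  obtain ⟨l, hl, hgap⟩ := hB.exists_gap
  obtain ⟨hs, -⟩ := hB.aStar_spec ht hm hz
  have h1 := hgap t ht i m hm z hz _ a hs ha.1
  have h2 := ha.2 _ hs.1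
  have h3 : 0 ≤ ∑ j ∈ K i, (a j - P.aStar K t i m z j) ^ 2 :=
    Finset.sum_nonneg fun _ _ => sq_nonneg _
  have h4 : ∑ j ∈ K i, (a j - P.aStar K t i m z j) ^ 2 = 0 := by nlinarith
  exact sub_eq_zero.1 (pow_eq_zero_iff two_ne_zero |>.1
    ((Finset.sum_eq_zero_iff_of_nonneg fun _ _ => sq_nonneg _).1 h4 j hj))

/-- Normalized vectors do not differ outside `K i`. -/
theorem norm_sq_le_sum_K {i : Fin d} {a b : Fin d → ℝ} (ha : ∀ j, j ∉ K i → a j = 0)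
    (hb : ∀ j, j ∉ K i → b j = 0) : ‖a - b‖ ^ 2 ≤ ∑ j ∈ K i, (a j - b j) ^ 2 := by
  refine (norm_sq_le_sum_sq (a - b)).trans (le_of_eq ?_)
  symm
  refine Finset.sum_subset (Finset.subset_univ _) fun j _ hj => ?_
  rw [ha j hj, hb j hj]; simp

theorem AssumptionB.exists_abs_f_sub_le (hB : P.AssumptionB M K) :
    ∃ L, 0 ≤ L ∧ ∀ t ∈ Icc 0 P.T, ∀ i, ∀ m ∈ stdSimplex ℝ (Fin d), ∀ q ∈ stdSimplex ℝ (Fin d),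
      ∀ a ∈ P.A, ∀ b ∈ P.A,
        |(P.f i t b m - P.f i t b q) - (P.f i t a m - P.f i t a q)| ≤ L * ‖m - q‖ * ‖b - a‖ := by
  obtain ⟨D, hD, -, ⟨L, hL⟩, -⟩ := hB.f_convex
  refine ⟨d * |L|, by positivity, fun t ht i m hm q hq a ha b hb => ?_⟩
  refine hB.convex_A.norm_image_sub_le_of_norm_hasFDerivWithin_le (𝕜 := ℝ)
    (f := fun a => P.f i t a m - P.f i t a q)
    (fun x hx => (hD i t ht m hm x hx).sub (hD i t ht q hq x hx)) (fun x hx => ?_) ha hb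
  refine ContinuousLinearMap.opNorm_le_bound _ (by positivity) fun y => ?_
  have e : ((∑ j, D i t x m j • ContinuousLinearMap.proj (R := ℝ) (φ := fun _ : Fin d => ℝ) j) -
      ∑ j, D i t x q j • ContinuousLinearMap.proj (R := ℝ) (φ := fun _ : Fin d => ℝ) j) y =
      ∑ j, (D i t x m - D i t x q) j * y j := by
    simp [sub_mul, Finset.sum_sub_distrib]
  rw [e, Real.norm_eq_abs]
  refine (abs_sum_mul_le _ _).trans ?_
  have h1 : ‖D i t x m - D i t x q‖ ≤ |L| * ‖m - q‖ :=
    (hL i t ht x hx m hm q hq).trans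
      (mul_le_mul_of_nonneg_right (le_abs_self L) (norm_nonneg _))
  calc (d : ℝ) * ‖D i t x m - D i t x q‖ * ‖y‖ ≤ d * (|L| * ‖m - q‖) * ‖y‖ := by gcongr
    _ = d * |L| * ‖m - q‖ * ‖y‖ := by ring

theorem AssumptionB.exists_norm_aStar_sub_le (hB : P.AssumptionB M K) :
    ∃ k, 0 ≤ k ∧ ∀ t ∈ Icc 0 P.T, ∀ i, ∀ m ∈ stdSimplex ℝ (Fin d), ∀ q ∈ stdSimplex ℝ (Fin d),
      ∀ z z' : Fin d → ℝ, z i = 0 → z' i = 0 →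
        ‖P.aStar K t i m z - P.aStar K t i q z'‖ ≤ k * (‖m - q‖ + ‖z - z'‖) := by
  obtain ⟨l, hl, hgap⟩ := hB.exists_gap
  obtain ⟨L, hL, hf⟩ := hB.exists_abs_f_sub_le
  refine ⟨(d + L) / (2 * l), by positivity, fun t ht i m hm q hq z z' hz hz' => ?_⟩
  obtain ⟨ha, ha'⟩ := hB.aStar_spec ht hm hz
  obtain ⟨hb, hb'⟩ := hB.aStar_spec ht hq hz'
  set a := P.aStar K t i m z
  set b := P.aStar K t i q z'
  have h1 := hgap t ht i m hm z hz a b ha hb.1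
  have h2 := hgap t ht i q hq z' hz' b a hb ha.1
  rw [hB.preH_eq ht hm hz ha.1, hB.preH_eq ht hm hz hb.1] at h1
  rw [hB.preH_eq ht hq hz' ha.1, hB.preH_eq ht hq hz' hb.1] at h2
  have h3 := norm_sq_le_sum_K ha' hb'
  have h4 := norm_sq_le_sum_K hb' ha'
  rw [norm_sub_rev] at h4
  have h5 := (abs_le.1 (hf t ht i m hm q hq a ha.1 b hb.1)).2
  rw [norm_sub_rev b a] at h5
  have h6 := (le_abs_self _).trans (abs_sum_mul_le (a - b) (z' - z))
  have h7 : ∑ j, (a - b) j * (z' - z) j = (∑ j, a j * z' j - ∑ j, b j * z' j) -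
      (∑ j, a j * z j - ∑ j, b j * z j) := by
    simp only [← Finset.sum_sub_distrib, Pi.sub_apply]
    exact Finset.sum_congr rfl fun j _ => by ring
  rw [h7, norm_sub_rev z' z] at h6
  have h8 := mul_le_mul_of_nonneg_left h3 hl.le
  have h9 := mul_le_mul_of_nonneg_left h4 hl.le
  rw [div_mul_eq_mul_div, le_div_iff₀ (by positivity)]
  rcases (norm_nonneg (a - b)).eq_or_lt with h0 | h0
  · rw [← h0, zero_mul]; positivity
  · have h10 : (0 : ℝ) ≤ d * ‖m - q‖ := by positivity
    have h11 : 0 ≤ L * ‖z - z'‖ := by positivity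
    refine le_of_mul_le_mul_left (a := ‖a - b‖) ?_ h0
    have h12 := mul_nonneg h10 h0.le
    have h13 := mul_nonneg h11 h0.le
    linarith

/-- When `m_i > 0`, the Lipschitz continuity of `F` in time makes the maximizer Hölder continuous in
time. -/
theorem AssumptionB.exists_norm_aStar_sub_time_le (hB : P.AssumptionB M K) :
    ∃ k, 0 ≤ k ∧ ∀ t ∈ Icc 0 P.T, ∀ s ∈ Icc 0 P.T, ∀ i, ∀ m ∈ stdSimplex ℝ (Fin d), 0 < m i →
      ∀ z : Fin d → ℝ, z i = 0 →
        m i * ‖P.aStar K t i m z - P.aStar K s i m z‖ ^ 2 ≤ k * |t - s| := by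
  obtain ⟨l, hl, hgap⟩ := hB.exists_gap
  obtain ⟨C, hC⟩ := hB.toA.exists_bounds
  have hC0 := hC.pos
  refine ⟨C / l, by positivity, fun t ht s hs i m hm hi z hz => ?_⟩
  obtain ⟨ha, ha'⟩ := hB.aStar_spec ht hm hz
  obtain ⟨hb, hb'⟩ := hB.aStar_spec hs hm hz
  set a := P.aStar K t i m z
  set b := P.aStar K s i m z
  have h1 := hgap t ht i m hm z hz a b ha hb.1
  have h2 := hgap s hs i m hm z hz b a hb ha.1
  rw [hB.preH_eq ht hm hz ha.1, hB.preH_eq ht hm hz hb.1] at h1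
  rw [hB.preH_eq hs hm hz ha.1, hB.preH_eq hs hm hz hb.1] at h2
  have h3 := norm_sq_le_sum_K ha' hb'
  have h4 := norm_sq_le_sum_K hb' ha'
  rw [norm_sub_rev] at h4
  -- the increment of `m_i f^i` in the action is an increment of `F`
  have hF : ∀ r, m i * (P.f i r b m - P.f i r a m) =
      P.F r (Function.update (fun _ => a) i b) m - P.F r (fun _ => a) m := by
    intro r
    rw [F, F, ← Finset.sum_sub_distrib, Finset.sum_eq_single i]
    · simp [mul_sub]
    · intro j _ hj
      simp [hj]
    · simp
  have hup : ∀ j, Function.update (fun _ => a) i b j ∈ P.A := by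
    intro j
    by_cases hj : j = i
    · subst hj; simpa using hb.1
    · simpa [hj] using ha.1
  have h5 := (abs_le.1 (hC.F_lip t ht s hs _ hup m hm m hm)).2
  have h6 := (abs_le.1 (hC.F_lip t ht s hs _ (fun _ => ha.1) m hm m hm)).1
  rw [sub_self, norm_zero, add_zero] at h5 h6
  have h7 := hF t
  have h8 := hF s
  have h9 : m i * (2 * l * ‖a - b‖ ^ 2) ≤
      m i * ((P.f i t b m - P.f i t a m) - (P.f i s b m - P.f i s a m)) := by
    refine mul_le_mul_of_nonneg_left ?_ hi.le
    have := mul_le_mul_of_nonneg_left h3 hl.le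
    have := mul_le_mul_of_nonneg_left h4 hl.le
    linarith
  rw [mul_sub, h7, h8] at h9
  rw [div_mul_eq_mul_div, le_div_iff₀ hl]
  linarith

/-- By density of the interior and the uniform Lipschitz estimate in `m`, the maximizer is continuous
in time for every `m`. -/
theorem AssumptionB.continuousOn_aStar_time (hB : P.AssumptionB M K) (i : Fin d) {m : Fin d → ℝ}
    (hm : m ∈ stdSimplex ℝ (Fin d)) {z : Fin d → ℝ} (hz : z i = 0) :
    ContinuousOn (fun t => P.aStar K t i m z) (Icc 0 P.T) := by
  obtain ⟨k, hk, hlip⟩ := hB.exists_norm_aStar_sub_le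
  obtain ⟨k', hk', htime⟩ := hB.exists_norm_aStar_sub_time_le
  rw [Metric.continuousOn_iff]
  intro t ht ε hε
  obtain ⟨m', hm', hmm'⟩ := Metric.mem_closure_iff.1 (mem_closure_intSimplex hm)
    (ε / (3 * (k + 1))) (by positivity)
  rw [dist_eq_norm] at hmm'
  have hm'S := intSimplex_subset hm'
  have hm'i := hm'.1 i
  refine ⟨m' i * (ε / 3) ^ 2 / (k' + 1), by positivity, fun s hs hst => ?_⟩
  rw [Real.dist_eq, lt_div_iff₀ (by positivity)] at hst
  rw [dist_eq_norm]
  have h1 := hlip s hs i m hm m' hm'S z z hz hz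
  have h2 := hlip t ht i m' hm'S m hm z z hz hz
  rw [sub_self, norm_zero, add_zero] at h1 h2
  rw [norm_sub_rev m'] at h2
  have h3 := htime s hs t ht i m' hm'S hm'i z hz
  have h4 : ‖P.aStar K s i m' z - P.aStar K t i m' z‖ < ε / 3 := by
    refine lt_of_pow_lt_pow_left₀ 2 (by positivity) (lt_of_mul_lt_mul_left ?_ hm'i.le)
    linarith [abs_nonneg (s - t)]
  have h5 : k * ‖m - m'‖ ≤ ε / 3 := by
    rw [lt_div_iff₀ (by positivity)] at hmm'
    linarith [norm_nonneg (m - m')]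
  have h6 := norm_sub_le_norm_sub_add_norm_sub (P.aStar K s i m z) (P.aStar K s i m' z)
    (P.aStar K t i m z)
  have h7 := norm_sub_le_norm_sub_add_norm_sub (P.aStar K s i m' z) (P.aStar K t i m' z)
    (P.aStar K t i m z)
  linarith

/-! ### The feedback control -/

section Feedback

variable {L : ℝ} {Vt : ℝ → (Fin d → ℝ) → ℝ} {p : ℝ → (Fin d → ℝ) → (Fin d → ℝ)}

theorem simplexD_self (p : Fin d → ℝ) (i : Fin d) : simplexD p i i = 0 := sub_self _

theorem norm_simplexD_sub_le (p p' : Fin d → ℝ) (i : Fin d) :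
    ‖simplexD p i - simplexD p' i‖ ≤ 2 * ‖p - p'‖ := by
  rw [pi_norm_le_iff_of_nonneg (by positivity)]
  intro j
  have h1 := norm_le_pi_norm (p - p') j
  have h2 := norm_le_pi_norm (p - p') i
  have e : (simplexD p i - simplexD p' i) j = (p - p') j - (p - p') i := by
    simp only [simplexD, Pi.sub_apply]; ring
  rw [e]
  exact (norm_sub_le _ _).trans (by linarith)

theorem AssumptionB.isMaximizer_feedback (hB : P.AssumptionB M K) {t : ℝ} (ht : t ∈ Icc 0 P.T)
    {m : Fin d → ℝ} (hm : m ∈ stdSimplex ℝ (Fin d)) (i : Fin d) :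
    P.IsMaximizer t i m (simplexD (p t m) i) (P.feedback K p t m i) :=
  (hB.aStar_spec ht hm (simplexD_self _ _)).1

theorem AssumptionB.continuousOn_feedback (hB : P.AssumptionB M K)
    (hp : ContinuousOn (fun q : ℝ × (Fin d → ℝ) => p q.1 q.2) (Icc 0 P.T ×ˢ stdSimplex ℝ (Fin d)))
    (i : Fin d) : ContinuousOn (fun q : ℝ × (Fin d → ℝ) => P.feedback K p q.1 q.2 i)
      (Icc 0 P.T ×ˢ stdSimplex ℝ (Fin d)) := by
  obtain ⟨k, hk, hlip⟩ := hB.exists_norm_aStar_sub_le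
  rintro ⟨t, m⟩ ⟨ht, hm⟩
  have h1 : Tendsto (fun q : ℝ × (Fin d → ℝ) => ‖p q.1 q.2 - p t m‖)
      (𝓝[Icc 0 P.T ×ˢ stdSimplex ℝ (Fin d)] (t, m)) (𝓝 0) :=
    tendsto_iff_norm_sub_tendsto_zero.1 (hp (t, m) ⟨ht, hm⟩)
  have h2 : Tendsto (fun q : ℝ × (Fin d → ℝ) => ‖q.2 - m‖)
      (𝓝[Icc 0 P.T ×ˢ stdSimplex ℝ (Fin d)] (t, m)) (𝓝 0) :=
    tendsto_iff_norm_sub_tendsto_zero.1 (continuousWithinAt_snd (s := _) (p := (t, m)))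
  have h3 : Tendsto (fun q : ℝ × (Fin d → ℝ) =>
      ‖P.aStar K q.1 i m (simplexD (p t m) i) - P.aStar K t i m (simplexD (p t m) i)‖)
      (𝓝[Icc 0 P.T ×ˢ stdSimplex ℝ (Fin d)] (t, m)) (𝓝 0) :=
    tendsto_iff_norm_sub_tendsto_zero.1
      (((hB.continuousOn_aStar_time i hm (simplexD_self (p t m) i)).comp continuousOn_fst
        fun q hq => hq.1) (t, m) ⟨ht, hm⟩)
  refine tendsto_iff_norm_sub_tendsto_zero.2 ?_
  have h4 := ((h2.add (h1.const_mul 2)).const_mul k).add h3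
  simp only [mul_zero, add_zero] at h4
  refine squeeze_zero' (Eventually.of_forall fun _ => norm_nonneg _) ?_ h4
  filter_upwards [self_mem_nhdsWithin] with q hq
  have h5 := hlip q.1 hq.1 i q.2 hq.2 m hm (simplexD (p q.1 q.2) i) (simplexD (p t m) i)
    (simplexD_self _ _) (simplexD_self _ _)
  have h6 := norm_simplexD_sub_le (p q.1 q.2) (p t m) i
  refine (norm_sub_le_norm_sub_add_norm_sub _
    (P.aStar K q.1 i m (simplexD (p t m) i)) _).trans (add_le_add (h5.trans ?_) le_rfl)
  gcongr

theorem AssumptionB.norm_drift_sub_le (hB : P.AssumptionB M K) {t : ℝ} (ht : t ∈ Icc 0 P.T)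
    {a b : Fin d → Fin d → ℝ} (ha : ∀ i, a i ∈ P.A) (hb : ∀ i, b i ∈ P.A) {m : Fin d → ℝ}
    (hm : m ∈ stdSimplex ℝ (Fin d)) : ‖P.drift t a m - P.drift t b m‖ ≤ 2 * d * ‖a - b‖ := by
  rw [pi_norm_le_iff_of_nonneg (by positivity)]
  intro i
  rw [Pi.sub_apply, hB.drift_eq ht ha hm, hB.drift_eq ht hb hm, ← Finset.sum_sub_distrib]
  refine (norm_sum_le _ _).trans ?_
  have h : ∀ j ∈ Finset.univ, ‖(m j * a j i - m i * a i j) - (m j * b j i - m i * b i j)‖ ≤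
      2 * ‖a - b‖ := by
    intro j _
    have e : (m j * a j i - m i * a i j) - (m j * b j i - m i * b i j) =
        m j * (a - b) j i - m i * (a - b) i j := by
      simp only [Pi.sub_apply]; ring
    have h1 : ∀ x y, ‖m x * (a - b) x y‖ ≤ ‖a - b‖ := by
      intro x y
      rw [norm_mul, Real.norm_of_nonneg (hm.1 x)]
      refine (mul_le_of_le_one_left (norm_nonneg _) (stdSimplex_le_one hm x)).trans ?_
      exact (norm_le_pi_norm ((a - b) x) y).trans (norm_le_pi_norm (a - b) x)
    rw [e]
    exact (norm_sub_le _ _).trans (by linarith [h1 j i, h1 i j])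
  refine (Finset.sum_le_sum h).trans (le_of_eq ?_)
  simp only [Finset.sum_const, Finset.card_univ, Fintype.card_fin, nsmul_eq_mul]
  ring

theorem AssumptionB.exists_simplexField (hB : P.AssumptionB M K)
    (hV : IsC11OnWith L (Icc 0 P.T) (stdSimplex ℝ (Fin d)) P.V Vt p) {t₀ : ℝ} (ht₀ : 0 ≤ t₀) :
    ∃ C, SimplexField (fun t m => P.drift t (P.feedback K p t m) m) t₀ P.T C := by
  have hA := hB.toA
  obtain ⟨k, hk, hlip⟩ := hB.exists_norm_aStar_sub_le
  obtain ⟨C, hC⟩ := hA.exists_bounds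
  have hC0 := hC.pos
  set k' := 2 * d * (k * (1 + 2 * |L|)) with hk'
  have hk'0 : 0 ≤ k' := by positivity
  have hI : ∀ t ∈ Icc t₀ P.T, t ∈ Icc 0 P.T := fun t ht => ⟨ht₀.trans ht.1, ht.2⟩
  have hfA : ∀ t ∈ Icc t₀ P.T, ∀ m ∈ stdSimplex ℝ (Fin d), ∀ i, P.feedback K p t m i ∈ P.A :=
    fun t ht m hm i => (hB.isMaximizer_feedback (hI t ht) hm i).1
  refine ⟨C + k', by positivity, fun t _ m _ => sum_drift _ _ _ _, fun t ht m hm i => ?_,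
    fun t ht m hm q hq => ?_, fun ν hν hνS i => ?_⟩
  · have h1 := hC.inward t (hI t ht) _ (hfA t ht m hm) m hm i
    have h2 := mul_nonneg hk'0 (hm.1 i)
    linarith
  · have ht' := hI t ht
    have h1 := hC.drift_lip t ht' t ht' _ (hfA t ht m hm) m hm q hq
    rw [sub_self, abs_zero, zero_add] at h1
    have h2 := hB.norm_drift_sub_le ht' (hfA t ht m hm) (hfA t ht q hq) hq
    have h3 : ‖P.feedback K p t m - P.feedback K p t q‖ ≤ k * (1 + 2 * |L|) * ‖m - q‖ := by
      rw [pi_norm_le_iff_of_nonneg (by positivity)]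
      intro i
      have h4 := hlip t ht' i m hm q hq (simplexD (p t m) i) (simplexD (p t q) i)
        (simplexD_self _ _) (simplexD_self _ _)
      have h5 := norm_simplexD_sub_le (p t m) (p t q) i
      have h6 := hV.lip_space t ht' t ht' m hm q hq
      rw [sub_self, abs_zero, zero_add] at h6
      have h7 : L * ‖m - q‖ ≤ |L| * ‖m - q‖ := by gcongr; exact le_abs_self L
      have h8 : k * (‖m - q‖ + ‖simplexD (p t m) i - simplexD (p t q) i‖) ≤
          k * (‖m - q‖ + 2 * (|L| * ‖m - q‖)) := by
        gcongr
        linarith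
      refine h4.trans (h8.trans (le_of_eq ?_))
      ring
    have h4 : 2 * d * ‖P.feedback K p t m - P.feedback K p t q‖ ≤ k' * ‖m - q‖ := by
      rw [hk', mul_assoc (2 * (d : ℝ))]
      gcongr
    have h5 := norm_sub_le_norm_sub_add_norm_sub (P.drift t (P.feedback K p t m) m)
      (P.drift t (P.feedback K p t m) q) (P.drift t (P.feedback K p t q) q)
    linarith
  · have hc : ContinuousOn (fun r => P.drift r (P.feedback K p r (ν r)) (ν r) i)
        (Icc t₀ P.T) := by
      refine (hA.continuousOn_drift i).comp
        (f := fun r => (r, (fun i => P.feedback K p r (ν r) i), ν r)) ?_ fun r hr =>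
          ⟨hI r hr, fun j _ => hfA r hr _ (hνS r hr) j, hνS r hr⟩
      refine continuousOn_id.prodMk (ContinuousOn.prodMk (continuousOn_pi.2 fun j => ?_) hν)
      exact (hB.continuousOn_feedback hV.c1.cont_space j).comp
        (f := fun r => (r, ν r)) (continuousOn_id.prodMk hν) fun r hr => ⟨hI r hr, hνS r hr⟩
    exact hc.aestronglyMeasurable measurableSet_Icc

theorem AssumptionB.exists_isAdmissible_feedback (hB : P.AssumptionB M K)
    (hV : IsC11OnWith L (Icc 0 P.T) (stdSimplex ℝ (Fin d)) P.V Vt p) {t₀ : ℝ}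
    (ht₀ : t₀ ∈ Icc 0 P.T) {m₀ : Fin d → ℝ} (hm₀ : m₀ ∈ stdSimplex ℝ (Fin d)) :
    ∃ μ, P.IsAdmissible t₀ m₀ (fun s => P.feedback K p s (μ s)) μ := by
  obtain ⟨C, hC⟩ := hB.exists_simplexField hV ht₀.1
  obtain ⟨μ, hμc, hμS, hμ⟩ := hC.exists_solution ht₀.2 hm₀
  have hI : ∀ t ∈ Icc t₀ P.T, t ∈ Icc 0 P.T := fun t ht => ⟨ht₀.1.trans ht.1, ht.2⟩
  refine ⟨μ, fun i => ?_, fun s hs i => (hB.isMaximizer_feedback (hI s hs) (hμS s hs) i).1,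
    hμS, hμc, hμ⟩
  have h : ContinuousOn (fun s => P.feedback K p s (μ s) i) (Icc t₀ P.T) :=
    (hB.continuousOn_feedback hV.c1.cont_space i).comp
      (f := fun r => (r, μ r)) (continuousOn_id.prodMk hμc) fun r hr => ⟨hI r hr, hμS r hr⟩
  exact h.domRestrict.measurable

/-- The value function is its own test function. -/
theorem AssumptionA.time_deriv_eq_totalH {X : Type*} [MetricSpace X] [MeasurableSpace X]
    [BorelSpace X] {P : MFCP d X} (hA : P.AssumptionA)
    (hV : IsC1On (Icc 0 P.T) (stdSimplex ℝ (Fin d)) P.V Vt p) {t : ℝ} (ht : t ∈ Ico 0 P.T)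
    {m : Fin d → ℝ} (hm : m ∈ stdSimplex ℝ (Fin d)) : Vt t m = P.totalH t m (p t m) := by
  obtain ⟨h, -⟩ := hA.viscosity_characterization (S := stdSimplex ℝ (Fin d)) (Or.inl rfl)
  have hV' := hV.mono (Ico_subset_Icc_self : Ico 0 P.T ⊆ Icc 0 P.T) Subset.rfl
  have h1 := h.sub.2 _ _ _ hV' t ht m hm (by simp [IsLocalMaxOn, IsMaxFilter])
  have h2 := h.super.2 _ _ _ hV' t ht m hm (by simp [IsLocalMinOn, IsMinFilter])
  linarith

/-- Verification: the cost exceeds the value by the integral of the defect of optimality in the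
Hamiltonian. -/
theorem IsAdmissible.J_sub_V_eq {X : Type*} [MetricSpace X] [MeasurableSpace X]
    [BorelSpace X] {P : MFCP d X} {t₀ : ℝ} {m₀ : Fin d → ℝ} {α : ℝ → Fin d → X}
    {ν : ℝ → Fin d → ℝ} (h : P.IsAdmissible t₀ m₀ α ν) (hA : P.AssumptionA)
    (hV : IsC1On (Icc 0 P.T) (stdSimplex ℝ (Fin d)) P.V Vt p) (ht₀ : t₀ ∈ Icc 0 P.T) :
    IntervalIntegrable (fun r => Vt r (ν r) + ∑ i, p r (ν r) i * P.drift r (α r) (ν r) i +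
      P.F r (α r) (ν r)) volume t₀ P.T ∧
    P.J t₀ α ν - P.V t₀ m₀ =
      ∫ r in t₀..P.T, (Vt r (ν r) + ∑ i, p r (ν r) i * P.drift r (α r) (ν r) i +
        P.F r (α r) (ν r)) := by
  obtain ⟨h1, h2⟩ := h.test_add_cost hA hV ht₀.1 ht₀.2 le_rfl
    (Icc_subset_Icc_left ht₀.1) h.mem_simplex
  refine ⟨h1, ?_⟩
  rw [← h2, hA.V_terminal (h.mem_simplex _ ⟨ht₀.2, le_rfl⟩), J]
  ring

theorem AssumptionB.isOptimal_feedback (hB : P.AssumptionB M K)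
    (hV : IsC11OnWith L (Icc 0 P.T) (stdSimplex ℝ (Fin d)) P.V Vt p) {t₀ : ℝ}
    (ht₀ : t₀ ∈ Icc 0 P.T) {m₀ : Fin d → ℝ} {μ : ℝ → Fin d → ℝ}
    (hμ : P.IsAdmissible t₀ m₀ (fun s => P.feedback K p s (μ s)) μ) :
    P.J t₀ (fun s => P.feedback K p s (μ s)) μ = P.V t₀ m₀ := by
  have hA := hB.toA
  obtain ⟨h1, h2⟩ := hμ.J_sub_V_eq hA hV.c1 ht₀
  rw [intervalIntegral.integral_zero_ae] at h2
  · exact sub_eq_zero.1 h2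
  · have hne : ∀ᵐ r : ℝ, r ≠ P.T := by simp [ae_iff, measure_singleton]
    filter_upwards [hne] with r hr hr'
    rw [uIoc_of_le ht₀.2] at hr'
    have hr0 : r ∈ Ico 0 P.T := ⟨ht₀.1.trans hr'.1.le, lt_of_le_of_ne hr'.2 hr⟩
    have hμr := hμ.mem_simplex r ⟨hr'.1.le, hr'.2⟩
    have h3 := sum_mul_preH P r (P.feedback K p r (μ r)) (μ r) (p r (μ r))
    have h4 : P.totalH r (μ r) (p r (μ r)) = ∑ i, μ r i *
        P.preH i r (P.feedback K p r (μ r) i) (μ r) (simplexD (p r (μ r)) i) :=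
      Finset.sum_congr rfl fun i _ => by
        rw [(hB.isMaximizer_feedback (p := p) ⟨hr0.1, hr0.2.le⟩ hμr i).H_eq]
    rw [hA.time_deriv_eq_totalH hV.c1 hr0 hμr, h4, h3]
    ring

/-- Along a trajectory of minimal cost, the control maximizes the pre-Hamiltonians at almost every
time, in the states of positive mass. -/
theorem AssumptionB.ae_eq_feedback (hB : P.AssumptionB M K)
    (hV : IsC11OnWith L (Icc 0 P.T) (stdSimplex ℝ (Fin d)) P.V Vt p) {t₀ : ℝ}
    (ht₀ : t₀ ∈ Icc 0 P.T) {m₀ : Fin d → ℝ} {α : ℝ → Fin d → Fin d → ℝ} {ν : ℝ → Fin d → ℝ}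
    (hν : P.IsAdmissible t₀ m₀ α ν) (hJ : P.J t₀ α ν = P.V t₀ m₀) :
    ∀ᵐ s ∂(volume.restrict (Icc t₀ P.T)), ∀ i, 0 < ν s i →
      ∀ j ∈ K i, α s i j = P.feedback K p s (ν s) i j := by
  have hA := hB.toA
  obtain ⟨h1, h2⟩ := hν.J_sub_V_eq hA hV.c1 ht₀
  rw [hJ, sub_self] at h2
  have hne : ∀ᵐ r ∂(volume.restrict (Ioc t₀ P.T)), r ≠ P.T :=
    ae_restrict_of_ae (by simp [ae_iff, measure_singleton])
  have hmem : ∀ᵐ r ∂(volume.restrict (Ioc t₀ P.T)), r ∈ Ioc t₀ P.T :=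
    ae_restrict_mem measurableSet_Ioc
  have hnonneg : 0 ≤ᵐ[volume.restrict (Ioc t₀ P.T)] fun r =>
      Vt r (ν r) + ∑ i, p r (ν r) i * P.drift r (α r) (ν r) i + P.F r (α r) (ν r) := by
    filter_upwards [hne, hmem] with r hr hr'
    have hr0 : r ∈ Ico 0 P.T := ⟨ht₀.1.trans hr'.1.le, lt_of_le_of_ne hr'.2 hr⟩
    have hrI : r ∈ Icc t₀ P.T := ⟨hr'.1.le, hr'.2⟩
    have h3 := hA.le_totalH ⟨hr0.1, hr0.2.le⟩ (hν.mem_simplex r hrI) (p r (ν r)) (hν.mem_A r hrI)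
    rw [hA.time_deriv_eq_totalH hV.c1 hr0 (hν.mem_simplex r hrI)]
    simp only [Pi.zero_apply]
    linarith
  have hzero := (intervalIntegral.integral_eq_zero_iff_of_le_of_nonneg_ae ht₀.2 hnonneg h1).1
    h2.symm
  rw [← restrict_Ioc_eq_restrict_Icc]
  filter_upwards [hne, hmem, hzero] with r hr hr' hz i hi j hj
  have hr0 : r ∈ Ico 0 P.T := ⟨ht₀.1.trans hr'.1.le, lt_of_le_of_ne hr'.2 hr⟩
  have hrT : r ∈ Icc 0 P.T := ⟨hr0.1, hr0.2.le⟩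
  have hrI : r ∈ Icc t₀ P.T := ⟨hr'.1.le, hr'.2⟩
  have hνr := hν.mem_simplex r hrI
  have h3 := sum_mul_preH P r (α r) (ν r) (p r (ν r))
  rw [hA.time_deriv_eq_totalH hV.c1 hr0 hνr] at hz
  simp only [Pi.zero_apply] at hz
  have h4 : ∑ i, (ν r i * P.H i r (ν r) (simplexD (p r (ν r)) i) -
      ν r i * P.preH i r (α r i) (ν r) (simplexD (p r (ν r)) i)) = 0 := by
    rw [Finset.sum_sub_distrib, h3]
    change P.totalH r (ν r) (p r (ν r)) - _ = 0
    linarith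
  have h5 := (Finset.sum_eq_zero_iff_of_nonneg fun i _ =>
    sub_nonneg.2 (hA.mul_preH_le hrT hνr i _ (hν.mem_A r hrI i))).1 h4 i (Finset.mem_univ i)
  have h6 := mul_left_cancel₀ hi.ne' (sub_eq_zero.1 h5)
  have hf := hB.isMaximizer_feedback (p := p) hrT hνr i
  rw [hf.H_eq] at h6
  exact hB.eq_aStar hrT hνr (simplexD_self _ _)
    ⟨hν.mem_A r hrI i, fun b hb => (hf.2 b hb).trans h6.le⟩ hj

theorem AssumptionB.feedback_optimal (hB : P.AssumptionB M K)
    (hV : IsC11OnWith L (Icc 0 P.T) (stdSimplex ℝ (Fin d)) P.V Vt p) {t₀ : ℝ}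
    (ht₀ : t₀ ∈ Icc 0 P.T) {m₀ : Fin d → ℝ} (hm₀ : m₀ ∈ stdSimplex ℝ (Fin d)) :
    ∃ μ : ℝ → Fin d → ℝ, P.IsOptimal t₀ m₀ (fun s => P.feedback K p s (μ s)) μ ∧
      ∀ α ν, P.IsOptimal t₀ m₀ α ν → (∀ s ∈ Icc t₀ P.T, ν s = μ s) ∧
        ∀ᵐ s ∂(volume.restrict (Icc t₀ P.T)), ∀ i, m₀ ∈ intSimplex d ∨ 0 < ν s i →
          ∀ j ∈ K i, α s i j = P.feedback K p s (ν s) i j := by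
  have hA := hB.toA
  have hI : ∀ t ∈ Icc t₀ P.T, t ∈ Icc 0 P.T := fun t ht => ⟨ht₀.1.trans ht.1, ht.2⟩
  obtain ⟨μ, hμ⟩ := hB.exists_isAdmissible_feedback hV ht₀ hm₀
  have hμJ := hB.isOptimal_feedback hV ht₀ hμ
  refine ⟨μ, ⟨hμ, fun β ν hν => hμJ ▸ hν.V_le hA ht₀⟩, fun α ν hν => ?_⟩
  obtain ⟨hν, hopt⟩ := hν
  have hνJ : P.J t₀ α ν = P.V t₀ m₀ :=
    le_antisymm ((hopt _ _ hμ).trans hμJ.le) (hν.V_le hA ht₀)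
  have hae := hB.ae_eq_feedback hV ht₀ hν hνJ
  obtain ⟨C, hC⟩ := hB.exists_simplexField hV ht₀.1
  have h0mem : t₀ ∈ Icc t₀ P.T := ⟨le_rfl, ht₀.2⟩
  have hTmem : P.T ∈ Icc t₀ P.T := ⟨ht₀.2, le_rfl⟩
  constructor
  · -- `ν` solves the closed-loop equation, since the states without mass do not contribute
    have hlip : ∀ᵐ r, r ∈ Icc t₀ P.T →
        ‖P.drift r (α r) (ν r) - P.drift r (P.feedback K p r (μ r)) (μ r)‖ ≤ C * ‖ν r - μ r‖ := by
      filter_upwards [(ae_restrict_iff' measurableSet_Icc).1 hae] with r hr hrI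
      have hνr := hν.mem_simplex r hrI
      have hfA : ∀ i, P.feedback K p r (ν r) i ∈ P.A := fun i =>
        (hB.isMaximizer_feedback (hI r hrI) hνr i).1
      have key : ∀ i j, j ≠ i → ν r i * α r i j = ν r i * P.feedback K p r (ν r) i j := by
        intro i j hij
        rcases (hνr.1 i).eq_or_lt with h0 | h0
        · rw [← h0, zero_mul, zero_mul]
        · rw [hr hrI i h0 j (hB.mem_K i j hij)]
      have heq : P.drift r (α r) (ν r) = P.drift r (P.feedback K p r (ν r)) (ν r) := by
        funext i
        rw [hB.drift_eq (hI r hrI) (hν.mem_A r hrI) hνr, hB.drift_eq (hI r hrI) hfA hνr]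
        refine Finset.sum_congr rfl fun j _ => ?_
        by_cases hij : j = i
        · subst hij; rw [sub_self, sub_self]
        · rw [key i j hij, key j i (Ne.symm hij)]
      rw [heq]
      exact hC.lip r hrI _ hνr _ (hμ.mem_simplex r hrI)
    intro s hs
    have h1 := norm_sub_le_exp_of_integral_eq hC.pos.le hν.continuousOn hμ.continuousOn
      (hν.intervalIntegrable_drift hA ht₀.1 h0mem hTmem)
      (hμ.intervalIntegrable_drift hA ht₀.1 h0mem hTmem) hν.state_eq hμ.state_eq hlip s hs
    rw [sub_self, norm_zero, zero_mul] at h1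
    exact sub_eq_zero.1 (norm_le_zero_iff.1 h1)
  · filter_upwards [hae, ae_restrict_mem measurableSet_Icc] with s hs hsI i hi
    refine hs i (hi.elim (fun hm => ?_) id)
    exact hν.pos hA ht₀.1 hsI (hm.1 i)

end Feedback

end MFCP

theorem theorem2p5 (d : ℕ) :
    -- consequences of Assumption A
    (∀ (X : Type*) [MetricSpace X] [MeasurableSpace X] [BorelSpace X] (P : MFCP d X),
      P.AssumptionA →
        -- `V` is Lipschitz on `[0,T] × S_d`
        (∃ C : ℝ, ∀ t ∈ Icc 0 P.T, ∀ s ∈ Icc 0 P.T, ∀ m ∈ stdSimplex ℝ (Fin d),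
          ∀ q ∈ stdSimplex ℝ (Fin d), |P.V t m - P.V s q| ≤ C * (|t - s| + ‖m - q‖)) ∧
        -- `V` is the unique viscosity solution on `S_d`, and on `Int(S_d)`
        (∀ S : Set (Fin d → ℝ), S = stdSimplex ℝ (Fin d) ∨ S = intSimplex d →
          P.IsViscositySolution S P.V ∧
          ∀ v, P.IsViscositySolution S v →
            ∀ t ∈ Icc 0 P.T, ∀ m ∈ stdSimplex ℝ (Fin d), v t m = P.V t m)) ∧
    (∀ (P : MFCP d (Fin d → ℝ)) (M : ℝ) (K : Fin d → Finset (Fin d)),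
      -- under Assumption B there exist optimal controls
      (P.AssumptionB M K → ∀ t₀ ∈ Icc 0 P.T, ∀ m₀ ∈ stdSimplex ℝ (Fin d),
        ∃ α μ, P.IsOptimal t₀ m₀ α μ) ∧
      -- under Assumption C, `V` is `C^{1,1}` and is the unique classical solution
      (P.AssumptionC M K →
        (∃ L Vt p, IsC11OnWith L (Icc 0 P.T) (stdSimplex ℝ (Fin d)) P.V Vt p) ∧
        P.IsClassicalSolution P.V ∧
        ∀ v, P.IsClassicalSolution v →
          ∀ t ∈ Icc 0 P.T, ∀ m ∈ stdSimplex ℝ (Fin d), v t m = P.V t m) ∧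
      -- under Assumption B, if `V` is `C^{1,1}`, the feedback is the unique optimal control
      (P.AssumptionB M K → ∀ L Vt p,
        IsC11OnWith L (Icc 0 P.T) (stdSimplex ℝ (Fin d)) P.V Vt p →
          -- `a^*` is the maximizer of the pre-Hamiltonian, unique in the components that matter
          (∀ t ∈ Icc 0 P.T, ∀ i, ∀ m ∈ stdSimplex ℝ (Fin d), ∀ z : Fin d → ℝ, z i = 0 →
            P.IsMaximizer t i m z (P.aStar K t i m z) ∧
            ∀ a, P.IsMaximizer t i m z a → ∀ j ∈ K i, a j = P.aStar K t i m z j) ∧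
          -- the control given by the feedback is optimal, and every optimal control equals it
          ∀ t₀ ∈ Icc 0 P.T, ∀ m₀ ∈ stdSimplex ℝ (Fin d), ∃ μ : ℝ → Fin d → ℝ,
            P.IsOptimal t₀ m₀ (fun s => P.feedback K p s (μ s)) μ ∧
            ∀ α ν, P.IsOptimal t₀ m₀ α ν →
              (∀ s ∈ Icc t₀ P.T, ν s = μ s) ∧
              ∀ᵐ s ∂(volume.restrict (Icc t₀ P.T)), ∀ i, m₀ ∈ intSimplex d ∨ 0 < ν s i →
                ∀ j ∈ K i, α s i j = P.feedback K p s (ν s) i j)) := by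
  refine ⟨fun X _ _ _ P hA => ⟨?_, fun S hS => hA.viscosity_characterization hS⟩,
    fun P M K => ⟨fun hB t₀ ht₀ m₀ hm₀ => ?_, fun hP => hP.classical,
      fun hB L Vt p hV => ⟨fun t ht i m hm z hz => ⟨(hB.aStar_spec ht hm hz).1,
        fun a ha j hj => hB.eq_aStar ht hm hz ha hj⟩,
        fun t₀ ht₀ m₀ hm₀ => hB.feedback_optimal hV ht₀ hm₀⟩⟩⟩
  · obtain ⟨L, -, hL⟩ := hA.V_lipschitz
    exact ⟨L, hL⟩
  · obtain ⟨α, μ, hμ, hJ⟩ := hB.exists_isOptimal ht₀ hm₀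
    exact ⟨α, μ, hμ, fun β ν hν => hJ ▸ hν.V_le hB.toA ht₀⟩
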